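/- **Setting.** In $\mathrm{PGL}_2(\mathbb R)$ put $S=\begin{pmatrix}0&1\\-1&0\end{pmatrix}$, $T=k_1=\begin{pmatrix}1&2\\0&1\end{pmatrix}$, $Q=\begin{pmatrix}0&1\\1&0\end{pmatrix}$, $J=\begin{pmatrix}-1&0\\0&1\end{pmatrix}$, $k_2=\begin{pmatrix}2&1\\-1&0\end{pmatrix}$. The Theta group is $\Gamma=\langle S,T\rangle$, and $\widetilde\Gamma=\langle S,T,Q\rangle$ (which contains $J$ and $k_2$). Let $\chi$ be a unitary representation of $\widetilde\Gamma$ on a finite-dimensional complex inner product space $V$. For $s\in\mathbb C$, $g\in\widetilde\Gamma$ and a $V$-valued function $f$ put $\alpha_s(g^{-1})f(x)=|g'(x)|^s\,\chi(g^{-1})f(g.x)$ for those real $x$ for which $g.x$ lies in the domain of $f$; here $g.x=\frac{ax+b}{cx+d}$ and $|g'(x)|=|ad-bc|\,(cx+d)^{-2}$ for $g=\begin{pmatrix}a&b\\c&d\end{pmatrix}$. Throughout, the upper signs (even case) or the lower signs (odd case) are taken simultaneously. **Slow side.** Let $\mathcal L_s^{\mathrm{slow},\pm}=\alpha_s(k_1^{-1})+\alpha_s(k_2)\pm\alpha_s(k_2J)$,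 and let $\mathrm{SFE}_s^{\omega,\pm}$ be the space of real-analytic $\varphi\colon(-1,\infty)\to V$ with $\varphi=\mathcal L_s^{\mathrm{slow},\pm}\varphi$. * $\mathrm{SFE}_s^{\omega,\mathrm{as},\pm}$ is its subspace of those $\varphi$ for which there are $c_1,c_2\in V$ with $\varphi(x)=c_1x^{1-2s}+O(x^{-2s})$ as $x\to\infty$ and $\varphi(x)=\frac{c_2}{x+1}+O(1)$ as $x\to-1^+$. * $\mathrm{SFE}_s^{\omega,\mathrm{dec},\pm}$ is the subspace of those $\varphi\in\mathrm{SFE}_s^{\omega,\pm}$ for which the function $\varphi\pm\alpha_s(Q)\varphi$ on $(0,\infty)$, $-\alpha_s(S)\varphi\mp\alpha_s(J)\varphi$ on $(-\infty,0)$ extends to a $C^\infty$ function on $\mathbb R$, and the function $\varphi$ on $(-1,\infty)$, $\mp\alpha_s(T^{-1}J)\varphi$ on $(-\infty,-1)$ extends smoothly to $P^1(\mathbb R)$, i.e. has a $C^\infty$ extension $F$ to $\mathbb R$ such that $\alpha_s(S)F$ extends to a $C^\infty$ function across $0$. **Fast side.** Let $E_a=(-1,0)$, $E_b=(0,1)$,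 $E_c=(1,\infty)$. Let $\mathcal B(E_a)$, $\mathcal B(E_b)$ be the spaces of functions on $E_a$, $E_b$ with values in $V$ that extend holomorphically to a complex neighbourhood of $[-1,0]$, $[0,1]$ respectively, and let $\mathcal B(E_c)$ be the space of functions $f$ on $E_c$ for which $\alpha_s(Q)f$ on $(0,1)$ extends holomorphically to a complex neighbourhood of $[0,1]$ (holomorphy near $[1,\infty]$, with $\infty$ read in the chart given by the action). Put $\mathcal B=\mathcal B(E_a)\oplus\mathcal B(E_b)\oplus\mathcal B(E_c)$. For $\mathrm{Re}\,s>\frac12$ let $$\mathcal L_{1,s}^{\mathrm{fast}}=\sum_{n\ge1}\alpha_s(k_1^{-n}),\qquad \mathcal L_{2,s}^{\mathrm{fast}}=\sum_{n\ge1}\alpha_s(k_2^{n}),$$ acting on $\mathcal B(E_c)$ and $\mathcal B(E_a)$ and producing functions on $(-1,\infty)$. For the other $s$ with $\mathrm{Re}\,s>0$, $s\ne\frac12$, they are defined by holomorphic continuation in $s$ from $\{\mathrm{Re}\,s>\frac12\}$ to $\{\mathrm{Re}\,s>0,\ s\neq\frac12\}$, where $f_a\in\mathcal B(E_a)$, respectively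 $\alpha_s(Q)f_c$ for $f_c\in\mathcal B(E_c)$, is kept fixed. Let $\mathrm{FFE}_s^\pm$ be the space of $f=(f_a,f_b,f_c)^\top\in\mathcal B$ with $f=\mathcal L_s^{\mathrm{fast},\pm}f$, where $$\mathcal L_s^{\mathrm{fast},\pm}=\begin{pmatrix}0&\pm\alpha_s(k_2J)&\mathcal L_{1,s}^{\mathrm{fast}}\\ \mathcal L_{2,s}^{\mathrm{fast}}&\pm\alpha_s(k_2J)&\mathcal L_{1,s}^{\mathrm{fast}}\\ \mathcal L_{2,s}^{\mathrm{fast}}&\pm\alpha_s(k_2J)&0\end{pmatrix}.$$ Let $\mathrm{FFE}_s^{\mathrm{dec},\pm}$ be the subspace of those $f\in\mathrm{FFE}_s^\pm$ for which, with $A=(1+\mathcal L_{2,s}^{\mathrm{fast}})f_a$ on $E_a$ and $C=(1+\mathcal L_{1,s}^{\mathrm{fast}})f_c$ on $E_c$, the following functions extend to $C^\infty$ functions on the stated intervals: * $f_b\pm\alpha_s(Q)C$ on $(0,1)$, $-\alpha_s(S)C\mp\alpha_s(J)f_b$ on $(-1,0)$, to $(-1,1)$; * $A$ on $(-1,0)$,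 $\mp\alpha_s(T^{-1}J)A$ on $(-2,-1)$, to $(-2,0)$; * $\alpha_s(S)C$ on $(-1,0)$, $\mp\alpha_s(ST^{-1}J)C$ on $(0,\frac13)$, to $(-1,\frac13)$. **Theorem.** Let $s\in\mathbb C\setminus\{\frac12\}$ with $\mathrm{Re}\,s>0$. Then $\mathcal L_{1,s}^{\mathrm{fast}}$ and $\mathcal L_{2,s}^{\mathrm{fast}}$ are well defined on $\mathcal B(E_c)$ and $\mathcal B(E_a)$, and the spaces $\mathrm{FFE}_s^\pm$ and $\mathrm{SFE}_s^{\omega,\mathrm{as},\pm}$ are isomorphic as complex vector spaces. The isomorphism $\mathrm{FFE}_s^\pm\to\mathrm{SFE}_s^{\omega,\mathrm{as},\pm}$, $f\mapsto\varphi$, is given by $$\varphi|_{E_a}=(1+\mathcal L_{2,s}^{\mathrm{fast}})f_a|_{E_a},\qquad\varphi|_{E_b}=f_b|_{E_b},\qquad\varphi|_{E_c}=(1+\mathcal L_{1,s}^{\mathrm{fast}})f_c|_{E_c},$$ and its inverse $\varphi\mapsto f$ by $$f_a|_{E_a}=(1-\alpha_s(k_2))\varphi|_{E_a},\qquad f_b|_{E_b}=\varphi|_{E_b},\qquad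 f_c|_{E_c}=(1-\alpha_s(k_1^{-1}))\varphi|_{E_c}.$$ These maps restrict to isomorphisms between $\mathrm{FFE}_s^{\mathrm{dec},\pm}$ and $\mathrm{SFE}_s^{\omega,\mathrm{dec},\pm}$. -/

import Mathlib

open Set Filter Topology Asymptotics
open scoped MatrixGroups ContDiff

noncomputable section

namespace ThetaGroup

/-! ### The triangle group and its action on the real line -/

/-- The class in `PGL(2, ℝ)` of an invertible matrix. -/
def pgl (A : Matrix (Fin 2) (Fin 2) ℝ) (hA : A.det ≠ 0) : PGL(2, ℝ) :=
  Matrix.ProjGenLinGroup.mk (Matrix.GeneralLinearGroup.mkOfDetNeZero A hA)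

/-- The fractional linear transformation `g.x = (a x + b) / (c x + d)`
(only used where `c x + d ≠ 0`). -/
def moebius (g : PGL(2, ℝ)) (x : ℝ) : ℝ :=
  Quotient.liftOn g
    (fun A : GL (Fin 2) ℝ => (A 0 0 * x + A 0 1) / (A 1 0 * x + A 1 1)) (by
      intro A B hAB
      obtain ⟨u, rfl⟩ := Matrix.ProjGenLinGroup.mk_eq_mk_iff.mp (Quotient.sound hAB :
        Matrix.ProjGenLinGroup.mk A = Matrix.ProjGenLinGroup.mk B)
      have hu : (u : ℝ) ≠ 0 := u.ne_zero
      simp only [Matrix.GeneralLinearGroup.coe_mul, Matrix.GeneralLinearGroup.coe_scalar,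
        Matrix.scalar_apply, Matrix.mul_diagonal]
      rw [show A 0 0 * (u : ℝ) * x + A 0 1 * (u : ℝ) = (A 0 0 * x + A 0 1) * u by ring,
        show A 1 0 * (u : ℝ) * x + A 1 1 * (u : ℝ) = (A 1 0 * x + A 1 1) * u by ring,
        mul_div_mul_right _ _ hu])

/-- `|g'(x)| = |a d - b c| (c x + d)⁻²`. -/
def absDeriv (g : PGL(2, ℝ)) (x : ℝ) : ℝ :=
  Quotient.liftOn g
    (fun A : GL (Fin 2) ℝ => |(A : Matrix (Fin 2) (Fin 2) ℝ).det| / (A 1 0 * x + A 1 1) ^ 2) (by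
      intro A B hAB
      obtain ⟨u, rfl⟩ := Matrix.ProjGenLinGroup.mk_eq_mk_iff.mp (Quotient.sound hAB :
        Matrix.ProjGenLinGroup.mk A = Matrix.ProjGenLinGroup.mk B)
      have hu : (u : ℝ) ≠ 0 := u.ne_zero
      simp only [Matrix.GeneralLinearGroup.coe_mul, Matrix.GeneralLinearGroup.coe_scalar,
        Matrix.scalar_apply, Matrix.mul_diagonal, Matrix.det_mul, Matrix.det_diagonal,
        Fin.prod_univ_two]
      rw [show A 1 0 * (u : ℝ) * x + A 1 1 * (u : ℝ) = (A 1 0 * x + A 1 1) * u by ring, mul_pow,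
        abs_mul, abs_mul_self, ← sq, mul_div_mul_right _ _ (pow_ne_zero 2 hu)])

/-- The generator `S` of the Theta group. -/
def matS : PGL(2, ℝ) := pgl !![0, 1; -1, 0] (by simp)

/-- The generator `T = T₂` of the Theta group. -/
def matT : PGL(2, ℝ) := pgl !![1, 2; 0, 1] (by simp)

/-- The exterior symmetry `Q`. -/
def matQ : PGL(2, ℝ) := pgl !![0, 1; 1, 0] (by simp)

/-- The triangle group `⟨Γ₂, Q⟩ = ⟨S, T₂, Q⟩` underlying the Theta group. -/
def triangleGroup : Subgroup PGL(2, ℝ) := Subgroup.closure {matS, matT, matQ}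

def elS : triangleGroup := ⟨matS, Subgroup.subset_closure (by simp)⟩

def elT : triangleGroup := ⟨matT, Subgroup.subset_closure (by simp)⟩

def elQ : triangleGroup := ⟨matQ, Subgroup.subset_closure (by simp)⟩

lemma pgl_mul (A B : Matrix (Fin 2) (Fin 2) ℝ) (hA : A.det ≠ 0) (hB : B.det ≠ 0) :
    pgl A hA * pgl B hB = pgl (A * B) (by rw [Matrix.det_mul]; exact mul_ne_zero hA hB) := by
  unfold pgl
  rw [← map_mul]
  congr 1
  ext i j
  simp [Matrix.GeneralLinearGroup.mkOfDetNeZero]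

/-- The element `J = (-1 0; 0 1)`. -/
def elJ : triangleGroup := ⟨pgl !![-1, 0; 0, 1] (by simp), by
  have h : pgl !![-1, 0; 0, 1] (by simp) = matQ * matS := by
    simp only [matS, matQ, pgl_mul]
    congr 1
    ext i j
    fin_cases i <;> fin_cases j <;> simp
  rw [h]
  exact mul_mem elQ.2 elS.2⟩

/-- The element `k₁ = (1 2; 0 1)`. -/
def k₁ : triangleGroup := elT

/-- The element `k₂ = (2 1; -1 0)`. -/
def k₂ : triangleGroup := ⟨pgl !![2, 1; -1, 0] (by simp), by
  have h : pgl !![2, 1; -1, 0] (by simp) = matT⁻¹ * matS := by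
    rw [eq_inv_mul_iff_mul_eq]
    simp only [matS, matT, pgl_mul]
    congr 1
    ext i j
    fin_cases i <;> fin_cases j <;> simp
  rw [h]
  exact mul_mem (inv_mem elT.2) elS.2⟩

variable {V : Type*} [NormedAddCommGroup V] [InnerProductSpace ℂ V]

/-- The action `α_s(g⁻¹) F (x) = |g'(x)|^s χ(g⁻¹) F(g.x)`, written for `h = g⁻¹`. -/
def alpha (χ : triangleGroup →* (V ≃ₗᵢ[ℂ] V)) (s : ℂ) (h : triangleGroup) :
    (ℝ → V) →ₗ[ℂ] (ℝ → V) where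
  toFun F x := ((absDeriv (h⁻¹ : triangleGroup) x : ℝ) : ℂ) ^ s •
    χ h (F (moebius (h⁻¹ : triangleGroup) x))
  map_add' F G := by ext x; simp [smul_add]
  map_smul' c F := by ext x; simp [smul_comm c]

/-- A function on `I ⊆ ℝ`, extended by zero to `ℝ`; all the operators below evaluate their
arguments only inside `I`. -/
def extZero (I : Set ℝ) : (I → V) →ₗ[ℂ] (ℝ → V) where
  toFun f x := open Classical in if h : x ∈ I then f ⟨x, h⟩ else 0
  map_add' f g := by ext x; by_cases h : x ∈ I <;> simp [h]
  map_smul' c f := by ext x; by_cases h : x ∈ I <;> simp [h]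

/-! ### Slow eigenfunctions -/

section Slow

variable (χ : triangleGroup →* (V ≃ₗᵢ[ℂ] V)) (s : ℂ) (ε : ℤˣ)

/-- The slow transfer operator `α_s(k₁⁻¹) + α_s(k₂) ± α_s(k₂ J)`, even for `ε = 1`, odd for
`ε = -1`. -/
def slowOp : (ℝ → V) →ₗ[ℂ] (ℝ → V) :=
  alpha χ s k₁⁻¹ + alpha χ s k₂ + ε • alpha χ s (k₂ * elJ)

/-- The interval `(-1, ∞)`. -/
abbrev I₀ : Set ℝ := Ioi (-1)

/-- Real-analytic functions on `(-1, ∞)` fixed by the slow transfer operator. -/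
def SFE : Submodule ℂ (I₀ → V) where
  carrier := {φ | AnalyticOnNhd ℝ (extZero I₀ φ) I₀ ∧
    ∀ x : I₀, φ x = slowOp χ s ε (extZero I₀ φ) x}
  zero_mem' := by
    refine ⟨?_, fun x => by simp⟩
    rw [map_zero]
    exact analyticOnNhd_const
  add_mem' := by
    rintro φ ψ ⟨h₁, h₂⟩ ⟨h₃, h₄⟩
    refine ⟨?_, fun x => ?_⟩
    · rw [map_add]
      exact h₁.add h₃
    · simp only [map_add, Pi.add_apply]
      rw [h₂ x, h₄ x]
  smul_mem' := by
    rintro c φ ⟨h₁, h₂⟩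
    refine ⟨?_, fun x => ?_⟩
    · rw [map_smul]
      exact h₁.const_smul
    · simp only [map_smul, Pi.smul_apply]
      rw [h₂ x]

/-- The subspace of `SFE` of functions with
`φ(x) = c₁ x^(1-2s) + O(x^(-2s))` as `x → ∞` and `φ(x) = c₂ / (x + 1) + O(1)` as `x → -1⁺`. -/
def SFEas : Submodule ℂ (I₀ → V) where
  carrier := {φ | φ ∈ SFE χ s ε ∧ ∃ c₁ c₂ : V,
    ((fun x : ℝ => extZero I₀ φ x - (x : ℂ) ^ (1 - 2 * s) • c₁)
      =O[atTop] fun x : ℝ => (x : ℂ) ^ (-2 * s)) ∧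
    ((fun x : ℝ => extZero I₀ φ x - ((x : ℂ) + 1)⁻¹ • c₂) =O[𝓝[>] (-1)] fun _ => (1 : ℝ))}
  zero_mem' := by
    refine ⟨zero_mem _, 0, 0, ?_, ?_⟩ <;>
      simpa only [map_zero, Pi.zero_apply, smul_zero, sub_zero] using isBigO_zero _ _
  add_mem' := by
    rintro φ ψ ⟨h, c₁, c₂, h₁, h₂⟩ ⟨h', d₁, d₂, h₁', h₂'⟩
    refine ⟨add_mem h h', c₁ + d₁, c₂ + d₂, ?_, ?_⟩
    · refine (h₁.add h₁').congr_left fun x => ?_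
      simp only [map_add, Pi.add_apply, smul_add]
      abel
    · refine (h₂.add h₂').congr_left fun x => ?_
      simp only [map_add, Pi.add_apply, smul_add]
      abel
  smul_mem' := by
    rintro a φ ⟨h, c₁, c₂, h₁, h₂⟩
    refine ⟨(SFE χ s ε).smul_mem a h, a • c₁, a • c₂, ?_, ?_⟩
    · refine (h₁.const_smul_left a).congr_left fun x => ?_
      simp only [map_smul, Pi.smul_apply, smul_sub, smul_comm a]
    · refine (h₂.const_smul_left a).congr_left fun x => ?_
      simp only [map_smul, Pi.smul_apply, smul_sub, smul_comm a]

/-- The function given by `g` on `I` and by `h` on `J` extends to a `C^∞` function on `D`. -/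
def ExtendsSmoothly (I J D : Set ℝ) (g h : ℝ → V) : Prop :=
  ∃ F : ℝ → V, ContDiffOn ℝ ∞ F D ∧ EqOn F g I ∧ EqOn F h J

/-- The function given by `g` on `I` and by `h` on `J` extends smoothly to `P¹(ℝ)`: it has a
`C^∞` extension `F` to `ℝ`, and `α_s(S) F` (that is, `F` in the chart at `∞`) extends to a `C^∞`
function near `0`. -/
def ExtendsSmoothlyP1 (I J : Set ℝ) (g h : ℝ → V) : Prop :=
  ∃ F : ℝ → V, ContDiff ℝ ∞ F ∧ EqOn F g I ∧ EqOn F h J ∧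
    ∃ F' : ℝ → V, ContDiff ℝ ∞ F' ∧ EqOn F' (alpha χ s elS F) {0}ᶜ

lemma ExtendsSmoothly.zero {I J D : Set ℝ} : ExtendsSmoothly I J D (0 : ℝ → V) 0 :=
  ⟨0, contDiffOn_const, fun _ _ => rfl, fun _ _ => rfl⟩

lemma ExtendsSmoothly.add {I J D : Set ℝ} {g h g' h' : ℝ → V}
    (H : ExtendsSmoothly I J D g h) (H' : ExtendsSmoothly I J D g' h') :
    ExtendsSmoothly I J D (g + g') (h + h') := by
  obtain ⟨F, h₁, h₂, h₃⟩ := H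
  obtain ⟨F', h₁', h₂', h₃'⟩ := H'
  exact ⟨F + F', h₁.add h₁', fun x hx => by simp [h₂ hx, h₂' hx],
    fun x hx => by simp [h₃ hx, h₃' hx]⟩

lemma ExtendsSmoothly.smul {I J D : Set ℝ} {g h : ℝ → V} (c : ℂ)
    (H : ExtendsSmoothly I J D g h) : ExtendsSmoothly I J D (c • g) (c • h) := by
  obtain ⟨F, h₁, h₂, h₃⟩ := H
  exact ⟨c • F, h₁.const_smul c, fun x hx => by simp [h₂ hx], fun x hx => by simp [h₃ hx]⟩

lemma ExtendsSmoothly.congr {I J D : Set ℝ} {g h g' h' : ℝ → V}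
    (H : ExtendsSmoothly I J D g h) (hg : EqOn g g' I) (hh : EqOn h h' J) :
    ExtendsSmoothly I J D g' h' := by
  obtain ⟨F, h₁, h₂, h₃⟩ := H
  exact ⟨F, h₁, h₂.trans hg, h₃.trans hh⟩

/-- The subspace of `SFE` of functions `φ` such that
`φ ± α_s(Q) φ` on `(0, ∞)` and `-α_s(S) φ ∓ α_s(J) φ` on `(-∞, 0)` together extend smoothly to
`ℝ`, and `φ` on `(-1, ∞)` and `∓α_s(T⁻¹ J) φ` on `(-∞, -1)` together extend smoothly to `P¹(ℝ)`. -/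
def SFEdec : Submodule ℂ (I₀ → V) where
  carrier := {φ | φ ∈ SFE χ s ε ∧
    ExtendsSmoothly (Ioi 0) (Iio 0) univ
      (extZero I₀ φ + ε • alpha χ s elQ (extZero I₀ φ))
      (-alpha χ s elS (extZero I₀ φ) - ε • alpha χ s elJ (extZero I₀ φ)) ∧
    ExtendsSmoothlyP1 χ s (Ioi (-1)) (Iio (-1))
      (extZero I₀ φ) (-(ε • alpha χ s (elT⁻¹ * elJ) (extZero I₀ φ)))}
  zero_mem' := by
    refine ⟨zero_mem _, ?_, ?_⟩
    · simpa using ExtendsSmoothly.zero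
    · refine ⟨0, contDiff_const, ?_, ?_, 0, contDiff_const, ?_⟩ <;> intro x _ <;> simp
  add_mem' := by
    rintro φ ψ ⟨h, h₁, F, a₁, a₂, a₃, G, a₄, a₅⟩ ⟨h', h₁', F', b₁, b₂, b₃, G', b₄, b₅⟩
    refine ⟨add_mem h h', ?_, F + F', a₁.add b₁, ?_, ?_, G + G', a₄.add b₄, ?_⟩
    · refine (h₁.add h₁').congr (fun x _ => ?_) (fun x _ => ?_) <;>
        simp only [map_add, smul_add, Pi.add_apply, Pi.sub_apply, Pi.neg_apply, Pi.smul_apply] <;>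
        abel
    · intro x hx
      simp [a₂ hx, b₂ hx]
    · intro x hx
      simp only [Pi.add_apply, a₃ hx, b₃ hx, map_add, smul_add, Pi.neg_apply, Pi.smul_apply]
      abel
    · intro x hx
      simp [a₅ hx, b₅ hx]
  smul_mem' := by
    rintro c φ ⟨h, h₁, F, a₁, a₂, a₃, G, a₄, a₅⟩
    refine ⟨(SFE χ s ε).smul_mem c h, ?_, c • F, a₁.const_smul c, ?_, ?_, c • G,
      a₄.const_smul c, ?_⟩
    · refine (h₁.smul c).congr (fun x _ => ?_) (fun x _ => ?_) <;>
        simp only [map_smul, smul_add, smul_sub, smul_neg, Pi.add_apply, Pi.sub_apply,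
          Pi.neg_apply, Pi.smul_apply, smul_comm c]
    · intro x hx
      simp [a₂ hx]
    · intro x hx
      simp only [Pi.smul_apply, a₃ hx, map_smul, smul_neg, Pi.neg_apply, smul_comm c]
    · intro x hx
      simp [a₅ hx]

end Slow

/-! ### Meromorphic continuation of operator series -/

/-- The half plane `Re z > 0` without the point `1/2`, the only pole there. -/
def contDomain : Set ℂ := {z | 0 < z.re ∧ z ≠ 1 / 2}

/-- For `Re z > 1/2` the series `∑ₙ a n z` converges, its sum has a holomorphic continuation to
`contDomain`, and `v` is the value of the continuation at `s`. -/
def HasContinuedSum (a : ℕ → ℂ → V) (s : ℂ) (v : V) : Prop :=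
  ∃ G : ℂ → V, DifferentiableOn ℂ G contDomain ∧
    (∀ z : ℂ, 1 / 2 < z.re → HasSum (fun n => a n z) (G z)) ∧ G s = v

/-- The series has a continued sum at `s`. -/
def ContinuedSummable (a : ℕ → ℂ → V) (s : ℂ) : Prop := ∃ v, HasContinuedSum a s v

/-- The continued sum at `s` (unique for `s ∈ contDomain`); `0` if there is none. -/
def continuedSum (a : ℕ → ℂ → V) (s : ℂ) : V :=
  open Classical in if h : ContinuedSummable a s then h.choose else 0

lemma isOpen_contDomain : IsOpen contDomain :=
  (isOpen_lt continuous_const Complex.continuous_re).inter isOpen_ne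

lemma isPreconnected_contDomain : IsPreconnected contDomain := by
  have hA : Convex ℝ {z : ℂ | 1 / 2 < z.re} := convex_halfSpace_re_gt _
  have hB : Convex ℝ ({z : ℂ | 0 < z.re} ∩ {z : ℂ | 0 < z.im}) :=
    (convex_halfSpace_re_gt _).inter (convex_halfSpace_im_gt _)
  have hC : Convex ℝ ({z : ℂ | 0 < z.re} ∩ {z : ℂ | z.im < 0}) :=
    (convex_halfSpace_re_gt _).inter (convex_halfSpace_im_lt _)
  have hD : Convex ℝ ({z : ℂ | 0 < z.re} ∩ {z : ℂ | z.re < 1 / 2}) :=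
    (convex_halfSpace_re_gt _).inter (convex_halfSpace_re_lt _)
  have hAB := hA.isPreconnected.union (⟨1, 1⟩ : ℂ) (by norm_num) (by norm_num) hB.isPreconnected
  have hABC := hAB.union (⟨1, -1⟩ : ℂ) (by norm_num) (by norm_num) hC.isPreconnected
  have hABCD := hABC.union (⟨1 / 4, 1⟩ : ℂ) (by norm_num) (by norm_num) hD.isPreconnected
  convert hABCD using 1
  ext z
  simp only [contDomain, mem_ofPred_eq, mem_union, mem_inter_iff, ne_eq, Complex.ext_iff]
  norm_num
  constructor
  · rintro ⟨h1, h2⟩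
    rcases lt_trichotomy z.re (1 / 2) with h | h | h
    · exact Or.inr ⟨h1, h⟩
    · rcases lt_trichotomy z.im 0 with h' | h' | h'
      · exact Or.inl (Or.inr ⟨h1, h'⟩)
      · exact absurd h' (h2 h)
      · exact Or.inl (Or.inl (Or.inr ⟨h1, h'⟩))
    · exact Or.inl (Or.inl (Or.inl h))
  · rintro (((h | ⟨h, h'⟩) | ⟨h, h'⟩) | ⟨h, h'⟩)
    · exact ⟨by linarith, fun h' => by linarith⟩
    · exact ⟨h, fun _ => h'.ne'⟩
    · exact ⟨h, fun _ => h'.ne⟩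
    · exact ⟨h, fun h'' => absurd h'' h'.ne⟩

lemma HasContinuedSum.unique [CompleteSpace V] {a : ℕ → ℂ → V} {s : ℂ} (hs : s ∈ contDomain)
    {v w : V} (hv : HasContinuedSum a s v) (hw : HasContinuedSum a s w) : v = w := by
  obtain ⟨G, h₁, h₂, rfl⟩ := hv
  obtain ⟨G', h₁', h₂', rfl⟩ := hw
  refine (h₁.analyticOnNhd isOpen_contDomain).eqOn_of_preconnected_of_eventuallyEq
    (h₁'.analyticOnNhd isOpen_contDomain) isPreconnected_contDomain
    (z₀ := 1) ⟨by norm_num, by norm_num⟩ ?_ hs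
  filter_upwards [(isOpen_lt continuous_const Complex.continuous_re).mem_nhds
    (show (1 / 2 : ℝ) < (1 : ℂ).re by norm_num)] with z hz
  exact (h₂ z hz).unique (h₂' z hz)

lemma ContinuedSummable.hasContinuedSum {a : ℕ → ℂ → V} {s : ℂ} (h : ContinuedSummable a s) :
    HasContinuedSum a s (continuedSum a s) := by
  unfold continuedSum
  rw [dif_pos h]
  exact h.choose_spec

lemma HasContinuedSum.continuedSum_eq [FiniteDimensional ℂ V] {a : ℕ → ℂ → V} {s : ℂ}
    (hs : s ∈ contDomain) {v : V} (h : HasContinuedSum a s v) : continuedSum a s = v :=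
  have := FiniteDimensional.complete ℂ V
  (ContinuedSummable.hasContinuedSum ⟨v, h⟩).unique hs h

lemma HasContinuedSum.zero (s : ℂ) : HasContinuedSum (fun _ _ => (0 : V)) s 0 :=
  ⟨fun _ => 0, differentiableOn_const _, fun _ _ => hasSum_zero, rfl⟩

lemma HasContinuedSum.add {a b : ℕ → ℂ → V} {s : ℂ} {v w : V} (h : HasContinuedSum a s v)
    (h' : HasContinuedSum b s w) : HasContinuedSum (fun n z => a n z + b n z) s (v + w) := by
  obtain ⟨G, h₁, h₂, rfl⟩ := h
  obtain ⟨G', h₁', h₂', rfl⟩ := h'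
  exact ⟨G + G', h₁.add h₁', fun z hz => (h₂ z hz).add (h₂' z hz), rfl⟩

lemma HasContinuedSum.smul {a : ℕ → ℂ → V} {s : ℂ} {v : V} (c : ℂ) (h : HasContinuedSum a s v) :
    HasContinuedSum (fun n z => c • a n z) s (c • v) := by
  obtain ⟨G, h₁, h₂, rfl⟩ := h
  exact ⟨c • G, h₁.const_smul c, fun z hz => (h₂ z hz).const_smul c, rfl⟩

/-! ### Fast eigenfunctions -/

/-- The interval `E_a = (-1, 0)`. -/
abbrev Ea : Set ℝ := Ioo (-1) 0

/-- The interval `E_b = (0, 1)`. -/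
abbrev Eb : Set ℝ := Ioo 0 1

/-- The interval `E_c = (1, ∞)`. -/
abbrev Ec : Set ℝ := Ioi 1

/-- `f`, restricted to the bounded interval `I`, is the restriction of an element of `B(𝓔)` for
some open connected complex neighbourhood `𝓔` of the closure of `I`: a function that is continuous
on the closure of `𝓔` and holomorphic on `𝓔`. Since such a germ is determined by its values on `I`,
the functions on `I` with this property form the inductive limit of the spaces `B(𝓔)`. -/
def IsGerm (I : Set ℝ) (f : ℝ → V) : Prop :=
  ∃ U : Set ℂ, IsOpen U ∧ IsConnected U ∧ (∀ x ∈ closure I, (x : ℂ) ∈ U) ∧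
    ∃ ψ : ℂ → V, DiffContOnCl ℂ ψ U ∧ ∀ x ∈ I, ψ x = f x

lemma IsGerm.zero (I : Set ℝ) : IsGerm I (0 : ℝ → V) :=
  ⟨univ, isOpen_univ, isConnected_univ, fun _ _ => mem_univ _, 0, diffContOnCl_const,
    fun _ _ => rfl⟩

lemma IsGerm.smul {I : Set ℝ} {f : ℝ → V} (c : ℂ) (h : IsGerm I f) : IsGerm I (c • f) := by
  obtain ⟨U, h₁, h₂, h₃, ψ, h₄, h₅⟩ := h
  exact ⟨U, h₁, h₂, h₃, c • ψ, h₄.const_smul c, fun x hx => by simp [h₅ x hx]⟩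

lemma IsGerm.add {l r : ℝ} (hlr : l < r) {f g : ℝ → V} (h : IsGerm (Ioo l r) f)
    (h' : IsGerm (Ioo l r) g) : IsGerm (Ioo l r) (f + g) := by
  obtain ⟨U, h₁, h₂, h₃, ψ, h₄, h₅⟩ := h
  obtain ⟨U', h₁', h₂', h₃', ψ', h₄', h₅'⟩ := h'
  rw [closure_Ioo hlr.ne] at h₃ h₃'
  have hl : l ∈ Icc l r := ⟨le_rfl, hlr.le⟩
  have hK : IsPreconnected ((fun x : ℝ => (x : ℂ)) '' Icc l r) :=
    isPreconnected_Icc.image _ Complex.continuous_ofReal.continuousOn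
  have hKU : (fun x : ℝ => (x : ℂ)) '' Icc l r ⊆ U ∩ U' := by
    rintro _ ⟨x, hx, rfl⟩
    exact ⟨h₃ x hx, h₃' x hx⟩
  have hW : connectedComponentIn (U ∩ U') (l : ℂ) ⊆ U ∩ U' := connectedComponentIn_subset _ _
  refine ⟨connectedComponentIn (U ∩ U') (l : ℂ), (h₁.inter h₁').connectedComponentIn,
    isConnected_connectedComponentIn_iff.mpr (hKU ⟨l, hl, rfl⟩), ?_, ψ + ψ',
    (h₄.mono fun z hz => (hW hz).1).add (h₄'.mono fun z hz => (hW hz).2),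
    fun x hx => by simp [h₅ x hx, h₅' x hx]⟩
  rw [closure_Ioo hlr.ne]
  intro x hx
  exact hK.subset_connectedComponentIn ⟨l, hl, rfl⟩ hKU ⟨x, hx, rfl⟩

/-- Function vectors `(f_a, f_b, f_c)`. -/
abbrev Vec (V : Type*) := (Ea → V) × (Eb → V) × (Ec → V)

section Fast

variable (χ : triangleGroup →* (V ≃ₗᵢ[ℂ] V)) (s : ℂ) (ε : ℤˣ)

/-- The space `𝓑 = 𝓑(E_a) ⊕ 𝓑(E_b) ⊕ 𝓑(E_c)`. The closure of `E_c` in the Riemann sphere contains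
`∞`, where functions are read in the chart given by the action: `f_c` is holomorphic in a
neighbourhood of `[1, ∞]` if `α_s(Q) f_c` is holomorphic in a neighbourhood of
`Q.[1, ∞] = [0, 1]`. -/
def fastSpace : Submodule ℂ (Vec V) where
  carrier := {f | IsGerm Ea (extZero Ea f.1) ∧ IsGerm Eb (extZero Eb f.2.1) ∧
    IsGerm Eb (alpha χ s elQ (extZero Ec f.2.2))}
  zero_mem' := by
    refine ⟨?_, ?_, ?_⟩ <;> simpa using IsGerm.zero _
  add_mem' := by
    rintro f g ⟨h₁, h₂, h₃⟩ ⟨h₁', h₂', h₃'⟩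
    refine ⟨?_, ?_, ?_⟩
    · simpa using h₁.add (by norm_num) h₁'
    · simpa using h₂.add (by norm_num) h₂'
    · simpa using h₃.add (by norm_num) h₃'
  smul_mem' := by
    rintro c f ⟨h₁, h₂, h₃⟩
    refine ⟨?_, ?_, ?_⟩
    · simpa using h₁.smul c
    · simpa using h₂.smul c
    · simpa using h₃.smul c

/-- The summands of `L_{1,z}^fast = ∑_{n ≥ 1} α_z(k₁⁻ⁿ)` at `x`, where `f` on `E_c`, an element of
the space for the parameter `s`, is carried to the parameter `z` by keeping `α_s(Q) f` fixed.
At `z = s` this is `α_s(k₁⁻ⁿ) f (x)`. -/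
def fastOneTerm (f : Ec → V) (x : ℝ) (n : ℕ) (z : ℂ) : V :=
  alpha χ z (k₁ ^ (n + 1))⁻¹ (alpha χ z elQ (alpha χ s elQ (extZero Ec f))) x

/-- The summands of `L_{2,z}^fast = ∑_{n ≥ 1} α_z(k₂ⁿ)` at `x`. -/
def fastTwoTerm (f : Ea → V) (x : ℝ) (n : ℕ) (z : ℂ) : V :=
  alpha χ z (k₂ ^ (n + 1)) (extZero Ea f) x

/-- `L_{1,s}^fast`, defined by its series for `Re s > 1/2` and by continuation in `s` otherwise. -/
def fastOne (f : Ec → V) (x : ℝ) : V := continuedSum (fastOneTerm χ s f x) s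

/-- `L_{2,s}^fast`, defined by its series for `Re s > 1/2` and by continuation in `s` otherwise. -/
def fastTwo (f : Ea → V) (x : ℝ) : V := continuedSum (fastTwoTerm χ f x) s

/-- `L_{1,s}^fast f_c` and `L_{2,s}^fast f_a` are defined on `(-1, ∞)`. -/
def FastDefined (f : Vec V) : Prop :=
  ∀ x ∈ I₀, ContinuedSummable (fastOneTerm χ s f.2.2 x) s ∧
    ContinuedSummable (fastTwoTerm χ f.1 x) s

/-- `f = L_s^{fast,±} f` for the matrix of operators
```
    0      ±α_s(k₂ J)   L₁
    L₂     ±α_s(k₂ J)   L₁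
    L₂     ±α_s(k₂ J)   0
``` -/
def IsFastFixed (f : Vec V) : Prop :=
  (∀ x : Ea, f.1 x = ε • alpha χ s (k₂ * elJ) (extZero Eb f.2.1) x + fastOne χ s f.2.2 x) ∧
  (∀ x : Eb, f.2.1 x = fastTwo χ s f.1 x + ε • alpha χ s (k₂ * elJ) (extZero Eb f.2.1) x
    + fastOne χ s f.2.2 x) ∧
  (∀ x : Ec, f.2.2 x = fastTwo χ s f.1 x + ε • alpha χ s (k₂ * elJ) (extZero Eb f.2.1) x)

/-- `(1 + L_{2,s}^fast) f_a` on `E_a`. -/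
def sumA (f : Vec V) : ℝ → V := extZero Ea fun x : Ea => f.1 x + fastTwo χ s f.1 x

/-- `(1 + L_{1,s}^fast) f_c` on `E_c`. -/
def sumC (f : Vec V) : ℝ → V := extZero Ec fun x : Ec => f.2.2 x + fastOne χ s f.2.2 x

end Fast

section FastSpaces

variable {χ : triangleGroup →* (V ≃ₗᵢ[ℂ] V)} {s : ℂ}

lemma fastOneTerm_add (f g : Ec → V) (x : ℝ) : fastOneTerm χ s (f + g) x =
    fun n z => fastOneTerm χ s f x n z + fastOneTerm χ s g x n z := by
  ext n z
  simp [fastOneTerm]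

lemma fastTwoTerm_add (f g : Ea → V) (x : ℝ) : fastTwoTerm χ (f + g) x =
    fun n z => fastTwoTerm χ f x n z + fastTwoTerm χ g x n z := by
  ext n z
  simp [fastTwoTerm]

lemma fastOneTerm_smul (c : ℂ) (f : Ec → V) (x : ℝ) : fastOneTerm χ s (c • f) x =
    fun n z => c • fastOneTerm χ s f x n z := by
  ext n z
  simp [fastOneTerm]

lemma fastTwoTerm_smul (c : ℂ) (f : Ea → V) (x : ℝ) : fastTwoTerm χ (c • f) x =
    fun n z => c • fastTwoTerm χ f x n z := by
  ext n z
  simp [fastTwoTerm]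

lemma FastDefined.zero : FastDefined χ s (0 : Vec V) := by
  intro x _
  refine ⟨⟨0, ?_⟩, ⟨0, ?_⟩⟩
  · have h : fastOneTerm χ s (0 : Vec V).2.2 x = fun _ _ => 0 := by
      ext n z
      simp [fastOneTerm]
    rw [h]
    exact HasContinuedSum.zero s
  · have h : fastTwoTerm χ (0 : Vec V).1 x = fun _ _ => 0 := by
      ext n z
      simp [fastTwoTerm]
    rw [h]
    exact HasContinuedSum.zero s

lemma FastDefined.add {f g : Vec V} (hf : FastDefined χ s f) (hg : FastDefined χ s g) :
    FastDefined χ s (f + g) := by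
  intro x hx
  obtain ⟨⟨v₁, h₁⟩, ⟨v₂, h₂⟩⟩ := hf x hx
  obtain ⟨⟨w₁, h₁'⟩, ⟨w₂, h₂'⟩⟩ := hg x hx
  refine ⟨⟨v₁ + w₁, ?_⟩, ⟨v₂ + w₂, ?_⟩⟩
  · rw [Prod.snd_add, Prod.snd_add, fastOneTerm_add]
    exact h₁.add h₁'
  · rw [Prod.fst_add, fastTwoTerm_add]
    exact h₂.add h₂'

lemma FastDefined.smul (c : ℂ) {f : Vec V} (hf : FastDefined χ s f) :
    FastDefined χ s (c • f) := by
  intro x hx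
  obtain ⟨⟨v₁, h₁⟩, ⟨v₂, h₂⟩⟩ := hf x hx
  refine ⟨⟨c • v₁, ?_⟩, ⟨c • v₂, ?_⟩⟩
  · rw [Prod.smul_snd, Prod.smul_snd, fastOneTerm_smul]
    exact h₁.smul c
  · rw [Prod.smul_fst, fastTwoTerm_smul]
    exact h₂.smul c

variable [FiniteDimensional ℂ V]

lemma fastOne_add (hs : s ∈ contDomain) {f g : Vec V} (hf : FastDefined χ s f)
    (hg : FastDefined χ s g) {x : ℝ} (hx : x ∈ I₀) :
    fastOne χ s (f.2.2 + g.2.2) x = fastOne χ s f.2.2 x + fastOne χ s g.2.2 x := by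
  refine HasContinuedSum.continuedSum_eq hs ?_
  rw [fastOneTerm_add]
  exact (hf x hx).1.hasContinuedSum.add (hg x hx).1.hasContinuedSum

lemma fastTwo_add (hs : s ∈ contDomain) {f g : Vec V} (hf : FastDefined χ s f)
    (hg : FastDefined χ s g) {x : ℝ} (hx : x ∈ I₀) :
    fastTwo χ s (f.1 + g.1) x = fastTwo χ s f.1 x + fastTwo χ s g.1 x := by
  refine HasContinuedSum.continuedSum_eq hs ?_
  rw [fastTwoTerm_add]
  exact (hf x hx).2.hasContinuedSum.add (hg x hx).2.hasContinuedSum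

lemma fastOne_smul (hs : s ∈ contDomain) (c : ℂ) {f : Vec V} (hf : FastDefined χ s f) {x : ℝ}
    (hx : x ∈ I₀) : fastOne χ s (c • f.2.2) x = c • fastOne χ s f.2.2 x := by
  refine HasContinuedSum.continuedSum_eq hs ?_
  rw [fastOneTerm_smul]
  exact (hf x hx).1.hasContinuedSum.smul c

lemma fastTwo_smul (hs : s ∈ contDomain) (c : ℂ) {f : Vec V} (hf : FastDefined χ s f) {x : ℝ}
    (hx : x ∈ I₀) : fastTwo χ s (c • f.1) x = c • fastTwo χ s f.1 x := by
  refine HasContinuedSum.continuedSum_eq hs ?_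
  rw [fastTwoTerm_smul]
  exact (hf x hx).2.hasContinuedSum.smul c

lemma Ea_subset : Ea ⊆ I₀ := fun _ hx => hx.1

lemma Eb_subset : Eb ⊆ I₀ := fun x hx => by
  have := hx.1
  simp only [mem_Ioi]
  linarith

lemma Ec_subset : Ec ⊆ I₀ := fun x hx => by
  simp only [mem_Ioi] at hx ⊢
  linarith

lemma sumA_add (hs : s ∈ contDomain) {f g : Vec V} (hf : FastDefined χ s f)
    (hg : FastDefined χ s g) : sumA χ s (f + g) = sumA χ s f + sumA χ s g := by
  unfold sumA
  rw [← map_add]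
  congr 1
  ext x
  simp only [Prod.fst_add, Pi.add_apply, fastTwo_add hs hf hg (Ea_subset x.2)]
  abel

lemma sumC_add (hs : s ∈ contDomain) {f g : Vec V} (hf : FastDefined χ s f)
    (hg : FastDefined χ s g) : sumC χ s (f + g) = sumC χ s f + sumC χ s g := by
  unfold sumC
  rw [← map_add]
  congr 1
  ext x
  simp only [Prod.snd_add, Pi.add_apply, fastOne_add hs hf hg (Ec_subset x.2)]
  abel

lemma sumA_smul (hs : s ∈ contDomain) (c : ℂ) {f : Vec V} (hf : FastDefined χ s f) :
    sumA χ s (c • f) = c • sumA χ s f := by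
  unfold sumA
  rw [← map_smul]
  congr 1
  ext x
  simp only [Prod.smul_fst, Pi.smul_apply, fastTwo_smul hs c hf (Ea_subset x.2), smul_add]

lemma sumC_smul (hs : s ∈ contDomain) (c : ℂ) {f : Vec V} (hf : FastDefined χ s f) :
    sumC χ s (c • f) = c • sumC χ s f := by
  unfold sumC
  rw [← map_smul]
  congr 1
  ext x
  simp only [Prod.smul_snd, Pi.smul_apply, fastOne_smul hs c hf (Ec_subset x.2), smul_add]

lemma sumA_zero (hs : s ∈ contDomain) : sumA χ s (0 : Vec V) = 0 := by
  simpa using sumA_smul (χ := χ) hs 0 (FastDefined.zero (V := V))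

lemma sumC_zero (hs : s ∈ contDomain) : sumC χ s (0 : Vec V) = 0 := by
  simpa using sumC_smul (χ := χ) hs 0 (FastDefined.zero (V := V))

variable (χ) in
/-- The elements of `𝓑` fixed by the fast transfer operator. -/
def FFE (hs : s ∈ contDomain) (ε : ℤˣ) : Submodule ℂ (Vec V) where
  carrier := {f | f ∈ fastSpace χ s ∧ FastDefined χ s f ∧ IsFastFixed χ s ε f}
  zero_mem' := by
    have h₁ : ∀ x ∈ I₀, fastOne χ s (0 : Ec → V) x = 0 := fun x hx => by
      simpa using fastOne_smul (χ := χ) hs 0 (FastDefined.zero (V := V)) hx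
    have h₂ : ∀ x ∈ I₀, fastTwo χ s (0 : Ea → V) x = 0 := fun x hx => by
      simpa using fastTwo_smul (χ := χ) hs 0 (FastDefined.zero (V := V)) hx
    refine ⟨zero_mem _, FastDefined.zero, fun x => ?_, fun x => ?_, fun x => ?_⟩
    · simp [h₁ x (Ea_subset x.2)]
    · simp [h₁ x (Eb_subset x.2), h₂ x (Eb_subset x.2)]
    · simp [h₂ x (Ec_subset x.2)]
  add_mem' := by
    rintro f g ⟨h, hf, h₁, h₂, h₃⟩ ⟨h', hg, h₁', h₂', h₃'⟩
    refine ⟨add_mem h h', hf.add hg, fun x => ?_, fun x => ?_, fun x => ?_⟩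
    · simp only [Prod.fst_add, Prod.snd_add, Pi.add_apply, map_add, smul_add, h₁ x, h₁' x,
        fastOne_add hs hf hg (Ea_subset x.2)]
      abel
    · simp only [Prod.fst_add, Prod.snd_add, Pi.add_apply, map_add, smul_add,
        fastOne_add hs hf hg (Eb_subset x.2), fastTwo_add hs hf hg (Eb_subset x.2)]
      rw [h₂ x, h₂' x]
      abel
    · simp only [Prod.fst_add, Prod.snd_add, Pi.add_apply, map_add, smul_add, h₃ x, h₃' x,
        fastTwo_add hs hf hg (Ec_subset x.2)]
      abel
  smul_mem' := by
    rintro c f ⟨h, hf, h₁, h₂, h₃⟩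
    refine ⟨(fastSpace χ s).smul_mem c h, hf.smul c, fun x => ?_, fun x => ?_, fun x => ?_⟩
    · simp only [Prod.smul_fst, Prod.smul_snd, Pi.smul_apply, map_smul, smul_add, h₁ x,
        fastOne_smul hs c hf (Ea_subset x.2), smul_comm c]
    · simp only [Prod.smul_fst, Prod.smul_snd, Pi.smul_apply, map_smul,
        fastOne_smul hs c hf (Eb_subset x.2), fastTwo_smul hs c hf (Eb_subset x.2)]
      rw [h₂ x]
      simp only [smul_add, smul_comm c]
    · simp only [Prod.smul_fst, Prod.smul_snd, Pi.smul_apply, map_smul, smul_add, h₃ x,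
        fastTwo_smul hs c hf (Ec_subset x.2), smul_comm c]

variable (χ) in
/-- The subspace of `FFE` of vectors `(f_a, f_b, f_c)` for which, with
`A = (1 + L_{2,s}^fast) f_a` and `C = (1 + L_{1,s}^fast) f_c`,
* `f_b ± α_s(Q) C` on `(0, 1)` and `-α_s(S) C ∓ α_s(J) f_b` on `(-1, 0)` extend smoothly to
  `(-1, 1)`,
* `A` on `(-1, 0)` and `∓α_s(T⁻¹ J) A` on `(-2, -1)` extend smoothly to `(-2, 0)`,
* `α_s(S) C` on `(-1, 0)` and `∓α_s(S T⁻¹ J) C` near `0` in `(0, ∞)` extend smoothly across `0`;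
  at `x` the latter reads `C` at `1/x - 2`, which lies in `E_c = (1, ∞)` exactly for
  `0 < x < 1/3`. -/
def FFEdec (hs : s ∈ contDomain) (ε : ℤˣ) : Submodule ℂ (Vec V) where
  carrier := {f | f ∈ FFE χ hs ε ∧
    ExtendsSmoothly (Ioo 0 1) (Ioo (-1) 0) (Ioo (-1) 1)
      (extZero Eb f.2.1 + ε • alpha χ s elQ (sumC χ s f))
      (-alpha χ s elS (sumC χ s f) - ε • alpha χ s elJ (extZero Eb f.2.1)) ∧
    ExtendsSmoothly (Ioo (-1) 0) (Ioo (-2) (-1)) (Ioo (-2) 0)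
      (sumA χ s f) (-(ε • alpha χ s (elT⁻¹ * elJ) (sumA χ s f))) ∧
    ExtendsSmoothly (Ioo (-1) 0) (Ioo 0 (1 / 3)) (Ioo (-1) (1 / 3))
      (alpha χ s elS (sumC χ s f)) (-(ε • alpha χ s (elS * elT⁻¹ * elJ) (sumC χ s f)))}
  zero_mem' := by
    refine ⟨zero_mem _, ?_, ?_, ?_⟩
    · simpa [sumC_zero hs] using ExtendsSmoothly.zero
    · simpa [sumA_zero hs] using ExtendsSmoothly.zero
    · simpa [sumC_zero hs] using ExtendsSmoothly.zero
  add_mem' := by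
    rintro f g ⟨h, h₁, h₂, h₃⟩ ⟨h', h₁', h₂', h₃'⟩
    refine ⟨add_mem h h', ?_, ?_, ?_⟩
    · refine (h₁.add h₁').congr (fun x _ => ?_) (fun x _ => ?_) <;>
        simp only [sumC_add hs h.2.1 h'.2.1, Prod.fst_add, Prod.snd_add, map_add, smul_add,
          Pi.add_apply, Pi.sub_apply, Pi.neg_apply, Pi.smul_apply] <;>
        abel
    · refine (h₂.add h₂').congr (fun x _ => ?_) (fun x _ => ?_) <;>
        simp only [sumA_add hs h.2.1 h'.2.1, map_add, smul_add,
          Pi.add_apply, Pi.neg_apply, Pi.smul_apply] <;>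
        abel
    · refine (h₃.add h₃').congr (fun x _ => ?_) (fun x _ => ?_) <;>
        simp only [sumC_add hs h.2.1 h'.2.1, map_add, smul_add,
          Pi.add_apply, Pi.neg_apply, Pi.smul_apply] <;>
        abel
  smul_mem' := by
    rintro c f ⟨h, h₁, h₂, h₃⟩
    refine ⟨(FFE χ hs ε).smul_mem c h, ?_, ?_, ?_⟩
    · refine (h₁.smul c).congr (fun x _ => ?_) (fun x _ => ?_) <;>
        simp only [sumC_smul hs c h.2.1, Prod.smul_fst, Prod.smul_snd, map_smul, smul_add,
          smul_sub, smul_neg, Pi.add_apply, Pi.sub_apply, Pi.neg_apply, Pi.smul_apply, smul_comm c]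
    · refine (h₂.smul c).congr (fun x _ => ?_) (fun x _ => ?_) <;>
        simp only [sumA_smul hs c h.2.1, map_smul, smul_neg, Pi.neg_apply, Pi.smul_apply,
          smul_comm c]
    · refine (h₃.smul c).congr (fun x _ => ?_) (fun x _ => ?_) <;>
        simp only [sumC_smul hs c h.2.1, map_smul, smul_neg, Pi.neg_apply, Pi.smul_apply,
          smul_comm c]

lemma FFEdec_le (hs : s ∈ contDomain) (ε : ℤˣ) : FFEdec (V := V) χ hs ε ≤ FFE χ hs ε :=
  fun _ hf => hf.1

end FastSpaces

end ThetaGroup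

end

/-!
Both fast operators are twisted Hurwitz series. With a unitary twist `U = χ(k₁⁻¹)`, the value of
`L_{1,z}^fast f_c` at `x` is `∑_{n ≥ 1} Uⁿ X_n^(-2z) G(1/X_n)` with `X_n = x + 2n`, where `G` is
holomorphic near `[0, 1]`; in the coordinate `y = 1/(x + 1)` the element `k₂⁻¹` becomes the
translation `y ↦ y + 1`, and `L_{2,z}^fast f_a` takes the same shape with step `1`. To continue such
a series in `z`, write `G 0 = v + (w - U w)` with `U v = v`
(`exists_fixed_add_coboundary`). The function
`P X = -X^(1-2z)/(d(1-2z)) v + X^(-2z) w` solves `P X - U P(X + d) = X^(-2z) G(1/X)` up to an error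
`O(X^(-2z-1))` (`norm_hurwitzRem_le`), which is summable for `Re z > 0`. Hence
`M = P + ∑ Uⁿ (error at X + n d)` is the continuation: it is holomorphic in `z ≠ 1/2`, analytic in
`X`, satisfies `M X = X^(-2z) G(1/X) + U M(X + d)` and has the asymptotics `c X^(1-2z) + O(X^(-2z))`
(`HurwitzData.hurwitz_eq`, `HurwitzData.hurwitz_asymptotics`). In terms of the action,
`Φ = (1 + L^fast) f` satisfies `L^fast f = α_s(k₁⁻¹) Φ`, respectively `α_s(k₂) Φ`
(`exists_fastOne_solution`, `exists_fastTwo_solution`).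

For a fast eigenvector `f`, the function `φ = L₂ f_a ± α_s(k₂ J) f_b + L₁ f_c` is therefore analytic
on `(-1, ∞)`, agrees with `(1 + L₂) f_a`, `f_b`, `(1 + L₁) f_c` on the three intervals, and the
formula for `φ` is the slow equation (`slowOfFast_spec`). Conversely, for a slow eigenfunction `φ`
the slow equation expresses `f = ((1 - α_s(k₂)) φ, φ, (1 - α_s(k₁⁻¹)) φ)` through values of `φ` on
compact subsets of `(-1, ∞)`, so that its components are germs of holomorphic functions
(`isGerm_of_analyticOnNhd`, `fastOfSlow_mem_fastSpace`). Applying `1 + L^fast` to `f` gives back `φ`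
because the difference `h` of the two solves `h y = U h(y + d)` and has asymptotics
`c y^(1-2s) + O(y^(-2s))`, which forces `h = 0` for `Re s > 0`, `s ≠ 1/2`
(`eq_zero_of_quasiPeriodic`).

As `φ` is analytic on `(-1, ∞)`, the smoothness conditions only matter near `0`, `-1` and `∞`,
where they are those imposed on `f` (`extendsSmoothly_zero_iff`, `extendsSmoothlyP1_iff`), and they
imply the asymptotics with vanishing leading coefficients (`SFEdec_le_SFEas`).
-/

noncomputable section

namespace ThetaGroup

/-! ### Bounds for power functions -/

section PowerBounds

lemma mul_rpow_le_sub_rpow {τ d b : ℝ} (hτ : 0 < τ) (hd : 0 < d) (hb : d < b) :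
    τ * d * b ^ (-τ - 1) ≤ (b - d) ^ (-τ) - b ^ (-τ) := by
  have hb0 : 0 < b := hd.trans hb
  set t : ℝ := (b - d) / b with ht
  have ht0 : 0 < t := div_pos (by linarith) hb0
  have h1 : (b - d) ^ (-τ) = t ^ (-τ) * b ^ (-τ) := by
    rw [← Real.mul_rpow ht0.le hb0.le, ht, div_mul_cancel₀ _ hb0.ne']
  have h2 : d * b ^ (-τ - 1) = (1 - t) * b ^ (-τ) := by
    rw [Real.rpow_sub_one hb0.ne', ht]
    field_simp
    ring
  -- The tangent line of the convex function `t ^ (-τ)` at `1`.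
  have h3 : 1 + τ * (1 - t) ≤ t ^ (-τ) := by
    rw [Real.rpow_def_of_pos ht0]
    have h4 := Real.log_le_sub_one_of_pos ht0
    have h5 := Real.add_one_le_exp (Real.log t * -τ)
    nlinarith
  have h6 : 0 < b ^ (-τ) := Real.rpow_pos_of_pos hb0 _
  rw [h1, mul_assoc, h2]
  nlinarith

/-- Comparison of `∑ (y + n d)^(-τ-1)` with the integral of `t^(-τ-1)`. -/
lemma sum_range_rpow_le {τ d y : ℝ} (hτ : 0 < τ) (hd : 0 < d) (hy : 1 ≤ y) (N : ℕ) :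
    ∑ n ∈ Finset.range N, (y + n * d) ^ (-τ - 1) ≤ (1 + 1 / (τ * d)) * y ^ (-τ) := by
  -- All terms but the first are bounded by the increments of `-t ^ (-τ) / (τ d)`.
  have key : ∀ N : ℕ, ∑ n ∈ Finset.range (N + 1), (y + n * d) ^ (-τ - 1) ≤
      y ^ (-τ - 1) + (y ^ (-τ) - (y + N * d) ^ (-τ)) / (τ * d) := by
    intro N
    induction N with
    | zero => simp
    | succ N ih =>
      rw [Finset.sum_range_succ]
      have h := mul_rpow_le_sub_rpow (b := y + ((N + 1 : ℕ) : ℝ) * d) hτ hd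
        (by push_cast; nlinarith [(Nat.cast_nonneg N : (0 : ℝ) ≤ N)])
      rw [show y + ((N + 1 : ℕ) : ℝ) * d - d = y + N * d by push_cast; ring] at h
      have h' := (le_div_iff₀' (mul_pos hτ hd)).mpr h
      refine (add_le_add ih h').trans (le_of_eq ?_)
      ring
  have hy0 : 0 < y := by linarith
  have h1 : y ^ (-τ - 1) ≤ y ^ (-τ) := Real.rpow_le_rpow_of_exponent_le hy (by linarith)
  have h2 : ∑ n ∈ Finset.range N, (y + n * d) ^ (-τ - 1) ≤
      ∑ n ∈ Finset.range (N + 1), (y + n * d) ^ (-τ - 1) := by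
    rw [Finset.sum_range_succ]
    have : 0 ≤ (y + N * d) ^ (-τ - 1) := by positivity
    linarith
  have h3 : (y ^ (-τ) - (y + N * d) ^ (-τ)) / (τ * d) ≤ y ^ (-τ) / (τ * d) := by
    gcongr
    have : 0 ≤ (y + N * d) ^ (-τ) := by positivity
    linarith
  calc _ ≤ _ := h2
    _ ≤ _ := key N
    _ ≤ y ^ (-τ) + y ^ (-τ) / (τ * d) := add_le_add h1 h3
    _ = _ := by ring

lemma summable_rpow_arith {τ d y : ℝ} (hτ : 0 < τ) (hd : 0 < d) (hy : 1 ≤ y) :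
    Summable fun n : ℕ => (y + n * d) ^ (-τ - 1) :=
  summable_of_sum_range_le (fun n => by positivity) (sum_range_rpow_le hτ hd hy)

lemma tsum_rpow_arith_le {τ d y : ℝ} (hτ : 0 < τ) (hd : 0 < d) (hy : 1 ≤ y) :
    ∑' n : ℕ, (y + n * d) ^ (-τ - 1) ≤ (1 + 1 / (τ * d)) * y ^ (-τ) :=
  Real.tsum_le_of_sum_range_le (fun n => by positivity) (sum_range_rpow_le hτ hd hy)

lemma norm_cpow_le_of_re_pos {X p : ℂ} (hX : 0 < X.re) (hp : p.re ≤ 0) :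
    ‖X ^ p‖ ≤ X.re ^ p.re * Real.exp (Real.pi * |p.im|) := by
  refine (Complex.norm_cpow_le X p).trans ?_
  rw [div_eq_mul_inv, ← Real.exp_neg]
  have h1 : ‖X‖ ^ p.re ≤ X.re ^ p.re :=
    Real.rpow_le_rpow_of_nonpos hX (Complex.re_le_norm X) hp
  have h2 : -(X.arg * p.im) ≤ Real.pi * |p.im| := by
    calc -(X.arg * p.im) ≤ |X.arg * p.im| := neg_le_abs _
      _ = |X.arg| * |p.im| := abs_mul _ _
      _ ≤ _ := by gcongr; exact Complex.abs_arg_le_pi X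
  gcongr

lemma hasDerivAt_add_ofReal_cpow {X : ℂ} (hX : 0 < X.re) (p : ℂ) {u : ℝ} (hu : 0 ≤ u) :
    HasDerivAt (fun u : ℝ => (X + u) ^ p) (p * (X + u) ^ (p - 1)) u := by
  have h1 : HasDerivAt (fun u : ℂ => X + u) 1 (u : ℂ) := (hasDerivAt_id _).const_add X
  have h2 : X + u ∈ Complex.slitPlane := Or.inl (by simp; linarith)
  simpa using (h1.cpow_const (c := p) h2).comp_ofReal

lemma norm_add_cpow_sub_le {X p : ℂ} (hX : 0 < X.re) (hp : p.re ≤ 1) {t : ℝ} (ht : 0 ≤ t) :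
    ‖(X + t) ^ p - X ^ p‖ ≤
      ‖p‖ * (X.re ^ (p.re - 1) * Real.exp (Real.pi * |p.im|)) * t := by
  have h := norm_image_sub_le_of_norm_deriv_le_segment' (f := fun u : ℝ => (X + u) ^ p)
    (f' := fun u : ℝ => p * (X + u) ^ (p - 1)) (a := 0) (b := t)
    (C := ‖p‖ * (X.re ^ (p.re - 1) * Real.exp (Real.pi * |p.im|)))
    (fun u hu => (hasDerivAt_add_ofReal_cpow hX p hu.1).hasDerivWithinAt)
    (fun u hu => ?_) t ⟨ht, le_rfl⟩
  · simpa using h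
  · rw [norm_mul]
    have h1 : (X + u).re = X.re + u := by simp
    have h2 := norm_cpow_le_of_re_pos (X := X + u) (p := p - 1) (by rw [h1]; linarith [hu.1])
      (by simpa using hp)
    have h3 : (X + u).re ^ (p - 1).re ≤ X.re ^ (p.re - 1) := by
      rw [h1, Complex.sub_re, Complex.one_re]
      exact Real.rpow_le_rpow_of_nonpos hX (by linarith [hu.1]) (by linarith)
    have h4 : (p - 1).im = p.im := by simp
    rw [h4] at h2
    refine mul_le_mul_of_nonneg_left (h2.trans ?_) (norm_nonneg _)
    gcongr

/-- Error of the rectangle rule for `∫ t^p` over a step of length `d`. -/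
lemma norm_cpow_integral_sub_le {X p : ℂ} (hX : 0 < X.re) (hp : p.re ≤ 1) (hp1 : p + 1 ≠ 0)
    {d : ℝ} (hd : 0 ≤ d) :
    ‖((X + d) ^ (p + 1) - X ^ (p + 1)) / (p + 1) - d * X ^ p‖ ≤
      ‖p‖ * (X.re ^ (p.re - 1) * Real.exp (Real.pi * |p.im|)) * d * d := by
  have h := norm_image_sub_le_of_norm_deriv_le_segment'
    (f := fun u : ℝ => (X + u) ^ (p + 1) / (p + 1) - u * X ^ p)
    (f' := fun u : ℝ => (X + u) ^ p - X ^ p) (a := 0) (b := d)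
    (C := ‖p‖ * (X.re ^ (p.re - 1) * Real.exp (Real.pi * |p.im|)) * d)
    (fun u hu => ?_) (fun u hu => ?_) d ⟨hd, le_rfl⟩
  · simp only [Complex.ofReal_zero, add_zero, zero_mul, sub_zero] at h
    refine le_trans (le_of_eq ?_) h
    congr 1
    ring
  · have h1 := (hasDerivAt_add_ofReal_cpow hX (p + 1) hu.1).div_const (p + 1)
    have h2 : HasDerivAt (fun u : ℝ => (u : ℂ) * X ^ p) (1 * X ^ p) u :=
      (Complex.ofRealCLM.hasDerivAt (x := u)).mul_const _
    refine ((h1.sub h2).congr_deriv ?_).hasDerivWithinAt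
    rw [add_sub_cancel_right, mul_div_cancel_left₀ _ hp1, one_mul]
  · refine (norm_add_cpow_sub_le hX hp hu.1).trans ?_
    gcongr
    exact hu.2.le

end PowerBounds

/-! ### Twisted Hurwitz series -/

section Hurwitz

variable {V : Type*} [NormedAddCommGroup V] [InnerProductSpace ℂ V]

/-- A unitary operator on a finite-dimensional space splits it into its fixed vectors and the range
of `1 - U`. -/
lemma exists_fixed_add_coboundary [FiniteDimensional ℂ V] (U : V ≃ₗᵢ[ℂ] V) (x : V) :
    ∃ v w : V, U v = v ∧ x = v + (w - U w) := by
  set A : V →ₗ[ℂ] V := LinearMap.id - (U : V →ₗ[ℂ] V)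
  obtain ⟨y, ⟨w, rfl⟩, v, hv, hx⟩ := (LinearMap.range A).exists_add_mem_mem_orthogonal x
  refine ⟨v, w, ?_, ?_⟩
  · have h1 : inner ℂ (v - U v) v = 0 := (Submodule.mem_orthogonal _ _).mp hv _ ⟨v, rfl⟩
    rw [inner_sub_left, sub_eq_zero] at h1
    have h2 : ‖U v - v‖ ^ 2 = 0 := by
      rw [@norm_sub_sq ℂ, ← h1, U.norm_map, inner_self_eq_norm_sq]
      ring
    have h3 : ‖U v - v‖ = 0 := by simpa using h2
    exact sub_eq_zero.mp (norm_eq_zero.mp h3)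
  · rw [hx, add_comm]
    rfl

variable (U : V ≃ₗᵢ[ℂ] V) (d : ℝ) (G : ℂ → V) (v w : V)

/-- The leading part of a solution of `M X - U (M (X + d)) = X^(-2z) (v + (w - U w))`, where
`U v = v`. -/
def hurwitzMain (z X : ℂ) : V :=
  -(X ^ (1 - 2 * z) / (d * (1 - 2 * z))) • v + X ^ (-2 * z) • w

/-- What remains of `X^(-2z) G (1/X)` after subtracting the twisted difference of the leading
part. -/
def hurwitzRem (z X : ℂ) : V :=
  X ^ (-2 * z) • G X⁻¹ - hurwitzMain d v w z X + U (hurwitzMain d v w z (X + d))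

/-- The continuation in `z` of the twisted Hurwitz series
`∑_{n ≥ 0} Uⁿ (X + n d)^(-2z) G (1/(X + n d))`. -/
def hurwitz (z X : ℂ) : V :=
  ∑' n : ℕ, (U ^ n) (hurwitzRem U d G v w z (X + n * d)) + hurwitzMain d v w z X

/-- The half strip whose image under `X ↦ 1/X` lies in the `ρ`-neighbourhood of `[0, 1]`. -/
def halfStrip (ρ : ℝ) : Set ℂ := {X | 1 < X.re ∧ |X.im| < ρ}

/-- The complex `ρ`-neighbourhood of `[0, 1]`. -/
def unitNhd (ρ : ℝ) : Set ℂ := Metric.thickening ρ ((fun x : ℝ => (x : ℂ)) '' Icc 0 1)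

lemma isOpen_halfStrip (ρ : ℝ) : IsOpen (halfStrip ρ) :=
  (isOpen_lt continuous_const Complex.continuous_re).inter
    (isOpen_lt Complex.continuous_im.abs continuous_const)

lemma add_mem_halfStrip {ρ : ℝ} {X : ℂ} (hX : X ∈ halfStrip ρ) {t : ℝ} (ht : 0 ≤ t) :
    X + t ∈ halfStrip ρ := by
  refine ⟨?_, by simpa using hX.2⟩
  have := hX.1
  simp only [Complex.add_re, Complex.ofReal_re]
  linarith

lemma ofReal_mem_halfStrip {ρ : ℝ} (hρ : 0 < ρ) {y : ℝ} (hy : 1 < y) : (y : ℂ) ∈ halfStrip ρ :=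
  ⟨by simpa using hy, by simpa using hρ⟩

lemma inv_mem_unitNhd {ρ : ℝ} {X : ℂ} (hX : X ∈ halfStrip ρ) : X⁻¹ ∈ unitNhd ρ := by
  have hre : 0 < X.re := by linarith [hX.1]
  have hX0 : X ≠ 0 := fun h => by simp [h] at hre
  refine Metric.mem_thickening_iff.mpr ⟨((X.re⁻¹ : ℝ) : ℂ), ⟨X.re⁻¹, ⟨by positivity,
    inv_le_one_of_one_le₀ hX.1.le⟩, rfl⟩, ?_⟩
  have hreC : (X.re : ℂ) ≠ 0 := by exact_mod_cast hre.ne'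
  have h1 : X⁻¹ - ((X.re⁻¹ : ℝ) : ℂ) = -(X.im * Complex.I) / (X * X.re) := by
    push_cast
    field_simp
    nth_rewrite 2 [← Complex.re_add_im X]
    ring
  rw [dist_eq_norm, h1, norm_div, norm_neg, norm_mul, norm_mul, Complex.norm_I, Complex.norm_real,
    Complex.norm_real, mul_one, Real.norm_eq_abs, Real.norm_of_nonneg hre.le]
  have h2 : 1 ≤ ‖X‖ * X.re := by
    have := Complex.re_le_norm X
    nlinarith [hX.1]
  exact (div_le_self (abs_nonneg _) h2).trans_lt hX.2

section Bounds

variable {U d G v w} {ρ K : ℝ}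

/-- The constant in the bound for `hurwitzRem` on `‖z‖ ≤ B`. -/
def hurwitzConst (d : ℝ) (v w : V) (K B : ℝ) : ℝ :=
  (K + 2 * B * d * (‖v‖ + ‖w‖)) * Real.exp (Real.pi * (2 * B))

lemma norm_hurwitzRem_le (hd : 0 < d) (hU : U v = v) (hG0 : G 0 = v + (w - U w))
    (hK : ∀ t ∈ unitNhd ρ, ‖G t - G 0‖ ≤ K * ‖t‖) (hK0 : 0 ≤ K) {z X : ℂ} {σ B : ℝ}
    (hσ : 0 < σ) (hz : σ ≤ z.re) (hB : ‖z‖ ≤ B) (hz' : z ≠ 1 / 2) (hX : X ∈ halfStrip ρ) :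
    ‖hurwitzRem U d G v w z X‖ ≤ hurwitzConst d v w K B * X.re ^ (-(2 * σ) - 1) := by
  have hre : 0 < X.re := by linarith [hX.1]
  have hX0 : X ≠ 0 := fun h => by simp [h] at hre
  have hdC : (d : ℂ) ≠ 0 := by exact_mod_cast hd.ne'
  have h12 : (1 - 2 * z) ≠ 0 := fun h => hz' (by linear_combination (-1 / 2) * h)
  set p : ℂ := -2 * z with hp
  have hp1 : p + 1 = 1 - 2 * z := by rw [hp]; ring
  have hpre : p.re = -(2 * z.re) := by simp [hp]
  have hpim : |p.im| ≤ 2 * B := by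
    have : p.im = -(2 * z.im) := by simp [hp]
    rw [this, abs_neg, abs_mul, abs_two]
    have := Complex.abs_im_le_norm z
    linarith
  have hpn : ‖p‖ ≤ 2 * B := by
    rw [hp, norm_mul, norm_neg, Complex.norm_ofNat]
    linarith
  have hB0 : 0 ≤ B := (norm_nonneg z).trans hB
  set E := Real.exp (Real.pi * (2 * B)) with hE
  set T := X.re ^ (-(2 * σ) - 1) with hT
  have hT0 : 0 ≤ T := by positivity
  have hexp : Real.exp (Real.pi * |p.im|) ≤ E := by
    rw [hE]; gcongr
  have hTle : X.re ^ (p.re - 1) ≤ T := by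
    rw [hT]
    exact Real.rpow_le_rpow_of_exponent_le hX.1.le (by rw [hpre]; linarith)
  have e1 : hurwitzRem U d G v w z X = X ^ p • (G X⁻¹ - G 0)
      + ((-1 / d) * (((X + d) ^ (p + 1) - X ^ (p + 1)) / (p + 1) - d * X ^ p)) • v
      + ((X + d) ^ p - X ^ p) • U w := by
    rw [hurwitzRem, hurwitzMain, hurwitzMain, ← hp, hp1, hG0]
    simp only [map_add, map_smul, hU, smul_sub, smul_add]
    have e2 : (-1 / d) * (((X + d) ^ (1 - 2 * z) - X ^ (1 - 2 * z)) / (1 - 2 * z) - d * X ^ p)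
        = X ^ p + X ^ (1 - 2 * z) / (d * (1 - 2 * z))
          - (X + d) ^ (1 - 2 * z) / (d * (1 - 2 * z)) := by
      field_simp
      ring
    rw [e2]
    simp only [sub_smul, add_smul, neg_smul]
    abel
  have b1 : ‖X ^ p • (G X⁻¹ - G 0)‖ ≤ K * E * T := by
    rw [norm_smul]
    have h1 := norm_cpow_le_of_re_pos (p := p) hre (by rw [hpre]; linarith)
    have h2 := hK _ (inv_mem_unitNhd hX)
    have h3 : ‖X⁻¹‖ ≤ X.re⁻¹ := by
      rw [norm_inv]
      exact inv_anti₀ hre (Complex.re_le_norm X)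
    calc ‖X ^ p‖ * ‖G X⁻¹ - G 0‖ ≤ (X.re ^ p.re * E) * (K * X.re⁻¹) := by
          gcongr
          · exact h1.trans (by gcongr)
          · exact h2.trans (by gcongr)
      _ = K * E * (X.re ^ (p.re - 1)) := by rw [Real.rpow_sub_one hre.ne']; ring
      _ ≤ _ := by gcongr
  have b2 : ‖((-1 / d) * (((X + d) ^ (p + 1) - X ^ (p + 1)) / (p + 1) - d * X ^ p)) • v‖
      ≤ 2 * B * d * ‖v‖ * E * T := by
    rw [norm_smul, norm_mul]
    have h1 := norm_cpow_integral_sub_le (p := p) hre (by rw [hpre]; linarith)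
      (by rwa [hp1]) hd.le
    have h2 : ‖(-1 / d : ℂ)‖ = d⁻¹ := by
      rw [norm_div, norm_neg, norm_one, Complex.norm_real, Real.norm_of_nonneg hd.le, one_div]
    rw [h2]
    calc _ ≤ d⁻¹ * (2 * B * (T * E) * d * d) * ‖v‖ := by
          gcongr
          exact h1.trans (by gcongr)
      _ = _ := by field_simp
  have b3 : ‖((X + d) ^ p - X ^ p) • U w‖ ≤ 2 * B * d * ‖w‖ * E * T := by
    rw [norm_smul, U.norm_map]
    have h1 := norm_add_cpow_sub_le (p := p) hre (by rw [hpre]; linarith) hd.le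
    calc _ ≤ (2 * B * (T * E) * d) * ‖w‖ := by
          gcongr
          exact h1.trans (by gcongr)
      _ = _ := by ring
  rw [e1]
  refine (norm_add₃_le.trans (add_le_add_three b1 b2 b3)).trans (le_of_eq ?_)
  rw [hurwitzConst]
  ring

end Bounds

end Hurwitz

/-! ### Continuation and asymptotics of twisted Hurwitz series -/

section HurwitzProperties

variable {V : Type*} [NormedAddCommGroup V] [InnerProductSpace ℂ V]

/-- The data of a twisted Hurwitz series: a unitary twist `U`, a step `d`, a function `G`
holomorphic near `[0, 1]` with a Lipschitz bound at `0`, and the decomposition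
`G 0 = v + (w - U w)` into a fixed vector and a coboundary. -/
structure HurwitzData (U : V ≃ₗᵢ[ℂ] V) (d : ℝ) (G : ℂ → V) (v w : V) (ρ K : ℝ) : Prop where
  d_pos : 0 < d
  rho_pos : 0 < ρ
  map_fixed : U v = v
  apply_zero : G 0 = v + (w - U w)
  differentiableOn : DifferentiableOn ℂ G (unitNhd ρ)
  const_nonneg : 0 ≤ K
  norm_sub_le : ∀ t ∈ unitNhd ρ, ‖G t - G 0‖ ≤ K * ‖t‖

namespace HurwitzData

variable {U : V ≃ₗᵢ[ℂ] V} {d : ℝ} {G : ℂ → V} {v w : V} {ρ K : ℝ}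

lemma add_nat_mul_mem (H : HurwitzData U d G v w ρ K) {X : ℂ} (hX : X ∈ halfStrip ρ) (n : ℕ) :
    X + n * d ∈ halfStrip ρ := by
  have := add_mem_halfStrip hX (t := n * d) (by have := H.d_pos; positivity)
  simpa using this

lemma norm_term_le (H : HurwitzData U d G v w ρ K) {z X : ℂ} {σ B : ℝ} (hσ : 0 < σ)
    (hz : σ ≤ z.re) (hB : ‖z‖ ≤ B) (hz' : z ≠ 1 / 2) (hX : X ∈ halfStrip ρ) (n : ℕ) :
    ‖(U ^ n) (hurwitzRem U d G v w z (X + n * d))‖ ≤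
      hurwitzConst d v w K B * (X.re + n * d) ^ (-(2 * σ) - 1) := by
  rw [LinearIsometryEquiv.norm_map]
  have h := norm_hurwitzRem_le H.d_pos H.map_fixed H.apply_zero H.norm_sub_le H.const_nonneg
    hσ hz hB hz' (H.add_nat_mul_mem hX n)
  simpa using h

lemma hurwitzConst_nonneg (H : HurwitzData U d G v w ρ K) {B : ℝ} (hB : 0 ≤ B) :
    0 ≤ hurwitzConst d v w K B := by
  have := H.d_pos
  have := H.const_nonneg
  unfold hurwitzConst
  positivity

lemma summable_term [FiniteDimensional ℂ V] (H : HurwitzData U d G v w ρ K) {z X : ℂ}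
    (hz : z ∈ contDomain) (hX : X ∈ halfStrip ρ) :
    Summable fun n : ℕ => (U ^ n) (hurwitzRem U d G v w z (X + n * d)) := by
  have := FiniteDimensional.complete ℂ V
  refine Summable.of_norm_bounded ((summable_rpow_arith (τ := 2 * z.re) (by linarith [hz.1])
    H.d_pos hX.1.le).mul_left (hurwitzConst d v w K ‖z‖)) fun n => ?_
  exact H.norm_term_le hz.1 le_rfl le_rfl hz.2 hX n

/-- The functional equation of the twisted Hurwitz function. -/
lemma hurwitz_eq [FiniteDimensional ℂ V] (H : HurwitzData U d G v w ρ K) {z X : ℂ}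
    (hz : z ∈ contDomain) (hX : X ∈ halfStrip ρ) :
    hurwitz U d G v w z X = X ^ (-2 * z) • G X⁻¹ + U (hurwitz U d G v w z (X + d)) := by
  have hXd : X + d ∈ halfStrip ρ := by simpa using H.add_nat_mul_mem hX 1
  unfold hurwitz
  have h1 : ∀ n : ℕ, (U ^ (n + 1)) (hurwitzRem U d G v w z (X + ((n + 1 : ℕ) : ℂ) * d)) =
      U ((U ^ n) (hurwitzRem U d G v w z (X + d + n * d))) := by
    intro n
    rw [pow_succ', LinearIsometryEquiv.coe_mul, Function.comp_apply]
    rw [show X + ((n + 1 : ℕ) : ℂ) * d = X + d + n * d by push_cast; ring]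
  have h2 := U.toContinuousLinearEquiv.map_tsum (L := .unconditional ℕ)
    (f := fun n : ℕ => (U ^ n) (hurwitzRem U d G v w z (X + d + n * d)))
  rw [(H.summable_term hz hX).tsum_eq_zero_add, map_add]
  simp only [h1]
  rw [show U (∑' n : ℕ, (U ^ n) (hurwitzRem U d G v w z (X + d + n * d))) = _ from h2]
  simp only [pow_zero, Nat.cast_zero, zero_mul, add_zero]
  rw [show (1 : V ≃ₗᵢ[ℂ] V) (hurwitzRem U d G v w z X) = hurwitzRem U d G v w z X from rfl]
  nth_rewrite 1 [hurwitzRem]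
  simp only [LinearIsometryEquiv.coe_toContinuousLinearEquiv]
  abel

lemma norm_hurwitzMain_le {z : ℂ} {y : ℝ} (hy : 1 < y) :
    ‖hurwitzMain d v w z y‖ ≤
      (‖(d * (1 - 2 * z))⁻¹‖ * ‖v‖ + ‖w‖) * y ^ (1 - 2 * z.re) := by
  have hy0 : 0 < y := by linarith
  unfold hurwitzMain
  refine (norm_add_le _ _).trans ?_
  rw [norm_smul, norm_smul, norm_neg, div_eq_mul_inv, norm_mul,
    Complex.norm_cpow_eq_rpow_re_of_pos hy0, Complex.norm_cpow_eq_rpow_re_of_pos hy0]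
  have h1 : (1 - 2 * z).re = 1 - 2 * z.re := by simp
  have h2 : y ^ (-2 * z).re ≤ y ^ (1 - 2 * z.re) :=
    Real.rpow_le_rpow_of_exponent_le hy.le (by simp)
  rw [h1]
  have := mul_le_mul_of_nonneg_right h2 (norm_nonneg w)
  nlinarith

lemma tendsto_add_nat_mul_atTop (hd : 0 < d) (y : ℝ) :
    Tendsto (fun n : ℕ => y + n * d) atTop atTop :=
  tendsto_atTop_add_const_left _ _ (tendsto_natCast_atTop_atTop.atTop_mul_const hd)

/-- For `Re z > 1/2` the twisted Hurwitz function is the sum of its series. -/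
lemma hasSum_hurwitz [FiniteDimensional ℂ V] (H : HurwitzData U d G v w ρ K) {z : ℂ}
    (hz : 1 / 2 < z.re) {y : ℝ} (hy : 1 < y) :
    HasSum (fun n : ℕ => (U ^ n) (((y + n * d : ℝ) : ℂ) ^ (-2 * z) • G ((y + n * d : ℝ) : ℂ)⁻¹))
      (hurwitz U d G v w z y) := by
  have := FiniteDimensional.complete ℂ V
  have hd := H.d_pos
  have hz' : z ∈ contDomain := by
    refine ⟨by linarith, ?_⟩
    rintro rfl
    norm_num at hz
  have hX : (y : ℂ) ∈ halfStrip ρ := ofReal_mem_halfStrip H.rho_pos hy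
  have hsum := H.summable_term hz' hX
  set b : ℕ → V := fun n => (U ^ n) (hurwitzMain d v w z (y + n * d)) with hb
  set a : ℕ → V := fun n =>
    (U ^ n) (((y + n * d : ℝ) : ℂ) ^ (-2 * z) • G ((y + n * d : ℝ) : ℂ)⁻¹) with ha
  have hn : ∀ n : ℕ, 1 < y + n * d := fun n => by
    have : 0 ≤ (n : ℝ) * d := by positivity
    linarith
  -- Up to the summable remainders, the series telescopes to its leading part.
  have hsplit : ∀ n, a n = (U ^ n) (hurwitzRem U d G v w z (y + n * d)) + (b n - b (n + 1)) := by
    intro n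
    simp only [ha, hb, hurwitzRem, pow_succ, LinearIsometryEquiv.coe_mul, Function.comp_apply,
      map_add, map_sub]
    push_cast
    rw [show (y : ℂ) + (n + 1) * d = y + n * d + d by ring]
    abel
  have hG : ∀ n : ℕ, ‖G ((y + n * d : ℝ) : ℂ)⁻¹‖ ≤ K + ‖G 0‖ := by
    intro n
    have hm := ofReal_mem_halfStrip H.rho_pos (hn n)
    have h1 := H.norm_sub_le _ (inv_mem_unitNhd hm)
    have h2 : ‖((y + n * d : ℝ) : ℂ)⁻¹‖ ≤ 1 := by
      rw [norm_inv, Complex.norm_real, Real.norm_of_nonneg (by linarith [hn n])]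
      exact inv_le_one_of_one_le₀ (hn n).le
    have h3 := norm_le_norm_add_norm_sub' (G ((y + n * d : ℝ) : ℂ)⁻¹) (G 0)
    have h4 := mul_le_mul_of_nonneg_left h2 H.const_nonneg
    linarith
  have ha_sum : Summable a := by
    refine Summable.of_norm_bounded ((summable_rpow_arith (τ := 2 * z.re - 1) (by linarith)
      hd hy.le).mul_left (K + ‖G 0‖)) fun n => ?_
    simp only [ha]
    rw [LinearIsometryEquiv.norm_map, norm_smul,
      Complex.norm_cpow_eq_rpow_re_of_pos (by linarith [hn n]), mul_comm]
    have h1 : (-2 * z).re = -(2 * z.re - 1) - 1 := by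
      simp
    rw [h1]
    have := hn n
    gcongr
    exact hG n
  have hb0 : Tendsto b atTop (𝓝 0) := by
    rw [tendsto_zero_iff_norm_tendsto_zero]
    have h1 : Tendsto (fun n : ℕ => (‖(d * (1 - 2 * z))⁻¹‖ * ‖v‖ + ‖w‖) *
        (y + n * d) ^ (1 - 2 * z.re)) atTop (𝓝 0) := by
      rw [← mul_zero (‖(d * (1 - 2 * z))⁻¹‖ * ‖v‖ + ‖w‖)]
      refine Tendsto.const_mul _ ?_
      have := (tendsto_rpow_neg_atTop (y := 2 * z.re - 1) (by linarith)).comp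
        (tendsto_add_nat_mul_atTop hd y)
      simpa [Function.comp_def, neg_sub] using this
    refine squeeze_zero (fun _ => norm_nonneg _) (fun n => ?_) h1
    simp only [hb]
    rw [LinearIsometryEquiv.norm_map]
    have := norm_hurwitzMain_le (d := d) (v := v) (w := w) (z := z) (hn n)
    simpa using this
  have hdiff : HasSum (fun n => b n - b (n + 1)) (b 0) := by
    have hs : Summable fun n => b n - b (n + 1) := by
      refine (ha_sum.sub hsum).congr fun n => ?_
      rw [hsplit n]
      abel
    have h1 := hs.hasSum.tendsto_sum_nat
    simp only [Finset.sum_range_sub'] at h1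
    have h2 : Tendsto (fun n => b 0 - b n) atTop (𝓝 (b 0 - 0)) := hb0.const_sub _
    rw [sub_zero] at h2
    rw [← tendsto_nhds_unique h1 h2]
    exact hs.hasSum
  have h := hsum.hasSum.add hdiff
  have hb00 : b 0 = hurwitzMain d v w z y := by simp [hb]
  rw [hb00] at h
  simp only [← hsplit] at h
  exact h

lemma differentiableAt_cpow_const {p X : ℂ} (hX : 0 < X.re) :
    DifferentiableAt ℂ (fun X : ℂ => X ^ p) X :=
  (hasDerivAt_id X).cpow_const (Or.inl hX) |>.differentiableAt

lemma differentiableOn_hurwitzMain_param {X : ℂ} (hX : X ≠ 0) (hd : d ≠ 0) :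
    DifferentiableOn ℂ (fun z => hurwitzMain d v w z X) contDomain := by
  unfold hurwitzMain
  have hdC : (d : ℂ) ≠ 0 := by exact_mod_cast hd
  have h1 : DifferentiableOn ℂ (fun z : ℂ => 1 - 2 * z) contDomain := by fun_prop
  have h2 : DifferentiableOn ℂ (fun z : ℂ => -2 * z) contDomain := by fun_prop
  have h3 : ∀ z ∈ contDomain, (d : ℂ) * (1 - 2 * z) ≠ 0 := fun z hz =>
    mul_ne_zero hdC fun h => hz.2 (by linear_combination (-1 / 2) * h)
  exact ((((h1.const_cpow (Or.inl hX)).div (h1.const_mul _) h3).neg).smul_const v).add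
    ((h2.const_cpow (Or.inl hX)).smul_const w)

lemma differentiableOn_hurwitzRem_param {X : ℂ} (hX : 0 < X.re) (hd : 0 < d) :
    DifferentiableOn ℂ (fun z => hurwitzRem U d G v w z X) contDomain := by
  unfold hurwitzRem
  have hX0 : X ≠ 0 := fun h => by simp [h] at hX
  have hX1 : X + d ≠ 0 := fun h => by
    have := congrArg Complex.re h
    simp at this
    linarith
  have h2 : DifferentiableOn ℂ (fun z : ℂ => -2 * z) contDomain := by fun_prop
  exact (((h2.const_cpow (Or.inl hX0)).smul_const _).sub
    (differentiableOn_hurwitzMain_param hX0 hd.ne')).add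
    (U.toContinuousLinearEquiv.differentiable.comp_differentiableOn
      (differentiableOn_hurwitzMain_param hX1 hd.ne'))

lemma differentiableOn_hurwitz_param [FiniteDimensional ℂ V] (H : HurwitzData U d G v w ρ K)
    {X : ℂ} (hX : X ∈ halfStrip ρ) :
    DifferentiableOn ℂ (fun z => hurwitz U d G v w z X) contDomain := by
  have := FiniteDimensional.complete ℂ V
  have hX0 : X ≠ 0 := fun h => by have := hX.1; simp [h] at this; linarith
  intro z₀ hz₀
  -- On `O` the bound for the remainders is uniform in the parameter.
  set O : Set ℂ := contDomain ∩ ({z | z₀.re / 2 < z.re} ∩ {z | ‖z‖ < ‖z₀‖ + 1}) with hO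
  have hOopen : IsOpen O := isOpen_contDomain.inter
    ((isOpen_lt continuous_const Complex.continuous_re).inter
      (isOpen_lt continuous_norm continuous_const))
  have hmem : z₀ ∈ O := ⟨hz₀, by simp only [mem_ofPred_eq]; linarith [hz₀.1],
    by simp⟩
  have h1 : DifferentiableOn ℂ (fun z => ∑' n : ℕ, (U ^ n) (hurwitzRem U d G v w z (X + n * d)))
      O := by
    refine Complex.differentiableOn_tsum_of_summable_norm
      ((summable_rpow_arith (τ := 2 * (z₀.re / 2)) (by linarith [hz₀.1])
        H.d_pos hX.1.le).mul_left (hurwitzConst d v w K (‖z₀‖ + 1))) (fun n => ?_) hOopen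
      (fun n z hz => ?_)
    · have h2 := (H.add_nat_mul_mem hX n).1
      exact (U ^ n).toContinuousLinearEquiv.differentiable.comp_differentiableOn
        ((differentiableOn_hurwitzRem_param (by linarith) H.d_pos).mono inter_subset_left)
    · exact H.norm_term_le (half_pos hz₀.1) hz.2.1.le (le_of_lt hz.2.2) hz.1.2 hX n
  have h2 := (differentiableOn_hurwitzMain_param (v := v) (w := w) hX0 H.d_pos.ne') z₀ hz₀
  exact ((h1.differentiableAt (hOopen.mem_nhds hmem)).differentiableWithinAt).add h2

lemma differentiableAt_hurwitzMain {z X : ℂ} (hX : 0 < X.re) :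
    DifferentiableAt ℂ (hurwitzMain d v w z) X := by
  unfold hurwitzMain
  exact ((((differentiableAt_cpow_const hX).div_const _).neg).smul_const v).add
    ((differentiableAt_cpow_const hX).smul_const w)

lemma isOpen_unitNhd (ρ : ℝ) : IsOpen (unitNhd ρ) := Metric.isOpen_thickening

lemma differentiableAt_hurwitzRem (H : HurwitzData U d G v w ρ K) {z X : ℂ}
    (hX : X ∈ halfStrip ρ) : DifferentiableAt ℂ (hurwitzRem U d G v w z) X := by
  have hre : 0 < X.re := by linarith [hX.1]
  have hX0 : X ≠ 0 := fun h => by simp [h] at hre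
  have hXd := (add_mem_halfStrip hX H.d_pos.le).1
  have hG : DifferentiableAt ℂ (fun X : ℂ => G X⁻¹) X :=
    ((H.differentiableOn.differentiableAt
      ((isOpen_unitNhd ρ).mem_nhds (inv_mem_unitNhd hX))).comp X (differentiableAt_inv hX0))
  have h2 : DifferentiableAt ℂ (fun X : ℂ => hurwitzMain d v w z (X + d)) X :=
    (differentiableAt_hurwitzMain (by linarith)).comp X (differentiableAt_id.add_const _)
  unfold hurwitzRem
  exact (((differentiableAt_cpow_const hre).smul hG).sub (differentiableAt_hurwitzMain hre)).add
    (U.toContinuousLinearEquiv.differentiableAt.comp X h2)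

lemma differentiableOn_hurwitz [FiniteDimensional ℂ V] (H : HurwitzData U d G v w ρ K) {z : ℂ}
    (hz : z ∈ contDomain) : DifferentiableOn ℂ (hurwitz U d G v w z) (halfStrip ρ) := by
  have := FiniteDimensional.complete ℂ V
  have h1 : DifferentiableOn ℂ (fun X => ∑' n : ℕ, (U ^ n) (hurwitzRem U d G v w z (X + n * d)))
      (halfStrip ρ) := by
    refine Complex.differentiableOn_tsum_of_summable_norm
      ((summable_rpow_arith (τ := 2 * z.re) (by linarith [hz.1])
        H.d_pos le_rfl).mul_left (hurwitzConst d v w K ‖z‖)) (fun n X hX => ?_)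
      (isOpen_halfStrip ρ) (fun n X hX => ?_)
    · have h2 : DifferentiableAt ℂ (fun X : ℂ => hurwitzRem U d G v w z (X + n * d)) X :=
        (H.differentiableAt_hurwitzRem (H.add_nat_mul_mem hX n)).comp X
          (differentiableAt_id.add_const _)
      exact ((U ^ n).toContinuousLinearEquiv.differentiableAt.comp X h2).differentiableWithinAt
    · refine (H.norm_term_le hz.1 le_rfl le_rfl hz.2 hX n).trans ?_
      refine mul_le_mul_of_nonneg_left ?_ (H.hurwitzConst_nonneg (norm_nonneg z))
      have := H.d_pos
      have := hX.1
      exact Real.rpow_le_rpow_of_nonpos (by positivity) (by linarith) (by linarith [hz.1])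
  intro X hX
  exact (h1 X hX).add
    (differentiableAt_hurwitzMain (by linarith [hX.1])).differentiableWithinAt

lemma analyticOnNhd_hurwitz [FiniteDimensional ℂ V] (H : HurwitzData U d G v w ρ K) {z : ℂ}
    (hz : z ∈ contDomain) :
    AnalyticOnNhd ℝ (fun y : ℝ => hurwitz U d G v w z y) (Ioi 1) := by
  have := FiniteDimensional.complete ℂ V
  intro y hy
  have h1 := ((H.differentiableOn_hurwitz hz).analyticOnNhd (isOpen_halfStrip ρ) y
    (ofReal_mem_halfStrip H.rho_pos hy)).restrictScalars (𝕜 := ℝ)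
  exact h1.comp (Complex.ofRealCLM.analyticAt y)

/-- The twisted Hurwitz function has the asymptotics `c y^(1-2z) + O(y^(-2z))` at infinity. -/
lemma hurwitz_asymptotics [FiniteDimensional ℂ V] (H : HurwitzData U d G v w ρ K) {z : ℂ}
    (hz : z ∈ contDomain) :
    ∃ c : V, (fun y : ℝ => hurwitz U d G v w z y - (y : ℂ) ^ (1 - 2 * z) • c)
      =O[atTop] fun y : ℝ => (y : ℂ) ^ (-2 * z) := by
  have := FiniteDimensional.complete ℂ V
  refine ⟨-(d * (1 - 2 * z))⁻¹ • v, IsBigO.of_bound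
    (hurwitzConst d v w K ‖z‖ * (1 + 1 / (2 * z.re * d)) + ‖w‖) ?_⟩
  filter_upwards [eventually_gt_atTop 1] with y hy
  have hX : (y : ℂ) ∈ halfStrip ρ := ofReal_mem_halfStrip H.rho_pos hy
  have e1 : hurwitz U d G v w z y - (y : ℂ) ^ (1 - 2 * z) • -(d * (1 - 2 * z))⁻¹ • v =
      ∑' n : ℕ, (U ^ n) (hurwitzRem U d G v w z (y + n * d)) + (y : ℂ) ^ (-2 * z) • w := by
    rw [hurwitz, hurwitzMain, smul_smul, div_eq_mul_inv, mul_neg]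
    abel
  have hn : ‖(y : ℂ) ^ (-2 * z)‖ = y ^ (-(2 * z.re)) := by
    rw [Complex.norm_cpow_eq_rpow_re_of_pos (by linarith)]
    simp
  have hsum := summable_rpow_arith (τ := 2 * z.re) (by linarith [hz.1]) H.d_pos hy.le
  have h1 := tsum_of_norm_bounded (hsum.mul_left (hurwitzConst d v w K ‖z‖)).hasSum
    (H.norm_term_le hz.1 le_rfl le_rfl hz.2 hX)
  rw [tsum_mul_left] at h1
  have h2 := tsum_rpow_arith_le (τ := 2 * z.re) (by linarith [hz.1]) H.d_pos hy.le
  have h3 := mul_le_mul_of_nonneg_left h2 (H.hurwitzConst_nonneg (norm_nonneg z))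
  rw [e1]
  refine (norm_add_le _ _).trans ?_
  rw [norm_smul, hn]
  linarith

end HurwitzData

/-- A function holomorphic near `[0, 1]` is part of the data of a twisted Hurwitz series. -/
lemma exists_hurwitzData [FiniteDimensional ℂ V] (U : V ≃ₗᵢ[ℂ] V) {d : ℝ} (hd : 0 < d)
    {G : ℂ → V} {O : Set ℂ} (hO : IsOpen O) (hsub : ∀ x ∈ Icc (0 : ℝ) 1, (x : ℂ) ∈ O)
    (hG : DifferentiableOn ℂ G O) : ∃ v w ρ K, HurwitzData U d G v w ρ K := by
  have := FiniteDimensional.complete ℂ V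
  obtain ⟨v, w, hv, hvw⟩ := exists_fixed_add_coboundary U (G 0)
  have hc : IsCompact ((fun x : ℝ => (x : ℂ)) '' Icc 0 1) :=
    isCompact_Icc.image Complex.continuous_ofReal
  obtain ⟨ρ, hρ, hρO⟩ := hc.exists_cthickening_subset_open hO (by
    rintro _ ⟨x, hx, rfl⟩
    exact hsub x hx)
  have h0 : (0 : ℂ) ∈ O := by simpa using hsub 0 (by simp)
  have hds : ContinuousOn (dslope G 0) O :=
    ((Complex.differentiableOn_dslope (hO.mem_nhds h0)).mpr hG).continuousOn
  obtain ⟨K, hK⟩ := (hc.cthickening (r := ρ)).exists_bound_of_continuousOn (hds.mono hρO)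
  refine ⟨v, w, ρ, max K 0, hd, hρ, hv, hvw,
    hG.mono ((Metric.thickening_subset_cthickening _ _).trans hρO), le_max_right _ _,
    fun t ht => ?_⟩
  have h1 := hK t (Metric.thickening_subset_cthickening _ _ ht)
  have h2 : G t - G 0 = t • dslope G 0 t := by
    simpa using (sub_smul_dslope G 0 t).symm
  rw [h2, norm_smul, mul_comm]
  gcongr
  exact h1.trans (le_max_left _ _)

end HurwitzProperties

/-! ### Quasi-periodic functions -/

section QuasiPeriodic

variable {V : Type*} [NormedAddCommGroup V] [InnerProductSpace ℂ V]

lemma tendsto_ofReal_cpow_zero {p : ℂ} (hp : p.re < 0) :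
    Tendsto (fun y : ℝ => (y : ℂ) ^ p) atTop (𝓝 0) := by
  rw [tendsto_zero_iff_norm_tendsto_zero]
  have h := tendsto_rpow_neg_atTop (y := -p.re) (by linarith)
  rw [neg_neg] at h
  refine h.congr' ?_
  filter_upwards [eventually_gt_atTop 0] with y hy
  exact (Complex.norm_cpow_eq_rpow_re_of_pos hy p).symm

lemma tendsto_add_floor_div {y d κ : ℝ} (hd : 0 < d) (hκ : 0 < κ) :
    Tendsto (fun n : ℕ => (y + (⌊κ * n⌋₊ : ℕ) * d) / (y + n * d)) atTop (𝓝 κ) := by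
  have h0 : Tendsto (fun n : ℕ => y / n) atTop (𝓝 0) := tendsto_const_div_atTop_nhds_zero_nat y
  have h1 : Tendsto (fun n : ℕ => ((⌊κ * n⌋₊ : ℕ) : ℝ) / n) atTop (𝓝 κ) :=
    (tendsto_nat_floor_mul_div_atTop hκ.le).comp tendsto_natCast_atTop_atTop
  have h2 := (h0.add (h1.mul_const d)).div (h0.add_const d) (by simpa using hd.ne')
  rw [zero_add, zero_add, mul_div_cancel_right₀ _ hd.ne'] at h2
  refine h2.congr' ?_
  filter_upwards [eventually_gt_atTop 0] with n hn
  have hn' : (n : ℝ) ≠ 0 := by exact_mod_cast hn.ne'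
  simp only [Pi.div_apply]
  rw [← mul_div_mul_right _ (y / n + d) hn']
  congr 1
  · field_simp
  · field_simp

/-- On the line `Re s = 1/2`, `s ≠ 1/2`, the factor `y^(1-2s)` rotates by `-1` under a suitable
dilation of `y`. -/
lemma exists_dilation_cpow_eq_neg_one {s : ℂ} (hre : s.re = 1 / 2) (hs : s ≠ 1 / 2) :
    ∃ κ : ℝ, 0 < κ ∧ (κ : ℂ) ^ (1 - 2 * s) = -1 := by
  have him : s.im ≠ 0 := fun h => hs (Complex.ext (by simpa using hre) (by simpa using h))
  have himC : (s.im : ℂ) ≠ 0 := by exact_mod_cast him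
  refine ⟨Real.exp (Real.pi / (2 * s.im)), Real.exp_pos _, ?_⟩
  have h1 : (1 : ℂ) - 2 * s = -(2 * s.im * Complex.I) := by
    rw [← Complex.re_add_im s, hre]
    push_cast
    simp
    ring
  rw [h1, Complex.cpow_def_of_ne_zero (by exact_mod_cast (Real.exp_pos _).ne'),
    ← Complex.ofReal_log (Real.exp_pos _).le, Real.log_exp]
  rw [show ((Real.pi / (2 * s.im) : ℝ) : ℂ) * -(2 * s.im * Complex.I) = -(Real.pi * Complex.I) by
    push_cast; field_simp, Complex.exp_neg, Complex.exp_pi_mul_I]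
  norm_num

/-- Solutions of `h y = U (h (y + d))` do not admit asymptotics `c y^(1-2s) + O(y^(-2s))` unless
they vanish: `‖h‖` is constant along `y + n d`, which settles `Re s ≠ 1/2`; for `Re s = 1/2` the
values along `y + n d` are constant as well, whereas `y^(1-2s)` oscillates. -/
lemma eq_zero_of_quasiPeriodic (U : V ≃ₗᵢ[ℂ] V) {d a : ℝ} (hd : 0 < d) {h : ℝ → V}
    (hper : ∀ y, a < y → h y = U (h (y + d))) {s : ℂ} (hs : s ∈ contDomain) {c : V}
    (hc : (fun y : ℝ => h y - (y : ℂ) ^ (1 - 2 * s) • c)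
      =O[atTop] fun y : ℝ => (y : ℂ) ^ (-2 * s)) {y : ℝ} (hy : a < y) : h y = 0 := by
  have hseq := HurwitzData.tendsto_add_nat_mul_atTop hd y
  have hr : Tendsto (fun y : ℝ => h y - (y : ℂ) ^ (1 - 2 * s) • c) atTop (𝓝 0) :=
    hc.trans_tendsto (tendsto_ofReal_cpow_zero (by simpa using hs.1))
  have hrn := hr.comp hseq
  have hstep : ∀ n : ℕ, h (y + n * d) = U (h (y + (n + 1 : ℕ) * d)) := fun n => by
    rw [hper (y + n * d) (by
      have : (0 : ℝ) ≤ n * d := by positivity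
      linarith)]
    push_cast
    ring_nf
  have hiter : ∀ n : ℕ, (U ^ n) (h (y + n * d)) = h y := by
    intro n
    induction n with
    | zero => simp
    | succ n ih => rw [pow_succ, LinearIsometryEquiv.coe_mul, Function.comp_apply, ← hstep, ih]
  have hnorm : ∀ n : ℕ, ‖h (y + n * d)‖ = ‖h y‖ := fun n => by
    rw [← hiter n, LinearIsometryEquiv.norm_map]
  have hzero : Tendsto (fun n : ℕ => h (y + n * d)) atTop (𝓝 0) → h y = 0 := by
    intro h0
    have h1 := h0.norm
    simp only [hnorm, norm_zero] at h1
    exact norm_eq_zero.mp (tendsto_nhds_unique tendsto_const_nhds h1)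
  rcases lt_trichotomy s.re (1 / 2) with hlt | heq | hgt
  · -- The bounded sequence `h (y + n d)` leaves no room for a growing leading term.
    have hc0 : c = 0 := by
      by_contra hne
      have h1 : Tendsto (fun n : ℕ => (y + n * d) ^ (1 - 2 * s.re) * ‖c‖) atTop atTop :=
        ((tendsto_rpow_atTop (by linarith)).comp hseq).atTop_mul_const (norm_pos_iff.mpr hne)
      have h2 : ∀ᶠ n : ℕ in atTop, (y + n * d) ^ (1 - 2 * s.re) * ‖c‖ ≤ ‖h y‖ + 1 := by
        have h3 := (tendsto_zero_iff_norm_tendsto_zero.mp hrn).eventually (ge_mem_nhds zero_lt_one)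
        filter_upwards [h3, hseq.eventually_gt_atTop 0] with n hn hpos
        simp only [Function.comp_apply] at hn
        have h4 := norm_le_norm_add_norm_sub (h (y + n * d))
          (((y + n * d : ℝ) : ℂ) ^ (1 - 2 * s) • c)
        rw [norm_smul, Complex.norm_cpow_eq_rpow_re_of_pos hpos, hnorm] at h4
        have h5 : (1 - 2 * s).re = 1 - 2 * s.re := by simp
        rw [h5] at h4
        linarith
      obtain ⟨n, hn1, hn2⟩ := (h2.and (h1.eventually_gt_atTop (‖h y‖ + 1))).exists
      linarith
    refine hzero ?_
    simpa [hc0, Function.comp_def] using hrn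
  · -- The increments of `y^(1-2s)` along `y + n d` tend to zero, hence `h y` is fixed by `U`.
    set p : ℂ := 1 - 2 * s with hp
    have hpre : p.re = 0 := by simp [hp, heq]
    set q : ℕ → ℂ := fun n => ((y + n * d : ℝ) : ℂ) ^ p with hq
    have hqdiff : Tendsto (fun n => q (n + 1) - q n) atTop (𝓝 0) := by
      rw [tendsto_zero_iff_norm_tendsto_zero]
      have h1 : Tendsto (fun n : ℕ => ‖p‖ * ((y + n * d) ^ (-1 : ℝ) *
          Real.exp (Real.pi * |p.im|)) * d) atTop (𝓝 0) := by
        have h2 := (((tendsto_rpow_neg_atTop one_pos).comp hseq).mul_const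
          (Real.exp (Real.pi * |p.im|))).const_mul ‖p‖ |>.mul_const d
        simpa [Function.comp_def] using h2
      refine squeeze_zero' (Eventually.of_forall fun _ => norm_nonneg _) ?_ h1
      filter_upwards [hseq.eventually_gt_atTop 0] with n hn
      have h3 := norm_add_cpow_sub_le (X := ((y + n * d : ℝ) : ℂ)) (p := p) (by simpa using hn)
        (by rw [hpre]; norm_num) hd.le
      rw [hpre, zero_sub, Complex.ofReal_re] at h3
      simp only [hq]
      rw [show ((y + (n + 1 : ℕ) * d : ℝ) : ℂ) = ((y + n * d : ℝ) : ℂ) + d by push_cast; ring]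
      exact h3
    have hudiff : Tendsto (fun n : ℕ => h (y + (n + 1 : ℕ) * d) - h (y + n * d)) atTop (𝓝 0) := by
      have h1 := ((hrn.comp (tendsto_add_atTop_nat 1)).sub hrn).add (hqdiff.smul_const c)
      rw [sub_zero, zero_smul, add_zero] at h1
      refine h1.congr fun n => ?_
      simp only [Function.comp_apply, hq, sub_smul]
      abel
    have hfix : U (h y) = h y := by
      have h1 : ∀ n : ℕ, ‖h (y + (n + 1 : ℕ) * d) - h (y + n * d)‖ = ‖h y - U (h y)‖ := by
        intro n
        have e1 : h y = (U ^ (n + 1)) (h (y + (n + 1 : ℕ) * d)) := (hiter (n + 1)).symm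
        have e2 : U (h y) = (U ^ (n + 1)) (h (y + n * d)) := by
          rw [pow_succ', LinearIsometryEquiv.coe_mul, Function.comp_apply, hiter]
        rw [e2]
        nth_rewrite 1 [e1]
        rw [← map_sub, LinearIsometryEquiv.norm_map]
      have h2 := hudiff.norm
      simp only [h1, norm_zero] at h2
      have h3 := tendsto_nhds_unique tendsto_const_nhds h2
      exact (sub_eq_zero.mp (norm_eq_zero.mp h3)).symm
    have hconst : ∀ n : ℕ, h (y + n * d) = h y := by
      intro n
      have h1 : (U ^ n) (h y) = h y := by
        induction n with
        | zero => simp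
        | succ n ih => rw [pow_succ, LinearIsometryEquiv.coe_mul, Function.comp_apply, hfix, ih]
      exact (U ^ n).injective ((hiter n).trans h1.symm)
    have hqlim : Tendsto (fun n => q n • c) atTop (𝓝 (h y)) := by
      have h1 := hrn.const_sub (h y)
      rw [sub_zero] at h1
      refine h1.congr fun n => ?_
      simp [hconst, hq]
    -- Passing to the subsequence `⌊κ n⌋` multiplies the limit of `q n • c` by `-1`.
    obtain ⟨κ, hκ, hκ1⟩ := exists_dilation_cpow_eq_neg_one heq hs.2
    have hfloor : Tendsto (fun n : ℕ => ⌊κ * n⌋₊) atTop atTop :=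
      tendsto_nat_floor_atTop.comp (tendsto_natCast_atTop_atTop.const_mul_atTop hκ)
    have hratio : Tendsto (fun n : ℕ =>
        (((y + (⌊κ * n⌋₊ : ℕ) * d) / (y + n * d) : ℝ) : ℂ) ^ p) atTop (𝓝 (-1)) := by
      rw [← hκ1]
      have h1 : ContinuousAt (fun x : ℂ => x ^ p) (κ : ℂ) :=
        continuousAt_cpow_const (Or.inl (by simpa using hκ))
      exact h1.tendsto.comp
        ((Complex.continuous_ofReal.tendsto κ).comp (tendsto_add_floor_div hd hκ))
    have h1 := hratio.smul hqlim
    have h2 : Tendsto (fun n : ℕ => q ⌊κ * n⌋₊ • c) atTop (𝓝 ((-1 : ℂ) • h y)) := by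
      refine h1.congr' ?_
      filter_upwards [hseq.eventually_gt_atTop 0,
        (hseq.comp hfloor).eventually_gt_atTop 0] with n hn hn'
      simp only [Function.comp_apply] at hn'
      simp only [hq]
      rw [smul_smul, ← Complex.mul_cpow_ofReal_nonneg (div_pos hn' hn).le hn.le,
        ← Complex.ofReal_mul, div_mul_cancel₀ _ hn.ne']
    have h3 := tendsto_nhds_unique h2 (hqlim.comp hfloor)
    rw [neg_one_smul] at h3
    have h4 : (2 : ℂ) • h y = 0 := by
      rw [two_smul]
      nth_rewrite 1 [← h3]
      exact neg_add_cancel _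
    exact (smul_eq_zero.mp h4).resolve_left two_ne_zero
  · refine hzero ?_
    have h1 : Tendsto (fun n : ℕ => ((y + n * d : ℝ) : ℂ) ^ (1 - 2 * s) • c) atTop (𝓝 0) := by
      have h2 := ((tendsto_ofReal_cpow_zero (p := 1 - 2 * s) (by simp; linarith)).comp
        hseq).smul_const c
      rwa [zero_smul] at h2
    have h2 := hrn.add h1
    rw [add_zero] at h2
    refine h2.congr fun n => ?_
    simp [Function.comp_apply]

end QuasiPeriodic

/-! ### Holomorphic extension of real-analytic functions -/

section Complexification

variable {V : Type*} [NormedAddCommGroup V] [InnerProductSpace ℂ V]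

lemma exists_ball_extension [CompleteSpace V] {f : ℝ → V} {x : ℝ} (hf : AnalyticAt ℝ f x) :
    ∃ r : ℝ, 0 < r ∧ ∃ F : ℂ → V, DifferentiableOn ℂ F (Metric.ball (x : ℂ) r) ∧
      ∀ t : ℝ, (t : ℂ) ∈ Metric.ball (x : ℂ) r → F t = f t := by
  obtain ⟨p, R, hp⟩ := hf
  obtain ⟨r, hr0, hrR⟩ := ENNReal.lt_iff_exists_nnreal_btwn.mp hp.r_pos
  have hr0' : 0 < (r : ℝ) := by exact_mod_cast hr0
  have hsum := p.summable_norm_mul_pow (hrR.trans_le hp.r_le)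
  refine ⟨r, hr0', fun z => ∑' n : ℕ, (z - x) ^ n • p.coeff n, ?_, fun t ht => ?_⟩
  · refine Complex.differentiableOn_tsum_of_summable_norm hsum (fun n => ?_) Metric.isOpen_ball
      fun n z hz => ?_
    · exact DifferentiableOn.smul_const (by fun_prop) _
    · rw [norm_smul, norm_pow, ← p.norm_apply_eq_norm_coef, mul_comm]
      rw [mem_ball_iff_norm] at hz
      gcongr
  · have h1 : (t - x) ∈ Metric.eball (0 : ℝ) R := by
      rw [mem_ball_iff_norm, ← Complex.ofReal_sub, Complex.norm_real] at ht
      rw [Metric.mem_eball, edist_zero_right]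
      refine lt_trans ?_ hrR
      rw [enorm_eq_nnnorm]
      exact_mod_cast ht
    have h2 := (hp.hasSum h1).tsum_eq
    rw [add_sub_cancel] at h2
    rw [← h2]
    refine tsum_congr fun n => ?_
    rw [p.apply_eq_pow_smul_coeff, ← Complex.ofReal_sub, ← Complex.ofReal_pow, Complex.coe_smul]

/-- A real-analytic function near a compact interval is the restriction of a holomorphic function:
the local power series glue by the identity theorem. -/
lemma isGerm_of_analyticOnNhd [CompleteSpace V] {l r : ℝ} (hlr : l < r) {f : ℝ → V}
    (hf : AnalyticOnNhd ℝ f (Icc l r)) : IsGerm (Ioo l r) f := by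
  choose! R hR F hF hFf using fun x (hx : x ∈ Icc l r) => exists_ball_extension (hf x hx)
  have hagree : ∀ x ∈ Icc l r, ∀ x' ∈ Icc l r,
      EqOn (F x) (F x') (Metric.ball (x : ℂ) (R x) ∩ Metric.ball (x' : ℂ) (R x')) := by
    intro x hx x' hx' z hz
    have hpre : IsPreconnected (Metric.ball (x : ℂ) (R x) ∩ Metric.ball (x' : ℂ) (R x')) :=
      ((convex_ball _ _).inter (convex_ball _ _)).isPreconnected
    have hopen : IsOpen (Metric.ball (x : ℂ) (R x) ∩ Metric.ball (x' : ℂ) (R x')) :=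
      Metric.isOpen_ball.inter Metric.isOpen_ball
    have hre : ∀ (a : ℝ) (b : ℝ), z ∈ Metric.ball (a : ℂ) b →
        ((z.re : ℝ) : ℂ) ∈ Metric.ball (a : ℂ) b := by
      intro a b h
      rw [mem_ball_iff_norm] at h ⊢
      rw [← Complex.ofReal_sub, Complex.norm_real]
      refine lt_of_le_of_lt ?_ h
      simpa using Complex.abs_re_le_norm (z - a)
    have hmem : ((z.re : ℝ) : ℂ) ∈ Metric.ball (x : ℂ) (R x) ∩ Metric.ball (x' : ℂ) (R x') :=
      ⟨hre _ _ hz.1, hre _ _ hz.2⟩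
    refine AnalyticOnNhd.eqOn_of_preconnected_of_frequently_eq
      (((hF x hx).mono inter_subset_left).analyticOnNhd hopen)
      (((hF x' hx').mono inter_subset_right).analyticOnNhd hopen) hpre hmem ?_ hz
    -- Both extensions restrict to `f` on the real line near `Re z`.
    have htend : Tendsto (fun t : ℝ => (t : ℂ)) (𝓝[≠] z.re) (𝓝[≠] ((z.re : ℝ) : ℂ)) :=
      tendsto_nhdsWithin_of_tendsto_nhds_of_eventually_within _
        ((Complex.continuous_ofReal.tendsto _).mono_left nhdsWithin_le_nhds) (by
          filter_upwards [self_mem_nhdsWithin] with t ht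
          exact fun h => ht (Complex.ofReal_injective h))
    refine htend.frequently (Eventually.frequently ?_)
    refine Filter.Eventually.filter_mono nhdsWithin_le_nhds ?_
    filter_upwards [(hopen.preimage Complex.continuous_ofReal).mem_nhds hmem] with t ht
    rw [hFf x hx t ht.1, hFf x' hx' t ht.2]
  set O : Set ℂ := ⋃ x ∈ Icc l r, Metric.ball (x : ℂ) (R x) with hO
  have hOopen : IsOpen O := isOpen_biUnion fun _ _ => Metric.isOpen_ball
  classical
  set ψ : ℂ → V := fun z => if h : ∃ x ∈ Icc l r, z ∈ Metric.ball (x : ℂ) (R x) then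
    F h.choose z else 0 with hψ
  have hψF : ∀ x ∈ Icc l r, EqOn ψ (F x) (Metric.ball (x : ℂ) (R x)) := by
    intro x hx z hz
    have hex : ∃ x ∈ Icc l r, z ∈ Metric.ball (x : ℂ) (R x) := ⟨x, hx, hz⟩
    simp only [hψ]
    rw [dif_pos hex]
    exact hagree _ hex.choose_spec.1 x hx ⟨hex.choose_spec.2, hz⟩
  have hψd : DifferentiableOn ℂ ψ O := by
    intro z hz
    obtain ⟨x, hx, hzx⟩ := mem_iUnion₂.mp hz
    have h1 := (hF x hx).differentiableAt (Metric.isOpen_ball.mem_nhds hzx)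
    exact (h1.congr_of_eventuallyEq
      ((hψF x hx).eventuallyEq_of_mem (Metric.isOpen_ball.mem_nhds hzx))).differentiableWithinAt
  have hKc : IsCompact ((fun x : ℝ => (x : ℂ)) '' Icc l r) :=
    isCompact_Icc.image Complex.continuous_ofReal
  have hKO : (fun x : ℝ => (x : ℂ)) '' Icc l r ⊆ O := by
    rintro _ ⟨x, hx, rfl⟩
    exact mem_iUnion₂.mpr ⟨x, hx, Metric.mem_ball_self (hR x hx)⟩
  obtain ⟨δ, hδ, hδO⟩ := hKc.exists_cthickening_subset_open hOopen hKO
  have hconv : Convex ℝ ((fun x : ℝ => (x : ℂ)) '' Icc l r) :=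
    (convex_Icc l r).is_linear_image Complex.ofRealCLM.isBoundedLinearMap.toIsLinearMap
  have hself := Metric.self_subset_thickening hδ ((fun x : ℝ => (x : ℂ)) '' Icc l r)
  refine ⟨Metric.thickening δ ((fun x : ℝ => (x : ℂ)) '' Icc l r), Metric.isOpen_thickening,
    ⟨⟨l, hself ⟨l, ⟨le_rfl, hlr.le⟩, rfl⟩⟩, (hconv.thickening δ).isPreconnected⟩, ?_, ψ,
    (hψd.mono ((Metric.closure_thickening_subset_cthickening _ _).trans hδO)).diffContOnCl,
    fun x hx => ?_⟩
  · rw [closure_Ioo hlr.ne]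
    exact fun x hx => hself ⟨x, hx, rfl⟩
  · have hx' : x ∈ Icc l r := Ioo_subset_Icc_self hx
    rw [hψF x hx' (Metric.mem_ball_self (hR x hx')),
      hFf x hx' x (Metric.mem_ball_self (hR x hx'))]

end Complexification

/-! ### The action of the group elements -/

section Formulas

variable {V : Type*} [NormedAddCommGroup V] [InnerProductSpace ℂ V]
  {χ : triangleGroup →* (V ≃ₗᵢ[ℂ] V)} {s : ℂ}

lemma alpha_apply_of_inv_eq {h : triangleGroup} {A : Matrix (Fin 2) (Fin 2) ℝ} {hA : A.det ≠ 0}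
    (hh : ((h⁻¹ : triangleGroup) : PGL(2, ℝ)) = pgl A hA) (F : ℝ → V) (x : ℝ) :
    alpha χ s h F x = ((|A.det| / (A 1 0 * x + A 1 1) ^ 2 : ℝ) : ℂ) ^ s •
      χ h (F ((A 0 0 * x + A 0 1) / (A 1 0 * x + A 1 1))) := by
  change ((absDeriv ((h⁻¹ : triangleGroup) : PGL(2, ℝ)) x : ℝ) : ℂ) ^ s •
    χ h (F (moebius ((h⁻¹ : triangleGroup) : PGL(2, ℝ)) x)) = _
  rw [hh]
  rfl

lemma pgl_one : pgl 1 (by simp) = 1 := by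
  unfold pgl
  rw [← map_one Matrix.ProjGenLinGroup.mk]
  congr 1
  ext i j
  simp [Matrix.GeneralLinearGroup.mkOfDetNeZero]

lemma pgl_congr {A B : Matrix (Fin 2) (Fin 2) ℝ} (h : A = B) (hA : A.det ≠ 0) (hB : B.det ≠ 0) :
    pgl A hA = pgl B hB := by
  subst h
  rfl

lemma inv_pgl_eq {A B : Matrix (Fin 2) (Fin 2) ℝ} (hA : A.det ≠ 0) (hB : B.det ≠ 0)
    (h : A * B = 1) : (pgl A hA)⁻¹ = pgl B hB := by
  rw [inv_eq_iff_mul_eq_one, pgl_mul, ← pgl_one]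
  exact pgl_congr h _ _

lemma coe_k₁_inv_inv : ((k₁⁻¹⁻¹ : triangleGroup) : PGL(2, ℝ)) = pgl !![1, 2; 0, 1] (by simp) := by
  rw [inv_inv]
  rfl

lemma coe_k₁_pow (n : ℕ) :
    ((k₁ ^ n : triangleGroup) : PGL(2, ℝ)) = pgl !![1, n * 2; 0, 1] (by simp) := by
  induction n with
  | zero =>
    rw [pow_zero, OneMemClass.coe_one, ← pgl_one]
    refine pgl_congr ?_ _ _
    ext i j
    fin_cases i <;> fin_cases j <;> simp
  | succ n ih =>
    rw [pow_succ, Subgroup.coe_mul, ih]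
    change _ * pgl !![1, 2; 0, 1] _ = _
    rw [pgl_mul]
    refine pgl_congr ?_ _ _
    ext i j
    fin_cases i <;> fin_cases j <;> simp
    ring

lemma coe_k₂_inv : ((k₂⁻¹ : triangleGroup) : PGL(2, ℝ)) = pgl !![0, -1; 1, 2] (by simp) := by
  rw [Subgroup.coe_inv]
  refine inv_pgl_eq _ _ ?_
  ext i j
  fin_cases i <;> fin_cases j <;> simp

lemma coe_k₂_pow_inv (n : ℕ) : (((k₂ ^ n)⁻¹ : triangleGroup) : PGL(2, ℝ)) =
    pgl !![1 - n, -n; n, 1 + n] (by rw [Matrix.det_fin_two_of]; ring_nf; simp) := by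
  induction n with
  | zero =>
    rw [pow_zero, inv_one, OneMemClass.coe_one, ← pgl_one]
    refine pgl_congr ?_ _ _
    ext i j
    fin_cases i <;> fin_cases j <;> simp
  | succ n ih =>
    rw [pow_succ', mul_inv_rev, Subgroup.coe_mul, ih, coe_k₂_inv, pgl_mul]
    refine pgl_congr ?_ _ _
    ext i j
    fin_cases i <;> fin_cases j <;> simp <;> ring

lemma coe_J_inv : ((elJ⁻¹ : triangleGroup) : PGL(2, ℝ)) = pgl !![-1, 0; 0, 1] (by simp) := by
  rw [Subgroup.coe_inv]
  refine inv_pgl_eq _ _ ?_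
  ext i j
  fin_cases i <;> fin_cases j <;> simp

lemma coe_S_inv : ((elS⁻¹ : triangleGroup) : PGL(2, ℝ)) = pgl !![0, -1; 1, 0] (by simp) := by
  rw [Subgroup.coe_inv]
  refine inv_pgl_eq _ _ ?_
  ext i j
  fin_cases i <;> fin_cases j <;> simp

lemma coe_Q_inv : ((elQ⁻¹ : triangleGroup) : PGL(2, ℝ)) = pgl !![0, 1; 1, 0] (by simp) := by
  rw [Subgroup.coe_inv]
  refine inv_pgl_eq _ _ ?_
  ext i j
  fin_cases i <;> fin_cases j <;> simp

lemma coe_k₂J_inv :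
    (((k₂ * elJ)⁻¹ : triangleGroup) : PGL(2, ℝ)) = pgl !![0, 1; 1, 2] (by simp) := by
  rw [mul_inv_rev, Subgroup.coe_mul, coe_J_inv, coe_k₂_inv, pgl_mul]
  refine pgl_congr ?_ _ _
  ext i j
  fin_cases i <;> fin_cases j <;> simp

lemma coe_TinvJ_inv :
    (((elT⁻¹ * elJ)⁻¹ : triangleGroup) : PGL(2, ℝ)) = pgl !![-1, -2; 0, 1] (by simp) := by
  rw [mul_inv_rev, inv_inv, Subgroup.coe_mul, coe_J_inv]
  change _ * pgl !![1, 2; 0, 1] _ = _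
  rw [pgl_mul]
  refine pgl_congr ?_ _ _
  ext i j
  fin_cases i <;> fin_cases j <;> simp

lemma coe_STinvJ_inv :
    (((elS * elT⁻¹ * elJ)⁻¹ : triangleGroup) : PGL(2, ℝ)) = pgl !![-2, 1; 1, 0] (by simp) := by
  rw [mul_assoc, mul_inv_rev, Subgroup.coe_mul, coe_TinvJ_inv, coe_S_inv, pgl_mul]
  refine pgl_congr ?_ _ _
  ext i j
  fin_cases i <;> fin_cases j <;> simp

lemma one_div_sq_cpow {t : ℝ} (ht : t ≠ 0) (s : ℂ) :
    ((1 / t ^ 2 : ℝ) : ℂ) ^ s = ((|t| : ℝ) : ℂ) ^ (-2 * s) := by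
  have h0 : 0 < |t| := abs_pos.mpr ht
  have h1 : 0 < 1 / t ^ 2 := by positivity
  rw [Complex.cpow_def_of_ne_zero (by exact_mod_cast h1.ne'),
    Complex.cpow_def_of_ne_zero (by exact_mod_cast h0.ne'), ← Complex.ofReal_log h1.le,
    ← Complex.ofReal_log h0.le, Real.log_abs, one_div, Real.log_inv, Real.log_pow]
  push_cast
  ring_nf

lemma alpha_k₁_inv (F : ℝ → V) (x : ℝ) : alpha χ s k₁⁻¹ F x = χ k₁⁻¹ (F (x + 2)) := by
  rw [alpha_apply_of_inv_eq coe_k₁_inv_inv]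
  simp

lemma alpha_k₁_pow_inv (n : ℕ) (F : ℝ → V) (x : ℝ) :
    alpha χ s (k₁ ^ n)⁻¹ F x = (χ k₁⁻¹ ^ n) (F (x + n * 2)) := by
  have h : (((k₁ ^ n)⁻¹⁻¹ : triangleGroup) : PGL(2, ℝ)) = pgl !![1, n * 2; 0, 1] (by simp) := by
    rw [inv_inv, coe_k₁_pow]
  rw [alpha_apply_of_inv_eq h, ← inv_pow, map_pow]
  simp

lemma alpha_k₂ (F : ℝ → V) {x : ℝ} (hx : -1 < x) :
    alpha χ s k₂ F x = ((x + 2 : ℝ) : ℂ) ^ (-2 * s) • χ k₂ (F (-(x + 2)⁻¹)) := by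
  rw [alpha_apply_of_inv_eq coe_k₂_inv]
  have h := one_div_sq_cpow (t := x + 2) (by linarith) s
  rw [abs_of_pos (by linarith : 0 < x + 2)] at h
  rw [← h]
  simp [neg_div]

lemma alpha_k₂_pow (n : ℕ) (F : ℝ → V) {x : ℝ} (hx : -1 < x) :
    alpha χ s (k₂ ^ n) F x = ((1 + n * (x + 1) : ℝ) : ℂ) ^ (-2 * s) •
      (χ k₂ ^ n) (F (-1 + (x + 1) / (1 + n * (x + 1)))) := by
  rw [alpha_apply_of_inv_eq (coe_k₂_pow_inv n), map_pow]
  have h0 : 0 < 1 + n * (x + 1) := by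
    have : 0 ≤ n * (x + 1) := mul_nonneg (Nat.cast_nonneg _) (by linarith)
    linarith
  have h := one_div_sq_cpow h0.ne' s
  rw [abs_of_pos h0] at h
  rw [← h]
  have h1 : (1 - (n : ℝ)) * (1 + n) - -n * n = 1 := by ring
  have h2 : (n : ℝ) * x + (1 + n) = 1 + n * (x + 1) := by ring
  have h3 : ((1 - (n : ℝ)) * x + -n) / (1 + n * (x + 1)) =
      -1 + (x + 1) / (1 + n * (x + 1)) := by
    field_simp
    ring
  simp only [Matrix.det_fin_two_of, Matrix.of_apply, Matrix.cons_val', Matrix.cons_val_zero,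
    Matrix.cons_val_one, Matrix.cons_val_fin_one]
  rw [h1, h2, h3, abs_one]

lemma alpha_k₂J (F : ℝ → V) {x : ℝ} (hx : -1 < x) : alpha χ s (k₂ * elJ) F x =
    ((x + 2 : ℝ) : ℂ) ^ (-2 * s) • χ (k₂ * elJ) (F (x + 2)⁻¹) := by
  rw [alpha_apply_of_inv_eq coe_k₂J_inv]
  have h := one_div_sq_cpow (t := x + 2) (by linarith) s
  rw [abs_of_pos (by linarith : 0 < x + 2)] at h
  rw [← h]
  simp

lemma alpha_Q (F : ℝ → V) {x : ℝ} (hx : 0 < x) :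
    alpha χ s elQ F x = (x : ℂ) ^ (-2 * s) • χ elQ (F x⁻¹) := by
  rw [alpha_apply_of_inv_eq coe_Q_inv]
  have h := one_div_sq_cpow hx.ne' s
  rw [abs_of_pos hx] at h
  rw [← h]
  simp

lemma alpha_S (F : ℝ → V) {x : ℝ} (hx : x ≠ 0) :
    alpha χ s elS F x = ((|x| : ℝ) : ℂ) ^ (-2 * s) • χ elS (F (-x⁻¹)) := by
  rw [alpha_apply_of_inv_eq coe_S_inv, ← one_div_sq_cpow hx s]
  simp [neg_div]

lemma alpha_J (F : ℝ → V) (x : ℝ) : alpha χ s elJ F x = χ elJ (F (-x)) := by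
  rw [alpha_apply_of_inv_eq coe_J_inv]
  simp

lemma alpha_TinvJ (F : ℝ → V) (x : ℝ) :
    alpha χ s (elT⁻¹ * elJ) F x = χ (elT⁻¹ * elJ) (F (-(x + 2))) := by
  rw [alpha_apply_of_inv_eq coe_TinvJ_inv]
  simp [add_comm]

lemma alpha_STinvJ (F : ℝ → V) {x : ℝ} (hx : x ≠ 0) : alpha χ s (elS * elT⁻¹ * elJ) F x =
    ((|x| : ℝ) : ℂ) ^ (-2 * s) • χ (elS * elT⁻¹ * elJ) (F (x⁻¹ - 2)) := by
  rw [alpha_apply_of_inv_eq coe_STinvJ_inv, ← one_div_sq_cpow hx s]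
  have h1 : (-(2 * x) + 1) / x = x⁻¹ - 2 := by field_simp; ring
  simp [h1]

lemma ofReal_mul_cpow {a b : ℝ} (ha : 0 < a) (hb : 0 < b) (p : ℂ) :
    ((a * b : ℝ) : ℂ) ^ p = (a : ℂ) ^ p * (b : ℂ) ^ p := by
  rw [Complex.ofReal_mul, Complex.mul_cpow_ofReal_nonneg ha.le hb.le]

lemma chi_Q_chi_Q (v : V) : χ elQ (χ elQ v) = v := by
  have h : elQ * elQ = 1 := by
    apply Subtype.ext
    change pgl !![0, 1; 1, 0] _ * pgl !![0, 1; 1, 0] _ = 1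
    rw [pgl_mul, ← pgl_one]
    refine pgl_congr ?_ _ _
    ext i j
    fin_cases i <;> fin_cases j <;> simp
  have h1 := congrArg χ h
  rw [map_mul, map_one] at h1
  exact congrArg (fun g : V ≃ₗᵢ[ℂ] V => g v) h1

lemma alpha_Q_alpha_Q (F : ℝ → V) {x : ℝ} (hx : 0 < x) :
    alpha χ s elQ (alpha χ s elQ F) x = F x := by
  rw [alpha_Q _ hx, alpha_Q _ (inv_pos.mpr hx), map_smul, chi_Q_chi_Q, inv_inv, smul_smul,
    ← ofReal_mul_cpow hx (inv_pos.mpr hx), mul_inv_cancel₀ hx.ne']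
  simp

lemma alpha_k₂_smul_comp_inv (M : ℝ → V) {x : ℝ} (hx : -1 < x) :
    alpha χ s k₂ (fun x => ((x + 1 : ℝ) : ℂ) ^ (-2 * s) • M (x + 1)⁻¹) x =
      ((x + 1 : ℝ) : ℂ) ^ (-2 * s) • χ k₂ (M ((x + 1)⁻¹ + 1)) := by
  have h1 : 0 < x + 1 := by linarith
  have h2 : 0 < x + 2 := by linarith
  have h3 : (x + 2) * (-(x + 2)⁻¹ + 1) = x + 1 := by field_simp; ring
  have h4 : 0 < -(x + 2)⁻¹ + 1 := by
    rw [show -(x + 2)⁻¹ + 1 = (x + 1) / (x + 2) by field_simp; ring]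
    positivity
  have h5 : (-(x + 2)⁻¹ + 1)⁻¹ = (x + 1)⁻¹ + 1 := by
    rw [show -(x + 2)⁻¹ + 1 = (x + 1) / (x + 2) by field_simp; ring]
    field_simp
    ring
  rw [alpha_k₂ _ hx, map_smul, smul_smul, ← ofReal_mul_cpow h2 h4, h3, h5]

lemma extZero_of_mem {I : Set ℝ} (f : I → V) {x : ℝ} (hx : x ∈ I) : extZero I f x = f ⟨x, hx⟩ :=
  dif_pos hx

end Formulas

/-! ### The fast operators as twisted Hurwitz series -/

section FastOperators

variable {V : Type*} [NormedAddCommGroup V] [InnerProductSpace ℂ V] [FiniteDimensional ℂ V]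
  {χ : triangleGroup →* (V ≃ₗᵢ[ℂ] V)} {s : ℂ}

/-- `(1 + L_{1,s}^fast) f` and its asymptotics: up to the scaling of the action, it is a twisted
Hurwitz function with step `2`. -/
lemma exists_fastOne_solution (hs : s ∈ contDomain) {f : Ec → V}
    (hf : IsGerm Eb (alpha χ s elQ (extZero Ec f))) :
    ∃ Φ : ℝ → V, AnalyticOnNhd ℝ Φ Ec ∧
      (∀ x ∈ I₀, HasContinuedSum (fastOneTerm χ s f x) s (alpha χ s k₁⁻¹ Φ x)) ∧
      (∀ x ∈ Ec, Φ x = extZero Ec f x + alpha χ s k₁⁻¹ Φ x) ∧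
      ∃ c : V, (fun x : ℝ => Φ x - (x : ℂ) ^ (1 - 2 * s) • c)
        =O[atTop] fun x : ℝ => (x : ℂ) ^ (-2 * s) := by
  obtain ⟨O, hO, -, hsub, ψ, hψ, hψf⟩ := hf
  rw [closure_Ioo zero_ne_one] at hsub
  set U := χ k₁⁻¹ with hU
  -- `α_z(Q) g` is `X^(-2z) G(1/X)`, as the continuation in `z` keeps `g = α_s(Q) f` fixed.
  set G : ℂ → V := fun t => χ elQ (ψ t) with hG
  obtain ⟨v, w, ρ, K, H⟩ := exists_hurwitzData (G := G) U two_pos hO hsub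
    ((χ elQ).toContinuousLinearEquiv.differentiable.comp_differentiableOn hψ.differentiableOn)
  set g := alpha χ s elQ (extZero Ec f) with hg
  have hGg : ∀ X : ℝ, 1 < X → ∀ z : ℂ, (X : ℂ) ^ (-2 * z) • G (X : ℂ)⁻¹ = alpha χ z elQ g X := by
    intro X hX z
    have hX0 : 0 < X := by linarith
    have h1 : X⁻¹ ∈ Eb := ⟨inv_pos.mpr hX0, inv_lt_one_of_one_lt₀ hX⟩
    rw [alpha_Q _ hX0, hG, ← hψf _ h1, Complex.ofReal_inv]
  refine ⟨fun y => hurwitz U 2 G v w s y, H.analyticOnNhd_hurwitz hs, fun x hx => ?_,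
    fun x hx => ?_, H.hurwitz_asymptotics hs⟩
  · have hx1 : 1 < x + 2 := by linarith [mem_Ioi.mp hx]
    refine ⟨fun z => U (hurwitz U 2 G v w z ((x + 2 : ℝ) : ℂ)),
      U.toContinuousLinearEquiv.differentiable.comp_differentiableOn
        (H.differentiableOn_hurwitz_param (ofReal_mem_halfStrip H.rho_pos hx1)),
      fun z hz => ?_, ?_⟩
    · have h1 := (U.toContinuousLinearEquiv : V →L[ℂ] V).hasSum (H.hasSum_hurwitz hz hx1)
      refine h1.congr_fun fun n => ?_
      have hX : 1 < x + 2 + n * 2 := by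
        have : (0 : ℝ) ≤ n * 2 := by positivity
        linarith
      rw [fastOneTerm, alpha_k₁_pow_inv, ← hg, ← hU]
      rw [show x + ((n + 1 : ℕ) : ℝ) * 2 = x + 2 + n * 2 by push_cast; ring, ← hGg _ hX, pow_succ']
      rfl
    · rw [alpha_k₁_inv]
  · have h1 := H.hurwitz_eq hs (ofReal_mem_halfStrip H.rho_pos hx)
    rw [alpha_k₁_inv]
    beta_reduce
    rw [h1, hGg x hx s, hg, alpha_Q_alpha_Q _ (by linarith [mem_Ioi.mp hx])]
    push_cast
    rfl

/-- `(1 + L_{2,s}^fast) f` and its asymptotics: in the coordinate `1/(x + 1)` it is a twisted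
Hurwitz function with step `1`. -/
lemma exists_fastTwo_solution (hs : s ∈ contDomain) {f : Ea → V}
    (hf : IsGerm Ea (extZero Ea f)) :
    ∃ Φ : ℝ → V, AnalyticOnNhd ℝ Φ Ea ∧
      (∀ x ∈ I₀, HasContinuedSum (fastTwoTerm χ f x) s (alpha χ s k₂ Φ x)) ∧
      (∀ x ∈ Ea, Φ x = extZero Ea f x + alpha χ s k₂ Φ x) ∧
      ∃ c : V, (fun x : ℝ => Φ x - ((x : ℂ) + 1)⁻¹ • c) =O[𝓝[>] (-1)] fun _ => (1 : ℝ) := by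
  obtain ⟨O, hO, -, hsub, ψ, hψ, hψf⟩ := hf
  rw [closure_Ioo (by norm_num)] at hsub
  set U := χ k₂ with hU
  set G : ℂ → V := fun t => ψ (-1 + t) with hG
  have hadd : Continuous fun t : ℂ => -1 + t := by fun_prop
  have hdiff : DifferentiableOn ℂ G ((fun t : ℂ => -1 + t) ⁻¹' O) :=
    hψ.differentiableOn.comp (by fun_prop) fun t ht => ht
  obtain ⟨v, w, ρ, K, H⟩ := exists_hurwitzData U one_pos (hO.preimage hadd) (fun x hx => by
    have := hsub (-1 + x) ⟨by linarith [hx.1], by linarith [hx.2]⟩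
    simpa using this) hdiff
  have hGf : ∀ X : ℝ, 1 < X → G (X : ℂ)⁻¹ = extZero Ea f (-1 + X⁻¹) := by
    intro X hX
    have hX0 : 0 < X := by linarith
    have h1 : X⁻¹ < 1 := inv_lt_one_of_one_lt₀ hX
    have h2 : -1 + X⁻¹ ∈ Ea := ⟨by linarith [inv_pos.mpr hX0], by linarith⟩
    rw [← hψf _ h2, hG]
    push_cast
    rfl
  set M : ℂ → ℝ → V := fun z y => hurwitz U 1 G v w z y with hM
  have hcpow : ∀ x : ℝ, -1 < x → AnalyticAt ℝ (fun x : ℝ => ((x + 1 : ℝ) : ℂ) ^ (-2 * s)) x := by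
    intro x hx
    have h1 : AnalyticAt ℂ (fun z : ℂ => z ^ (-2 * s)) ((x + 1 : ℝ) : ℂ) :=
      analyticAt_id.cpow analyticAt_const (Or.inl (by
        rw [id, Complex.ofReal_re]
        linarith))
    exact AnalyticAt.fun_comp (f := fun x : ℝ => ((x + 1 : ℝ) : ℂ))
      (h1.restrictScalars (𝕜 := ℝ)) (AnalyticAt.fun_comp (f := fun x : ℝ => x + 1)
        (Complex.ofRealCLM.analyticAt (x + 1)) (analyticAt_id.add analyticAt_const))
  refine ⟨fun x => ((x + 1 : ℝ) : ℂ) ^ (-2 * s) • M s (x + 1)⁻¹, fun x hx => ?_, fun x hx => ?_,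
    fun x hx => ?_, ?_⟩
  · have h0 : 0 < x + 1 := by linarith [hx.1]
    have h1 : (1 : ℝ) < (x + 1)⁻¹ := (one_lt_inv₀ h0).mpr (by linarith [hx.2])
    have h2 : AnalyticAt ℝ (fun x : ℝ => (x + 1)⁻¹) x :=
      (analyticAt_id.add analyticAt_const).inv h0.ne'
    have h3 : AnalyticAt ℝ (fun x : ℝ => M s (x + 1)⁻¹) x :=
      AnalyticAt.fun_comp (f := fun x : ℝ => (x + 1)⁻¹) (H.analyticOnNhd_hurwitz hs _ h1) h2
    exact (hcpow x hx.1).smul h3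
  · have hx' : -1 < x := hx
    have h0 : 0 < x + 1 := by linarith
    have h1 : 1 < (x + 1)⁻¹ + 1 := by linarith [inv_pos.mpr h0]
    have h0C : ((x + 1 : ℝ) : ℂ) ≠ 0 := by exact_mod_cast h0.ne'
    refine ⟨fun z => ((x + 1 : ℝ) : ℂ) ^ (-2 * z) • U (M z ((x + 1)⁻¹ + 1)),
      DifferentiableOn.smul ?_ (U.toContinuousLinearEquiv.differentiable.comp_differentiableOn
        (H.differentiableOn_hurwitz_param (ofReal_mem_halfStrip H.rho_pos h1))),
      fun z hz => ?_, ?_⟩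
    · have : DifferentiableOn ℂ (fun z : ℂ => -2 * z) contDomain := by fun_prop
      exact this.const_cpow (Or.inl h0C)
    · have h2 := ((U.toContinuousLinearEquiv : V →L[ℂ] V).hasSum
        (H.hasSum_hurwitz hz h1)).const_smul (((x + 1 : ℝ) : ℂ) ^ (-2 * z))
      refine h2.congr_fun fun n => ?_
      have hX : 1 < (x + 1)⁻¹ + 1 + n * 1 := by
        have : (0 : ℝ) ≤ n := by positivity
        linarith
      have hmul : 1 + ((n + 1 : ℕ) : ℝ) * (x + 1) = (x + 1) * ((x + 1)⁻¹ + 1 + n * 1) := by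
        push_cast
        field_simp
        ring
      rw [fastTwoTerm, alpha_k₂_pow _ _ hx', ← hU, hmul, ofReal_mul_cpow h0 (by linarith), hGf _ hX,
        mul_smul, ← div_div, div_self h0.ne', one_div, ← map_smul, pow_succ']
      rfl
    · exact (alpha_k₂_smul_comp_inv (M s) hx').symm
  · have h0 : 0 < x + 1 := by linarith [hx.1]
    have h1 : (1 : ℝ) < (x + 1)⁻¹ := (one_lt_inv₀ h0).mpr (by linarith [hx.2])
    have h2 := H.hurwitz_eq hs (ofReal_mem_halfStrip H.rho_pos h1)
    have h3 : ((x + 1 : ℝ) : ℂ) ^ (-2 * s) * (((x + 1)⁻¹ : ℝ) : ℂ) ^ (-2 * s) = 1 := by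
      rw [← ofReal_mul_cpow h0 (inv_pos.mpr h0), mul_inv_cancel₀ h0.ne']
      simp
    rw [alpha_k₂_smul_comp_inv (M s) hx.1]
    simp only [hM]
    rw [h2, smul_add, smul_smul, h3, one_smul, hGf _ h1, inv_inv]
    push_cast
    simp [hU]
  · obtain ⟨c, hc⟩ := H.hurwitz_asymptotics hs
    refine ⟨c, ?_⟩
    have htend : Tendsto (fun x : ℝ => (x + 1)⁻¹) (𝓝[>] (-1)) atTop := by
      refine tendsto_inv_nhdsGT_zero.comp (tendsto_nhdsWithin_of_tendsto_nhds_of_eventually_within _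
        ?_ ?_)
      · have : Tendsto (fun x : ℝ => x + 1) (𝓝 (-1)) (𝓝 (-1 + 1)) :=
          (continuous_id.add continuous_const).tendsto _
        rw [neg_add_cancel] at this
        exact this.mono_left nhdsWithin_le_nhds
      · filter_upwards [self_mem_nhdsWithin] with x hx
        simp only [mem_Ioi] at hx ⊢
        linarith
    have h1 := (isBigO_refl (fun x : ℝ => ((x + 1 : ℝ) : ℂ) ^ (-2 * s)) (𝓝[>] (-1))).smul
      (hc.comp_tendsto htend)
    have hone : ∀ x : ℝ, -1 < x →
        ((x + 1 : ℝ) : ℂ) ^ (-2 * s) * (((x + 1)⁻¹ : ℝ) : ℂ) ^ (-2 * s) = 1 := by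
      intro x hx
      have h0 : 0 < x + 1 := by linarith
      rw [← ofReal_mul_cpow h0 (inv_pos.mpr h0), mul_inv_cancel₀ h0.ne']
      simp
    refine (h1.congr' ?_ ?_).trans (isBigO_const_const (1 : ℂ) one_ne_zero _)
    · filter_upwards [self_mem_nhdsWithin] with x hx
      have hx' : 0 < x + 1 := by linarith [mem_Ioi.mp hx]
      have h0C : (((x + 1)⁻¹ : ℝ) : ℂ) ≠ 0 := by exact_mod_cast (inv_pos.mpr hx').ne'
      simp only [Function.comp_apply, hM]
      rw [smul_sub, smul_smul, show (1 : ℂ) - 2 * s = -2 * s + 1 by ring, Complex.cpow_add _ _ h0C,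
        Complex.cpow_one, ← mul_assoc, hone x hx, one_mul]
      push_cast
      rfl
    · filter_upwards [self_mem_nhdsWithin] with x hx
      simp only [Function.comp_apply, smul_eq_mul]
      exact hone x hx

end FastOperators

/-! ### Regularity of the action -/

section AlphaRegularity

variable {V : Type*} [NormedAddCommGroup V] [InnerProductSpace ℂ V]
  {χ : triangleGroup →* (V ≃ₗᵢ[ℂ] V)} {s : ℂ}

/-- The cocycle identity `α_s(g h) = α_s(g) α_s(h)` at a point where both sides make sense. -/
lemma alpha_mul_apply {g h : triangleGroup} {A B : Matrix (Fin 2) (Fin 2) ℝ} {hA : A.det ≠ 0}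
    {hB : B.det ≠ 0} (hg : ((g⁻¹ : triangleGroup) : PGL(2, ℝ)) = pgl A hA)
    (hh : ((h⁻¹ : triangleGroup) : PGL(2, ℝ)) = pgl B hB) {x : ℝ}
    (hx : A 1 0 * x + A 1 1 ≠ 0) (F : ℝ → V) :
    alpha χ s (g * h) F x = alpha χ s g (alpha χ s h F) x := by
  have hgh : (((g * h)⁻¹ : triangleGroup) : PGL(2, ℝ)) =
      pgl (B * A) (by rw [Matrix.det_mul]; exact mul_ne_zero hB hA) := by
    rw [mul_inv_rev, Subgroup.coe_mul, hg, hh, pgl_mul]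
  rw [alpha_apply_of_inv_eq hgh, alpha_apply_of_inv_eq hg, alpha_apply_of_inv_eq hh, map_smul,
    smul_smul, ← Complex.mul_cpow_ofReal_nonneg (by positivity) (by positivity),
    ← Complex.ofReal_mul, map_mul]
  set D := A 1 0 * x + A 1 1 with hD
  set N := A 0 0 * x + A 0 1 with hN
  have e1 : ∀ i, (B * A) i 0 * x + (B * A) i 1 = D * (B i 0 * (N / D) + B i 1) := by
    intro i
    rw [Matrix.mul_apply, Matrix.mul_apply, Fin.sum_univ_two, Fin.sum_univ_two, mul_add,
      mul_left_comm, mul_div_cancel₀ _ hx, hD, hN]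
    ring
  rw [e1, e1, mul_div_mul_left _ _ hx, Matrix.det_mul, abs_mul, mul_pow, mul_comm |B.det|,
    mul_div_mul_comm]
  rfl

lemma analyticAt_absDeriv_cpow {A : Matrix (Fin 2) (Fin 2) ℝ} (hA : A.det ≠ 0) {x : ℝ}
    (hx : A 1 0 * x + A 1 1 ≠ 0) :
    AnalyticAt ℝ (fun x : ℝ => ((|A.det| / (A 1 0 * x + A 1 1) ^ 2 : ℝ) : ℂ) ^ s) x := by
  have h1 : AnalyticAt ℝ (fun x : ℝ => |A.det| / (A 1 0 * x + A 1 1) ^ 2) x :=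
    analyticAt_const.div (((analyticAt_const.mul analyticAt_id).add analyticAt_const).pow 2)
      (pow_ne_zero 2 hx)
  have h2 : 0 < |A.det| / (A 1 0 * x + A 1 1) ^ 2 := by positivity
  have h3 : AnalyticAt ℂ (fun z : ℂ => z ^ s)
      ((|A.det| / (A 1 0 * x + A 1 1) ^ 2 : ℝ) : ℂ) :=
    analyticAt_id.cpow analyticAt_const (Or.inl (by rwa [id, Complex.ofReal_re]))
  exact AnalyticAt.fun_comp (f := fun x : ℝ => ((|A.det| / (A 1 0 * x + A 1 1) ^ 2 : ℝ) : ℂ))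
    (h3.restrictScalars (𝕜 := ℝ)) (AnalyticAt.fun_comp
      (f := fun x : ℝ => |A.det| / (A 1 0 * x + A 1 1) ^ 2) (Complex.ofRealCLM.analyticAt _) h1)

lemma analyticAt_moebius (A : Matrix (Fin 2) (Fin 2) ℝ) {x : ℝ}
    (hx : A 1 0 * x + A 1 1 ≠ 0) :
    AnalyticAt ℝ (fun x : ℝ => (A 0 0 * x + A 0 1) / (A 1 0 * x + A 1 1)) x :=
  ((analyticAt_const.mul analyticAt_id).add analyticAt_const).div
    ((analyticAt_const.mul analyticAt_id).add analyticAt_const) hx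

lemma analyticAt_alpha {h : triangleGroup} {A : Matrix (Fin 2) (Fin 2) ℝ} {hA : A.det ≠ 0}
    (hh : ((h⁻¹ : triangleGroup) : PGL(2, ℝ)) = pgl A hA) {F : ℝ → V} {x : ℝ}
    (hx : A 1 0 * x + A 1 1 ≠ 0)
    (hF : AnalyticAt ℝ F ((A 0 0 * x + A 0 1) / (A 1 0 * x + A 1 1))) :
    AnalyticAt ℝ (alpha χ s h F) x := by
  have h1 : alpha χ s h F = fun x => ((|A.det| / (A 1 0 * x + A 1 1) ^ 2 : ℝ) : ℂ) ^ s •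
      χ h (F ((A 0 0 * x + A 0 1) / (A 1 0 * x + A 1 1))) :=
    funext fun x => alpha_apply_of_inv_eq hh F x
  rw [h1]
  have h2 : AnalyticAt ℝ (fun x => F ((A 0 0 * x + A 0 1) / (A 1 0 * x + A 1 1))) x :=
    AnalyticAt.fun_comp (f := fun x : ℝ => (A 0 0 * x + A 0 1) / (A 1 0 * x + A 1 1)) hF
      (analyticAt_moebius A hx)
  have h3 := AnalyticAt.fun_comp
    ((((χ h).toContinuousLinearEquiv : V →L[ℂ] V).restrictScalars ℝ).analyticAt _) h2
  exact (analyticAt_absDeriv_cpow hA hx).smul h3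

lemma contDiffAt_alpha {h : triangleGroup} {A : Matrix (Fin 2) (Fin 2) ℝ} {hA : A.det ≠ 0}
    (hh : ((h⁻¹ : triangleGroup) : PGL(2, ℝ)) = pgl A hA) {F : ℝ → V} {x : ℝ}
    (hx : A 1 0 * x + A 1 1 ≠ 0)
    (hF : ContDiffAt ℝ ∞ F ((A 0 0 * x + A 0 1) / (A 1 0 * x + A 1 1))) :
    ContDiffAt ℝ ∞ (alpha χ s h F) x := by
  have h1 : alpha χ s h F = fun x => ((|A.det| / (A 1 0 * x + A 1 1) ^ 2 : ℝ) : ℂ) ^ s •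
      χ h (F ((A 0 0 * x + A 0 1) / (A 1 0 * x + A 1 1))) :=
    funext fun x => alpha_apply_of_inv_eq hh F x
  rw [h1]
  have h2 : ContDiffAt ℝ ∞ (fun x => F ((A 0 0 * x + A 0 1) / (A 1 0 * x + A 1 1))) x :=
    ContDiffAt.comp (f := fun x : ℝ => (A 0 0 * x + A 0 1) / (A 1 0 * x + A 1 1)) x hF
      (analyticAt_moebius A hx).contDiffAt
  have h3 := (((χ h).toContinuousLinearEquiv : V →L[ℂ] V).restrictScalars ℝ).contDiff
    (n := ∞) |>.contDiffAt.comp x h2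
  exact (analyticAt_absDeriv_cpow hA hx).contDiffAt.smul h3

lemma unit_smul_eq (ε : ℤˣ) (v : V) : ε • v = ((ε : ℤ) : ℝ) • v := by
  rw [Units.smul_def, Int.cast_smul_eq_zsmul]

lemma analyticAt_unit_smul {F : ℝ → V} {x : ℝ} (ε : ℤˣ) (hF : AnalyticAt ℝ F x) :
    AnalyticAt ℝ (ε • F) x := by
  have h : ε • F = ((ε : ℤ) : ℝ) • F := funext fun y => unit_smul_eq ε (F y)
  rw [h]
  exact hF.const_smul

lemma analyticAt_alpha_k₁_inv {F : ℝ → V} {x : ℝ} (hF : AnalyticAt ℝ F (x + 2)) :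
    AnalyticAt ℝ (alpha χ s k₁⁻¹ F) x :=
  analyticAt_alpha coe_k₁_inv_inv (by simp) (by simpa using hF)

lemma analyticAt_alpha_k₂ {F : ℝ → V} {x : ℝ} (hx : -1 ≤ x)
    (hF : AnalyticAt ℝ F (-(x + 2)⁻¹)) : AnalyticAt ℝ (alpha χ s k₂ F) x :=
  analyticAt_alpha coe_k₂_inv (by simp; linarith) (by simpa [neg_div] using hF)

lemma analyticAt_alpha_k₂J {F : ℝ → V} {x : ℝ} (hx : -1 ≤ x)
    (hF : AnalyticAt ℝ F (x + 2)⁻¹) : AnalyticAt ℝ (alpha χ s (k₂ * elJ) F) x :=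
  analyticAt_alpha coe_k₂J_inv (by simp; linarith) (by simpa using hF)

lemma add_two_mem_Ec {x : ℝ} (hx : x ∈ I₀) : x + 2 ∈ Ec := by
  simp only [mem_Ioi] at hx ⊢
  linarith

lemma neg_inv_mem_Ea {x : ℝ} (hx : x ∈ I₀) : -(x + 2)⁻¹ ∈ Ea := by
  have h1 : 1 < x + 2 := add_two_mem_Ec hx
  have h2 := inv_lt_one_of_one_lt₀ h1
  have h3 : 0 < (x + 2)⁻¹ := inv_pos.mpr (by linarith)
  exact ⟨by linarith, by linarith⟩

lemma inv_mem_Eb {x : ℝ} (hx : x ∈ I₀) : (x + 2)⁻¹ ∈ Eb := by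
  have h1 : 1 < x + 2 := add_two_mem_Ec hx
  exact ⟨inv_pos.mpr (by linarith), inv_lt_one_of_one_lt₀ h1⟩

lemma alpha_k₁_inv_congr {F F' : ℝ → V} (h : EqOn F F' Ec) {x : ℝ} (hx : x ∈ I₀) :
    alpha χ s k₁⁻¹ F x = alpha χ s k₁⁻¹ F' x := by
  rw [alpha_k₁_inv, alpha_k₁_inv, h (add_two_mem_Ec hx)]

lemma alpha_k₂_congr {F F' : ℝ → V} (h : EqOn F F' Ea) {x : ℝ} (hx : x ∈ I₀) :
    alpha χ s k₂ F x = alpha χ s k₂ F' x := by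
  rw [alpha_k₂ _ hx, alpha_k₂ _ hx, h (neg_inv_mem_Ea hx)]

lemma alpha_k₂J_congr {F F' : ℝ → V} (h : EqOn F F' Eb) {x : ℝ} (hx : x ∈ I₀) :
    alpha χ s (k₂ * elJ) F x = alpha χ s (k₂ * elJ) F' x := by
  rw [alpha_k₂J _ hx, alpha_k₂J _ hx, h (inv_mem_Eb hx)]

lemma IsGerm.congr {I : Set ℝ} {f g : ℝ → V} (h : IsGerm I f) (hfg : EqOn f g I) :
    IsGerm I g := by
  obtain ⟨O, h₁, h₂, h₃, ψ, h₄, h₅⟩ := h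
  exact ⟨O, h₁, h₂, h₃, ψ, h₄, fun x hx => (h₅ x hx).trans (hfg hx)⟩

lemma IsGerm.analyticOnNhd [CompleteSpace V] {I : Set ℝ} (hI : IsOpen I) {f : ℝ → V}
    (h : IsGerm I f) : AnalyticOnNhd ℝ f I := by
  obtain ⟨O, hO, -, hsub, ψ, hψ, hψf⟩ := h
  intro x hx
  have h1 := (hψ.differentiableOn.analyticOnNhd hO x
    (hsub x (subset_closure hx))).restrictScalars (𝕜 := ℝ)
  refine (AnalyticAt.fun_comp (f := fun x : ℝ => (x : ℂ)) h1
    (Complex.ofRealCLM.analyticAt x)).congr ?_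
  filter_upwards [hI.mem_nhds hx] with y hy
  exact hψf y hy

end AlphaRegularity

/-! ### From fast to slow eigenfunctions and back -/

section Maps

variable {V : Type*} [NormedAddCommGroup V] [InnerProductSpace ℂ V]
  (χ : triangleGroup →* (V ≃ₗᵢ[ℂ] V)) (s : ℂ) (ε : ℤˣ)

/-- The slow eigenfunction of a fast eigenvector `f`. In terms of `f` it is
`L_{2,s}^fast f_a ± α_s(k₂ J) f_b + L_{1,s}^fast f_c` on the whole of `(-1, ∞)`, including the
points `0` and `1` missed by the three intervals. -/
def slowOfFast (f : Vec V) : I₀ → V := fun x =>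
  fastTwo χ s f.1 x + ε • alpha χ s (k₂ * elJ) (extZero Eb f.2.1) x + fastOne χ s f.2.2 x

/-- The fast eigenvector `((1 - α_s(k₂)) φ, φ, (1 - α_s(k₁⁻¹)) φ)` of a slow eigenfunction `φ`. -/
def fastOfSlow (φ : I₀ → V) : Vec V :=
  (fun x => φ ⟨x, Ea_subset x.2⟩ - alpha χ s k₂ (extZero I₀ φ) x,
    fun x => φ ⟨x, Eb_subset x.2⟩,
    fun x => φ ⟨x, Ec_subset x.2⟩ - alpha χ s k₁⁻¹ (extZero I₀ φ) x)

variable {χ s ε}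

lemma slow_eq {φ : I₀ → V} (hφ : φ ∈ SFE χ s ε) {x : ℝ} (hx : x ∈ I₀) :
    extZero I₀ φ x = alpha χ s k₁⁻¹ (extZero I₀ φ) x + alpha χ s k₂ (extZero I₀ φ) x +
      ε • alpha χ s (k₂ * elJ) (extZero I₀ φ) x := by
  rw [extZero_of_mem _ hx]
  exact hφ.2 ⟨x, hx⟩

lemma fastOfSlow_fst {φ : I₀ → V} {x : ℝ} (hx : x ∈ Ea) :
    extZero Ea (fastOfSlow χ s φ).1 x = extZero I₀ φ x - alpha χ s k₂ (extZero I₀ φ) x := by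
  rw [extZero_of_mem _ hx, extZero_of_mem _ (Ea_subset hx)]
  rfl

lemma fastOfSlow_snd {φ : I₀ → V} {x : ℝ} (hx : x ∈ Eb) :
    extZero Eb (fastOfSlow χ s φ).2.1 x = extZero I₀ φ x := by
  rw [extZero_of_mem _ hx, extZero_of_mem _ (Eb_subset hx)]
  rfl

lemma fastOfSlow_trd {φ : I₀ → V} {x : ℝ} (hx : x ∈ Ec) :
    extZero Ec (fastOfSlow χ s φ).2.2 x = extZero I₀ φ x - alpha χ s k₁⁻¹ (extZero I₀ φ) x := by
  rw [extZero_of_mem _ hx, extZero_of_mem _ (Ec_subset hx)]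
  rfl

lemma coe_Qk₂_inv :
    (((elQ * k₂)⁻¹ : triangleGroup) : PGL(2, ℝ)) = pgl !![-1, 0; 2, 1] (by simp) := by
  rw [mul_inv_rev, Subgroup.coe_mul, coe_Q_inv, coe_k₂_inv, pgl_mul]
  refine pgl_congr ?_ _ _
  ext i j
  fin_cases i <;> fin_cases j <;> simp

lemma coe_Qk₂J_inv :
    (((elQ * (k₂ * elJ))⁻¹ : triangleGroup) : PGL(2, ℝ)) = pgl !![1, 0; 2, 1] (by simp) := by
  rw [mul_inv_rev, Subgroup.coe_mul, coe_Q_inv, coe_k₂J_inv, pgl_mul]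
  refine pgl_congr ?_ _ _
  ext i j
  fin_cases i <;> fin_cases j <;> simp

lemma isBigO_sub_sub {l : Filter ℝ} {F F' : ℝ → V} {a : ℝ → ℂ} {c c' : V} {g : ℝ → ℂ}
    (h : (fun x => F x - a x • c) =O[l] g) (h' : (fun x => F' x - a x • c') =O[l] g) :
    (fun x => (F - F') x - a x • (c - c')) =O[l] g := by
  refine (h.sub h').congr_left fun x => ?_
  simp only [Pi.sub_apply, smul_sub]
  abel

/-- A solution of `D = α_s(k₂) D` on `E_a` with a simple-pole asymptotics at `-1` vanishes: in the
coordinate `y = 1/(x + 1)` it is quasi-periodic. -/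
lemma eq_zero_of_alpha_k₂_fixed (hs : s ∈ contDomain) {D : ℝ → V}
    (hD : ∀ x ∈ Ea, D x = alpha χ s k₂ D x) {c : V}
    (hc : (fun x : ℝ => D x - ((x : ℂ) + 1)⁻¹ • c) =O[𝓝[>] (-1)] fun _ => (1 : ℂ)) {x : ℝ}
    (hx : x ∈ Ea) : D x = 0 := by
  set h : ℝ → V := fun y => (y : ℂ) ^ (-2 * s) • D (-1 + y⁻¹) with hh
  have hper : ∀ y, 1 < y → h y = χ k₂ (h (y + 1)) := by
    intro y hy
    have hy0 : 0 < y := by linarith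
    have hyi : y⁻¹ < 1 := inv_lt_one_of_one_lt₀ hy
    have hyi0 : 0 < y⁻¹ := inv_pos.mpr hy0
    have hm : -1 + y⁻¹ ∈ Ea := ⟨by linarith, by linarith⟩
    have e1 : y * (-1 + y⁻¹ + 2) = y + 1 := by field_simp; ring
    have e2 : -(-1 + y⁻¹ + 2)⁻¹ = -1 + (y + 1)⁻¹ := by
      rw [show -1 + y⁻¹ + 2 = (y + 1) / y by field_simp; ring]
      field_simp
      ring
    simp only [hh]
    rw [hD _ hm, alpha_k₂ _ hm.1, smul_smul, ← ofReal_mul_cpow hy0 (by linarith), e1, e2, map_smul]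
  have htend : Tendsto (fun y : ℝ => -1 + y⁻¹) atTop (𝓝[>] (-1)) := by
    refine tendsto_nhdsWithin_of_tendsto_nhds_of_eventually_within _ ?_ ?_
    · simpa using (tendsto_inv_atTop_zero (𝕜 := ℝ)).const_add (-1)
    · filter_upwards [eventually_gt_atTop 0] with y hy
      simp only [mem_Ioi]
      linarith [inv_pos.mpr hy]
  have has : (fun y : ℝ => h y - (y : ℂ) ^ (1 - 2 * s) • c)
      =O[atTop] fun y : ℝ => (y : ℂ) ^ (-2 * s) := by
    refine ((isBigO_refl (fun y : ℝ => (y : ℂ) ^ (-2 * s)) atTop).smul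
      (hc.comp_tendsto htend)).congr' ?_ ?_
    · filter_upwards [eventually_gt_atTop 0] with y hy
      have hyC : (y : ℂ) ≠ 0 := by exact_mod_cast hy.ne'
      simp only [hh, Function.comp_apply]
      rw [smul_sub, smul_smul, show (1 : ℂ) - 2 * s = -2 * s + 1 by ring, Complex.cpow_add _ _ hyC,
        Complex.cpow_one]
      push_cast
      rw [show (-1 + (y : ℂ)⁻¹ + 1)⁻¹ = y by rw [neg_add_cancel_comm, inv_inv]]
    · exact Eventually.of_forall fun y => by simp
  have hx0 : 0 < x + 1 := by linarith [hx.1]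
  have hy : 1 < (x + 1)⁻¹ := (one_lt_inv₀ hx0).mpr (by linarith [hx.2])
  have h0 := eq_zero_of_quasiPeriodic (χ k₂) one_pos hper hs has hy
  simp only [hh, inv_inv] at h0
  rw [neg_add_cancel_comm_assoc] at h0
  refine (smul_eq_zero.mp h0).resolve_left fun h1 => ?_
  rw [Complex.cpow_eq_zero_iff, Complex.ofReal_eq_zero] at h1
  exact (inv_pos.mpr hx0).ne' h1.1

lemma eq_zero_of_alpha_k₁_inv_fixed (hs : s ∈ contDomain) {D : ℝ → V}
    (hD : ∀ x ∈ Ec, D x = alpha χ s k₁⁻¹ D x) {c : V}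
    (hc : (fun x : ℝ => D x - (x : ℂ) ^ (1 - 2 * s) • c)
      =O[atTop] fun x : ℝ => (x : ℂ) ^ (-2 * s)) {x : ℝ} (hx : x ∈ Ec) : D x = 0 :=
  eq_zero_of_quasiPeriodic (χ k₁⁻¹) two_pos
    (fun y hy => by rw [← alpha_k₁_inv (s := s)]; exact hD y hy) hs hc hx

variable [FiniteDimensional ℂ V]

lemma fastDefined_of_mem (hs : s ∈ contDomain) {f : Vec V} (hf : f ∈ fastSpace χ s) :
    FastDefined χ s f := by
  obtain ⟨Φc, -, hc, -⟩ := exists_fastOne_solution hs hf.2.2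
  obtain ⟨Φa, -, ha, -⟩ := exists_fastTwo_solution (χ := χ) hs hf.1
  exact fun x hx => ⟨⟨_, hc x hx⟩, ⟨_, ha x hx⟩⟩

/-- The relations between a fast eigenvector `f` and its slow eigenfunction `φ`:
`φ` has the required asymptotics, `L_{1,s}^fast f_c = α_s(k₁⁻¹) φ`, `L_{2,s}^fast f_a = α_s(k₂) φ`,
and `f` is recovered from `φ`. -/
lemma slowOfFast_spec (hs : s ∈ contDomain) {f : Vec V} (hf : f ∈ FFE χ hs ε) :
    slowOfFast χ s ε f ∈ SFEas χ s ε ∧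
    (∀ x ∈ I₀, fastOne χ s f.2.2 x = alpha χ s k₁⁻¹ (extZero I₀ (slowOfFast χ s ε f)) x) ∧
    (∀ x ∈ I₀, fastTwo χ s f.1 x = alpha χ s k₂ (extZero I₀ (slowOfFast χ s ε f)) x) ∧
    fastOfSlow χ s (slowOfFast χ s ε f) = f := by
  have := FiniteDimensional.complete ℂ V
  obtain ⟨hfB, -, fixA, fixB, fixC⟩ := hf
  obtain ⟨Φc, Φc_an, Φc_sum, Φc_eq, cc, Φc_as⟩ := exists_fastOne_solution hs hfB.2.2
  obtain ⟨Φa, Φa_an, Φa_sum, Φa_eq, ca, Φa_as⟩ := exists_fastTwo_solution (χ := χ) hs hfB.1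
  have h1 : ∀ x ∈ I₀, fastOne χ s f.2.2 x = alpha χ s k₁⁻¹ Φc x := fun x hx =>
    (Φc_sum x hx).continuedSum_eq hs
  have h2 : ∀ x ∈ I₀, fastTwo χ s f.1 x = alpha χ s k₂ Φa x := fun x hx =>
    (Φa_sum x hx).continuedSum_eq hs
  set φ := slowOfFast χ s ε f with hφ
  have hφx : ∀ x ∈ I₀, extZero I₀ φ x = alpha χ s k₂ Φa x +
      ε • alpha χ s (k₂ * elJ) (extZero Eb f.2.1) x + alpha χ s k₁⁻¹ Φc x := fun x hx => by
    rw [extZero_of_mem _ hx, hφ, slowOfFast, h1 x hx, h2 x hx]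
  have hA : EqOn (extZero I₀ φ) Φa Ea := fun x hx => by
    have hx' := Ea_subset hx
    have h3 := fixA ⟨x, hx⟩
    rw [h1 x hx'] at h3
    rw [hφx x hx', Φa_eq x hx, extZero_of_mem _ hx, h3]
    abel
  have hB : EqOn (extZero I₀ φ) (extZero Eb f.2.1) Eb := fun x hx => by
    have hx' := Eb_subset hx
    have h3 := fixB ⟨x, hx⟩
    rw [h1 x hx', h2 x hx'] at h3
    rw [hφx x hx', extZero_of_mem _ hx, h3]
  have hC : EqOn (extZero I₀ φ) Φc Ec := fun x hx => by
    have hx' := Ec_subset hx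
    have h3 := fixC ⟨x, hx⟩
    rw [h2 x hx'] at h3
    rw [hφx x hx', Φc_eq x hx, extZero_of_mem _ hx, h3]
  have h1' : ∀ x ∈ I₀, fastOne χ s f.2.2 x = alpha χ s k₁⁻¹ (extZero I₀ φ) x := fun x hx => by
    rw [h1 x hx, alpha_k₁_inv_congr hC hx]
  have h2' : ∀ x ∈ I₀, fastTwo χ s f.1 x = alpha χ s k₂ (extZero I₀ φ) x := fun x hx => by
    rw [h2 x hx, alpha_k₂_congr hA hx]
  have hSFE : φ ∈ SFE χ s ε := by
    refine ⟨fun x hx => ?_, fun x => ?_⟩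
    · have a1 := analyticAt_alpha_k₂ (χ := χ) (s := s) (le_of_lt hx) (Φa_an _ (neg_inv_mem_Ea hx))
      have a2 := analyticAt_alpha_k₂J (χ := χ) (s := s) (le_of_lt hx)
        (hfB.2.1.analyticOnNhd isOpen_Ioo _ (inv_mem_Eb hx))
      have a3 := analyticAt_alpha_k₁_inv (χ := χ) (s := s) (Φc_an _ (add_two_mem_Ec hx))
      refine ((a1.add (analyticAt_unit_smul ε a2)).add a3).congr ?_
      filter_upwards [isOpen_Ioi.mem_nhds hx] with y hy
      exact (hφx y hy).symm
    · have h3 := hφx x x.2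
      rw [extZero_of_mem _ x.2, ← alpha_k₂_congr hA x.2, ← alpha_k₂J_congr hB x.2,
        ← alpha_k₁_inv_congr hC x.2] at h3
      change φ x = alpha χ s k₁⁻¹ (extZero I₀ φ) x + alpha χ s k₂ (extZero I₀ φ) x +
        ε • alpha χ s (k₂ * elJ) (extZero I₀ φ) x
      rw [h3]
      abel
  refine ⟨⟨hSFE, cc, ca, ?_, ?_⟩, h1', h2', ?_⟩
  · refine Φc_as.congr' ?_ EventuallyEq.rfl
    filter_upwards [eventually_gt_atTop 1] with x hx
    rw [hC hx]
  · refine Φa_as.congr' ?_ EventuallyEq.rfl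
    filter_upwards [Ioo_mem_nhdsGT (show (-1 : ℝ) < 0 by norm_num)] with x hx
    rw [hA hx]
  · refine Prod.ext (funext fun x => ?_) (Prod.ext (funext fun x => ?_) (funext fun x => ?_))
    · change φ ⟨x, Ea_subset x.2⟩ - _ = _
      rw [← extZero_of_mem φ (Ea_subset x.2), hA x.2, Φa_eq x x.2,
        alpha_k₂_congr hA (Ea_subset x.2), extZero_of_mem _ x.2, add_sub_cancel_right]
    · change φ ⟨x, Eb_subset x.2⟩ = _
      rw [← extZero_of_mem φ (Eb_subset x.2), hB x.2, extZero_of_mem _ x.2]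
    · change φ ⟨x, Ec_subset x.2⟩ - _ = _
      rw [← extZero_of_mem φ (Ec_subset x.2), hC x.2, Φc_eq x x.2,
        alpha_k₁_inv_congr hC (Ec_subset x.2), extZero_of_mem _ x.2, add_sub_cancel_right]

/-- The fast vector of a slow eigenfunction consists of germs of holomorphic functions: by the slow
equation its components only involve values of `φ` on compact subsets of `(-1, ∞)`. -/
lemma fastOfSlow_mem_fastSpace {φ : I₀ → V} (hφ : φ ∈ SFE χ s ε) :
    fastOfSlow χ s φ ∈ fastSpace χ s := by
  have := FiniteDimensional.complete ℂ V
  set F := extZero I₀ φ with hF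
  have han := hφ.1
  rw [← hF] at han
  refine ⟨?_, ?_, ?_⟩
  · -- By the slow equation, `f_a = α_s(k₁⁻¹) φ ± α_s(k₂ J) φ`.
    have h1 : AnalyticOnNhd ℝ (alpha χ s k₁⁻¹ F + ε • alpha χ s (k₂ * elJ) F) (Icc (-1) 0) := by
      intro x hx
      have h2 : 0 < (x + 2)⁻¹ := inv_pos.mpr (by linarith [hx.1])
      exact (analyticAt_alpha_k₁_inv (han _ (by simp only [mem_Ioi]; linarith [hx.1]))).add
        (analyticAt_unit_smul ε (analyticAt_alpha_k₂J hx.1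
          (han _ (by simp only [mem_Ioi]; linarith))))
    refine (isGerm_of_analyticOnNhd (by norm_num) h1).congr fun x hx => ?_
    rw [fastOfSlow_fst hx, slow_eq hφ (Ea_subset hx)]
    simp only [Pi.add_apply, Pi.smul_apply, ← hF]
    abel
  · refine (isGerm_of_analyticOnNhd zero_lt_one fun x hx => ?_).congr
      fun x hx => (fastOfSlow_snd (χ := χ) (s := s) hx).symm
    exact han x (by simp only [mem_Ioi]; linarith [hx.1])
  · -- By the slow equation, `f_c = α_s(k₂) φ ± α_s(k₂ J) φ`; here `Q k₂` and `Q k₂ J` act on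
    -- `[0, 1]` without poles.
    have h1 : AnalyticOnNhd ℝ (alpha χ s (elQ * k₂) F + ε • alpha χ s (elQ * (k₂ * elJ)) F)
        (Icc 0 1) := by
      intro x hx
      have h0 : 0 < 2 * x + 1 := by linarith [hx.1]
      refine (analyticAt_alpha coe_Qk₂_inv (by simpa using h0.ne') (han _ ?_)).add
        (analyticAt_unit_smul ε
          (analyticAt_alpha coe_Qk₂J_inv (by simpa using h0.ne') (han _ ?_)))
      · have h3 : -1 < -x / (2 * x + 1) := by
          rw [lt_div_iff₀ h0]
          linarith [hx.1]
        simpa using h3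
      · have h3 : -1 < x / (2 * x + 1) := by
          rw [lt_div_iff₀ h0]
          linarith [hx.1]
        simpa using h3
    refine (isGerm_of_analyticOnNhd zero_lt_one h1).congr fun x hx => ?_
    have hx0 := hx.1
    have hxi : x⁻¹ ∈ Ec := (one_lt_inv₀ hx0).mpr hx.2
    have e1 := alpha_mul_apply (χ := χ) (s := s) coe_Q_inv coe_k₂_inv (x := x)
      (by simpa using hx0.ne') F
    have e2 := alpha_mul_apply (χ := χ) (s := s) coe_Q_inv coe_k₂J_inv (x := x)
      (by simpa using hx0.ne') F
    have e3 : extZero Ec (fastOfSlow χ s φ).2.2 x⁻¹ =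
        alpha χ s k₂ F x⁻¹ + ε • alpha χ s (k₂ * elJ) F x⁻¹ := by
      rw [fastOfSlow_trd hxi, slow_eq hφ (Ec_subset hxi), ← hF]
      abel
    rw [alpha_Q _ hx0, e3, Pi.add_apply, Pi.smul_apply, e1, e2, alpha_Q _ hx0, alpha_Q _ hx0,
      map_add, smul_add, unit_smul_eq, unit_smul_eq, ← Complex.coe_smul, ← Complex.coe_smul,
      map_smul, smul_comm]

lemma fastOfSlow_spec (hs : s ∈ contDomain) {φ : I₀ → V} (hφ : φ ∈ SFEas χ s ε) :
    fastOfSlow χ s φ ∈ FFE χ hs ε ∧ slowOfFast χ s ε (fastOfSlow χ s φ) = φ := by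
  obtain ⟨hSFE, c₁, c₂, has₁, has₂⟩ := hφ
  have hB := fastOfSlow_mem_fastSpace hSFE
  obtain ⟨Φc, -, Φc_sum, Φc_eq, cc, Φc_as⟩ := exists_fastOne_solution hs hB.2.2
  obtain ⟨Φa, -, Φa_sum, Φa_eq, ca, Φa_as⟩ := exists_fastTwo_solution (χ := χ) hs hB.1
  set F := extZero I₀ φ with hF
  have hC : EqOn Φc F Ec := fun x hx => by
    have h := eq_zero_of_alpha_k₁_inv_fixed (χ := χ) (D := Φc - F) hs (fun x hx => by
      rw [map_sub, Pi.sub_apply, Pi.sub_apply, Φc_eq x hx, fastOfSlow_trd hx, ← hF]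
      abel) (isBigO_sub_sub Φc_as has₁) hx
    exact sub_eq_zero.mp h
  have hone : (fun _ : ℝ => (1 : ℝ)) =O[𝓝[>] (-1)] fun _ => (1 : ℂ) :=
    isBigO_const_const _ one_ne_zero _
  have hA : EqOn Φa F Ea := fun x hx => by
    have h := eq_zero_of_alpha_k₂_fixed (χ := χ) (D := Φa - F) hs (fun x hx => by
      rw [map_sub, Pi.sub_apply, Pi.sub_apply, Φa_eq x hx, fastOfSlow_fst hx, ← hF]
      abel) (isBigO_sub_sub (Φa_as.trans hone) (has₂.trans hone)) hx
    exact sub_eq_zero.mp h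
  have h1 : ∀ x ∈ I₀, fastOne χ s (fastOfSlow χ s φ).2.2 x = alpha χ s k₁⁻¹ F x := fun x hx => by
    rw [← alpha_k₁_inv_congr hC hx]
    exact (Φc_sum x hx).continuedSum_eq hs
  have h2 : ∀ x ∈ I₀, fastTwo χ s (fastOfSlow χ s φ).1 x = alpha χ s k₂ F x := fun x hx => by
    rw [← alpha_k₂_congr hA hx]
    exact (Φa_sum x hx).continuedSum_eq hs
  have h3 : ∀ x ∈ I₀, alpha χ s (k₂ * elJ) (extZero Eb (fastOfSlow χ s φ).2.1) x =
      alpha χ s (k₂ * elJ) F x := fun x hx =>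
    alpha_k₂J_congr (fun y hy => fastOfSlow_snd hy) hx
  refine ⟨⟨hB, fastDefined_of_mem hs hB, fun x => ?_, fun x => ?_, fun x => ?_⟩,
    funext fun x => ?_⟩
  · rw [h1 x (Ea_subset x.2), h3 x (Ea_subset x.2),
      ← extZero_of_mem (fastOfSlow χ s φ).1 x.2, fastOfSlow_fst x.2,
      slow_eq hSFE (Ea_subset x.2), ← hF]
    abel
  · rw [h1 x (Eb_subset x.2), h2 x (Eb_subset x.2), h3 x (Eb_subset x.2),
      ← extZero_of_mem (fastOfSlow χ s φ).2.1 x.2, fastOfSlow_snd x.2,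
      slow_eq hSFE (Eb_subset x.2), ← hF]
    abel
  · rw [h2 x (Ec_subset x.2), h3 x (Ec_subset x.2),
      ← extZero_of_mem (fastOfSlow χ s φ).2.2 x.2, fastOfSlow_trd x.2,
      slow_eq hSFE (Ec_subset x.2), ← hF]
    abel
  · rw [slowOfFast, h1 x x.2, h2 x x.2, h3 x x.2, ← extZero_of_mem φ x.2, slow_eq hSFE x.2, ← hF]
    abel

end Maps

/-! ### Smooth extensions -/

section SmoothExtension

variable {V : Type*} [NormedAddCommGroup V] [InnerProductSpace ℂ V]
  {χ : triangleGroup →* (V ≃ₗᵢ[ℂ] V)} {s : ℂ} {ε : ℤˣ}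

lemma ExtendsSmoothly.mono {I J D I' J' D' : Set ℝ} {g h : ℝ → V}
    (H : ExtendsSmoothly I J D g h) (hI : I' ⊆ I) (hJ : J' ⊆ J) (hD : D' ⊆ D) :
    ExtendsSmoothly I' J' D' g h := by
  obtain ⟨F, h₁, h₂, h₃⟩ := H
  exact ⟨F, h₁.mono hD, h₂.mono hI, h₃.mono hJ⟩

lemma ExtendsSmoothly.symm {I J D : Set ℝ} {g h : ℝ → V} (H : ExtendsSmoothly I J D g h) :
    ExtendsSmoothly J I D h g := by
  obtain ⟨F, h₁, h₂, h₃⟩ := H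
  exact ⟨F, h₁, h₃, h₂⟩

/-- Two functions that are smooth on the two sides of `p` and fit together smoothly near `p` fit
together to a smooth function on the line. -/
lemma ExtendsSmoothly.exists_contDiff {l p r : ℝ} (hl : l < p) (hr : p < r) {g h : ℝ → V}
    (hg : ∀ x, p < x → ContDiffAt ℝ ∞ g x) (hh : ∀ x, x < p → ContDiffAt ℝ ∞ h x)
    (H : ExtendsSmoothly (Ioo p r) (Ioo l p) (Ioo l r) g h) :
    ∃ F : ℝ → V, ContDiff ℝ ∞ F ∧ EqOn F g (Ioi p) ∧ EqOn F h (Iio p) := by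
  obtain ⟨E, hE, hEg, hEh⟩ := H
  classical
  set F : ℝ → V := fun x => if p < x then g x else if x < p then h x else E x with hF
  have h1 : EqOn F g (Ioi p) := fun x hx => if_pos hx
  have h2 : EqOn F h (Iio p) := fun x hx => by
    simp only [hF]
    rw [if_neg (not_lt.mpr (le_of_lt hx)), if_pos (mem_Iio.mp hx)]
  have h3 : EqOn F E (Ioo l r) := fun x hx => by
    rcases lt_trichotomy x p with hxp | rfl | hxp
    · rw [h2 hxp, hEh ⟨hx.1, hxp⟩]
    · simp [hF]
    · rw [h1 hxp, hEg ⟨hxp, hx.2⟩]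
  refine ⟨F, contDiff_iff_contDiffAt.mpr fun x => ?_, h1, h2⟩
  rcases lt_trichotomy x p with hxp | rfl | hxp
  · exact (hh x hxp).congr_of_eventuallyEq (h2.eventuallyEq_of_mem (Iio_mem_nhds hxp))
  · exact ((hE.contDiffAt (Ioo_mem_nhds hl hr)).congr_of_eventuallyEq
      (h3.eventuallyEq_of_mem (Ioo_mem_nhds hl hr)))
  · exact (hg x hxp).congr_of_eventuallyEq (h1.eventuallyEq_of_mem (Ioi_mem_nhds hxp))

lemma alpha_S_TinvJ (F : ℝ → V) {x : ℝ} (hx : x ≠ 0) :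
    alpha χ s elS (alpha χ s (elT⁻¹ * elJ) F) x = alpha χ s (elS * elT⁻¹ * elJ) F x := by
  rw [mul_assoc]
  exact (alpha_mul_apply coe_S_inv coe_TinvJ_inv (by simpa using hx) F).symm

lemma alpha_unit_smul (g : triangleGroup) (ε : ℤˣ) (F : ℝ → V) :
    alpha χ s g (ε • F) = ε • alpha χ s g F := by
  rw [Units.smul_def, Units.smul_def, map_zsmul]

lemma contDiffAt_unit_smul {F : ℝ → V} {x : ℝ} (ε : ℤˣ) (hF : ContDiffAt ℝ ∞ F x) :
    ContDiffAt ℝ ∞ (ε • F) x := by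
  have h : ε • F = ((ε : ℤ) : ℝ) • F := funext fun y => unit_smul_eq ε (F y)
  rw [h]
  exact contDiffAt_const.smul hF

lemma contDiffAt_of_analyticOnNhd_I₀ [CompleteSpace V] {F : ℝ → V} (hF : AnalyticOnNhd ℝ F I₀)
    {x : ℝ} (hx : -1 < x) : ContDiffAt ℝ ∞ F x :=
  (hF x hx).contDiffAt

/-- Smoothness at `0` of the first pair of functions in the definition of `SFEdec` is a condition
near `0`, where only the values of `F` on `E_b` and `E_c` matter. -/
lemma extendsSmoothly_zero_iff [CompleteSpace V] {F B C : ℝ → V} (hF : AnalyticOnNhd ℝ F I₀)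
    (hB : EqOn B F Eb) (hC : EqOn C F Ec) :
    ExtendsSmoothly (Ioo 0 1) (Ioo (-1) 0) (Ioo (-1) 1) (B + ε • alpha χ s elQ C)
      (-alpha χ s elS C - ε • alpha χ s elJ B) ↔
    ExtendsSmoothly (Ioi 0) (Iio 0) univ (F + ε • alpha χ s elQ F)
      (-alpha χ s elS F - ε • alpha χ s elJ F) := by
  have e1 : EqOn (B + ε • alpha χ s elQ C) (F + ε • alpha χ s elQ F) (Ioo 0 1) := fun x hx => by
    have h1 : x⁻¹ ∈ Ec := (one_lt_inv₀ hx.1).mpr hx.2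
    simp only [Pi.add_apply, Pi.smul_apply]
    rw [alpha_Q _ hx.1, alpha_Q _ hx.1, hB hx, hC h1]
  have e2 : EqOn (-alpha χ s elS C - ε • alpha χ s elJ B)
      (-alpha χ s elS F - ε • alpha χ s elJ F) (Ioo (-1) 0) := fun x hx => by
    have h1 : -x⁻¹ ∈ Ec := by
      rw [← inv_neg, mem_Ioi]
      exact (one_lt_inv₀ (by linarith [hx.2])).mpr (by linarith [hx.1])
    have h2 : -x ∈ Eb := ⟨by linarith [hx.2], by linarith [hx.1]⟩
    simp only [Pi.sub_apply, Pi.smul_apply, Pi.neg_apply]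
    rw [alpha_S _ hx.2.ne, alpha_S _ hx.2.ne, alpha_J, alpha_J, hB h2, hC h1]
  constructor
  · intro H
    have hright : ∀ x : ℝ, 0 < x → ContDiffAt ℝ ∞ (F + ε • alpha χ s elQ F) x := by
      intro x hx
      refine (contDiffAt_of_analyticOnNhd_I₀ hF (by linarith)).add
        (contDiffAt_unit_smul ε (contDiffAt_alpha coe_Q_inv (by simpa using hx.ne')
          (contDiffAt_of_analyticOnNhd_I₀ hF ?_)))
      have := inv_pos.mpr hx
      simp
      linarith
    have hleft : ∀ x : ℝ, x < 0 →
        ContDiffAt ℝ ∞ (-alpha χ s elS F - ε • alpha χ s elJ F) x := by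
      intro x hx
      refine (contDiffAt_alpha coe_S_inv (by simpa using hx.ne)
        (contDiffAt_of_analyticOnNhd_I₀ hF ?_)).neg.sub (contDiffAt_unit_smul ε
          (contDiffAt_alpha coe_J_inv (by simp) (contDiffAt_of_analyticOnNhd_I₀ hF ?_)))
      · have := inv_lt_zero.mpr hx
        simp [neg_div]
        linarith
      · simp
        linarith
    obtain ⟨E, hE, hE1, hE2⟩ := (H.congr e1 e2).exists_contDiff (by norm_num) (by norm_num)
      hright hleft
    exact ⟨E, hE.contDiffOn, hE1, hE2⟩
  · intro H
    exact (H.mono Ioo_subset_Ioi_self Ioo_subset_Iio_self (subset_univ _)).congr e1.symm e2.symm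

/-- A smooth extension to `P¹(ℝ)` of the second pair of functions in the definition of `SFEdec`
exists as soon as the functions fit together near the cusps `-1` and `∞`. -/
lemma extendsSmoothlyP1_iff [CompleteSpace V] {F A C : ℝ → V} (hF : AnalyticOnNhd ℝ F I₀)
    (hA : EqOn A F Ea) (hC : EqOn C F Ec) :
    ExtendsSmoothly (Ioo (-1) 0) (Ioo (-2) (-1)) (Ioo (-2) 0)
      A (-(ε • alpha χ s (elT⁻¹ * elJ) A)) ∧
    ExtendsSmoothly (Ioo (-1) 0) (Ioo 0 (1 / 3)) (Ioo (-1) (1 / 3))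
      (alpha χ s elS C) (-(ε • alpha χ s (elS * elT⁻¹ * elJ) C)) ↔
    ExtendsSmoothlyP1 χ s (Ioi (-1)) (Iio (-1)) F (-(ε • alpha χ s (elT⁻¹ * elJ) F)) := by
  have e1 : EqOn (-(ε • alpha χ s (elT⁻¹ * elJ) A)) (-(ε • alpha χ s (elT⁻¹ * elJ) F))
      (Ioo (-2) (-1)) := fun x hx => by
    have h1 : -(x + 2) ∈ Ea := ⟨by linarith [hx.2], by linarith [hx.1]⟩
    simp only [Pi.smul_apply, Pi.neg_apply]
    rw [alpha_TinvJ, alpha_TinvJ, hA h1]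
  -- In the chart at infinity, the extension reads `F` left of `0` and its `T⁻¹ J`-image right of
  -- `0`; both only use values of `F` on `E_c` near `0`.
  have e2 : ∀ {E : ℝ → V}, EqOn E F (Ioi (-1)) →
      EqOn (alpha χ s elS E) (alpha χ s elS C) (Ioo (-1) 0) := fun {E} hE x hx => by
    have h1 : -x⁻¹ ∈ Ec := by
      rw [← inv_neg, mem_Ioi]
      exact (one_lt_inv₀ (by linarith [hx.2])).mpr (by linarith [hx.1])
    rw [alpha_S _ hx.2.ne, alpha_S _ hx.2.ne, hE (Ec_subset h1), hC h1]
  have e3 : ∀ {E : ℝ → V}, EqOn E (-(ε • alpha χ s (elT⁻¹ * elJ) F)) (Iio (-1)) →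
      EqOn (alpha χ s elS E) (-(ε • alpha χ s (elS * elT⁻¹ * elJ) C)) (Ioo 0 (1 / 3)) :=
    fun {E} hE x hx => by
      have h0 : 3 < x⁻¹ := by
        rw [lt_inv_comm₀ (by norm_num) hx.1]
        linarith [hx.2]
      have h1 : x⁻¹ - 2 ∈ Ec := by
        simp only [mem_Ioi]
        linarith
      have h2 : alpha χ s elS E x =
          alpha χ s elS (-(ε • alpha χ s (elT⁻¹ * elJ) F)) x := by
        rw [alpha_S _ hx.1.ne', alpha_S _ hx.1.ne', hE (by simp only [mem_Iio]; linarith)]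
      rw [h2, map_neg, alpha_unit_smul, Pi.neg_apply, Pi.smul_apply, alpha_S_TinvJ _ hx.1.ne',
        Pi.neg_apply, Pi.smul_apply, alpha_STinvJ _ hx.1.ne', alpha_STinvJ _ hx.1.ne', hC h1]
  constructor
  · rintro ⟨H1, H2⟩
    have hleft : ∀ x : ℝ, x < -1 → ContDiffAt ℝ ∞ (-(ε • alpha χ s (elT⁻¹ * elJ) F)) x := by
      intro x hx
      refine (contDiffAt_unit_smul ε (contDiffAt_alpha coe_TinvJ_inv (by simp)
        (contDiffAt_of_analyticOnNhd_I₀ hF ?_))).neg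
      simp
      linarith
    obtain ⟨E, hE, hE1, hE2⟩ := (H1.congr hA e1).exists_contDiff (by norm_num) (by norm_num)
      (fun x hx => contDiffAt_of_analyticOnNhd_I₀ hF hx) hleft
    have hSE : ∀ x : ℝ, x ≠ 0 → ContDiffAt ℝ ∞ (alpha χ s elS E) x := fun x hx =>
      contDiffAt_alpha coe_S_inv (by simpa using hx) hE.contDiffAt
    obtain ⟨E', hE', hE1', hE2'⟩ := (H2.symm.congr (e3 hE2).symm (e2 hE1).symm).exists_contDiff
      (by norm_num) (by norm_num) (fun x hx => hSE x hx.ne') (fun x hx => hSE x hx.ne)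
    refine ⟨E, hE, hE1, hE2, E', hE', fun x hx => ?_⟩
    rcases lt_or_gt_of_ne (show x ≠ 0 from hx) with h | h
    · exact hE2' h
    · exact hE1' h
  · rintro ⟨E, hE, hE1, hE2, E', hE', hEE'⟩
    refine ⟨⟨E, hE.contDiffOn, (hE1.mono Ioo_subset_Ioi_self).trans hA.symm,
      (hE2.mono Ioo_subset_Iio_self).trans e1.symm⟩, E', hE'.contDiffOn, fun x hx => ?_,
      fun x hx => ?_⟩
    · rw [hEE' hx.2.ne, e2 hE1 hx]
    · rw [hEE' hx.1.ne', e3 hE2 hx]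

/-- A slow eigenfunction that extends smoothly to `P¹(ℝ)` has the asymptotics defining `SFEas`,
with both leading coefficients zero. -/
lemma SFEdec_le_SFEas : SFEdec χ s ε ≤ SFEas (V := V) χ s ε := by
  rintro φ ⟨hφ, -, E, hE, hE1, -, E', hE', hEE'⟩
  refine ⟨hφ, 0, 0, ?_, ?_⟩
  · simp only [smul_zero, sub_zero]
    have htend : Tendsto (fun x : ℝ => -x⁻¹) atTop (𝓝 0) := by
      simpa using (tendsto_inv_atTop_zero (𝕜 := ℝ)).neg
    have h1 : (fun x : ℝ => E' (-x⁻¹)) =O[atTop] fun _ => (1 : ℝ) :=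
      ((hE'.continuous.tendsto 0).comp htend).isBigO_one ℝ
    have h2 := (isBigO_refl (fun x : ℝ => ‖(x : ℂ) ^ (-2 * s)‖) atTop).mul h1.norm_left
    refine IsBigO.trans (IsBigO.of_norm_left (h2.congr' ?_ EventuallyEq.rfl)) ?_
    · filter_upwards [eventually_gt_atTop 0] with x hx
      have hxi := inv_pos.mpr hx
      have h3 : -x⁻¹ ≠ 0 := (neg_lt_zero.mpr hxi).ne
      rw [hEE' h3, alpha_S _ h3, abs_neg, abs_of_pos hxi, inv_neg, inv_inv, neg_neg,
        hE1 (by simp only [mem_Ioi]; linarith), norm_smul, LinearIsometryEquiv.norm_map,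
        ← mul_assoc, ← norm_mul, ← ofReal_mul_cpow hx hxi, mul_inv_cancel₀ hx.ne']
      simp
    · simpa using (isBigO_refl (fun x : ℝ => (x : ℂ) ^ (-2 * s)) atTop).norm_left
  · simp only [smul_zero, sub_zero]
    refine (((hE.continuous.tendsto (-1)).isBigO_one ℝ).mono nhdsWithin_le_nhds).congr' ?_
      EventuallyEq.rfl
    filter_upwards [self_mem_nhdsWithin] with x hx
    exact hE1 hx

end SmoothExtension

/-! ### The isomorphisms -/

section Isomorphism

variable {V : Type*} [NormedAddCommGroup V] [InnerProductSpace ℂ V] [FiniteDimensional ℂ V]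
  {χ : triangleGroup →* (V ≃ₗᵢ[ℂ] V)} {s : ℂ} {ε : ℤˣ}

lemma slowOfFast_mem_SFEdec_iff (hs : s ∈ contDomain) {f : Vec V} (hf : f ∈ FFE χ hs ε) :
    slowOfFast χ s ε f ∈ SFEdec χ s ε ↔ f ∈ FFEdec χ hs ε := by
  have := FiniteDimensional.complete ℂ V
  obtain ⟨⟨hSFE, -⟩, h1, h2, h3⟩ := slowOfFast_spec hs hf
  set φ := slowOfFast χ s ε f
  have hA : EqOn (sumA χ s f) (extZero I₀ φ) Ea := fun x hx => by
    rw [sumA, extZero_of_mem _ hx, h2 x (Ea_subset hx), ← extZero_of_mem f.1 hx]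
    nth_rewrite 1 [← h3]
    rw [fastOfSlow_fst hx, sub_add_cancel]
  have hB : EqOn (extZero Eb f.2.1) (extZero I₀ φ) Eb := fun x hx => by
    nth_rewrite 1 [← h3]
    exact fastOfSlow_snd hx
  have hC : EqOn (sumC χ s f) (extZero I₀ φ) Ec := fun x hx => by
    rw [sumC, extZero_of_mem _ hx, h1 x (Ec_subset hx), ← extZero_of_mem f.2.2 hx]
    nth_rewrite 1 [← h3]
    rw [fastOfSlow_trd hx, sub_add_cancel]
  have e1 := extendsSmoothly_zero_iff (χ := χ) (s := s) (ε := ε) hSFE.1 hB hC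
  have e2 := extendsSmoothlyP1_iff (χ := χ) (s := s) (ε := ε) hSFE.1 hA hC
  exact ⟨fun h => ⟨hf, e1.mpr h.2.1, e2.mpr h.2.2⟩, fun h => ⟨hSFE, e1.mp h.2.1, e2.mp h.2.2⟩⟩

lemma slowOfFast_add (hs : s ∈ contDomain) {f g : Vec V} (hf : f ∈ FFE χ hs ε)
    (hg : g ∈ FFE χ hs ε) :
    slowOfFast χ s ε (f + g) = slowOfFast χ s ε f + slowOfFast χ s ε g := by
  funext x
  simp only [slowOfFast, Pi.add_apply, Prod.fst_add, Prod.snd_add, fastTwo_add hs hf.2.1 hg.2.1 x.2,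
    fastOne_add hs hf.2.1 hg.2.1 x.2, map_add, smul_add]
  abel

lemma slowOfFast_smul (hs : s ∈ contDomain) (c : ℂ) {f : Vec V} (hf : f ∈ FFE χ hs ε) :
    slowOfFast χ s ε (c • f) = c • slowOfFast χ s ε f := by
  funext x
  simp only [slowOfFast, Pi.smul_apply, Prod.smul_fst, Prod.smul_snd,
    fastTwo_smul hs c hf.2.1 x.2, fastOne_smul hs c hf.2.1 x.2, map_smul, smul_add, smul_comm c]

/-- The isomorphism between fast eigenvectors and slow eigenfunctions. -/
def fastSlowEquiv (χ : triangleGroup →* (V ≃ₗᵢ[ℂ] V)) (hs : s ∈ contDomain) (ε : ℤˣ) :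
    FFE χ hs ε ≃ₗ[ℂ] SFEas χ s ε where
  toFun f := ⟨slowOfFast χ s ε f, (slowOfFast_spec hs f.2).1⟩
  map_add' f g := Subtype.ext (slowOfFast_add hs f.2 g.2)
  map_smul' c f := Subtype.ext (slowOfFast_smul hs c f.2)
  invFun φ := ⟨fastOfSlow χ s φ, (fastOfSlow_spec hs φ.2).1⟩
  left_inv f := Subtype.ext (slowOfFast_spec hs f.2).2.2.2
  right_inv φ := Subtype.ext (fastOfSlow_spec hs φ.2).2

/-- The isomorphism on the subspaces cut out by smooth extendability. -/
def fastSlowEquivDec (χ : triangleGroup →* (V ≃ₗᵢ[ℂ] V)) (hs : s ∈ contDomain) (ε : ℤˣ) :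
    FFEdec χ hs ε ≃ₗ[ℂ] SFEdec χ s ε where
  toFun f := ⟨slowOfFast χ s ε f, (slowOfFast_mem_SFEdec_iff hs f.2.1).mpr f.2⟩
  map_add' f g := Subtype.ext (slowOfFast_add hs f.2.1 g.2.1)
  map_smul' c f := Subtype.ext (slowOfFast_smul hs c f.2.1)
  invFun φ := ⟨fastOfSlow χ s φ, by
    obtain ⟨h1, h2⟩ := fastOfSlow_spec hs (SFEdec_le_SFEas φ.2)
    refine (slowOfFast_mem_SFEdec_iff hs h1).mp ?_
    rw [h2]
    exact φ.2⟩
  left_inv f := Subtype.ext (slowOfFast_spec hs f.2.1).2.2.2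
  right_inv φ := Subtype.ext (fastOfSlow_spec hs (SFEdec_le_SFEas φ.2)).2

end Isomorphism

end ThetaGroup

end

/-- Slow and fast transfer operators of the Theta group: for `s ≠ 1/2` with `Re s > 0`, the
continued operators `L_{1,s}^fast`, `L_{2,s}^fast` are defined on `𝓑`, and `FFE ≃ SFEas` through
the stated maps, inducing `FFEdec ≃ SFEdec`. -/
theorem mainTheorem2 {V : Type*} [NormedAddCommGroup V] [InnerProductSpace ℂ V]
    [FiniteDimensional ℂ V]
    (χ : ThetaGroup.triangleGroup →* (V ≃ₗᵢ[ℂ] V)) (ε : ℤˣ)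
    (s : ℂ) (hs : 0 < s.re) (hs' : s ≠ 1 / 2) :
    (∀ f ∈ ThetaGroup.fastSpace χ s, ThetaGroup.FastDefined χ s f) ∧
    ∃ e : ThetaGroup.FFE χ (s := s) ⟨hs, hs'⟩ ε ≃ₗ[ℂ] ThetaGroup.SFEas χ s ε,
      (∀ f : ThetaGroup.FFE χ (s := s) ⟨hs, hs'⟩ ε,
        (∀ (x : ThetaGroup.I₀) (hx : (x : ℝ) ∈ ThetaGroup.Ea),
          (e f).1 x = f.1.1 ⟨x, hx⟩ + ThetaGroup.fastTwo χ s f.1.1 x) ∧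
        (∀ (x : ThetaGroup.I₀) (hx : (x : ℝ) ∈ ThetaGroup.Eb),
          (e f).1 x = f.1.2.1 ⟨x, hx⟩) ∧
        (∀ (x : ThetaGroup.I₀) (hx : (x : ℝ) ∈ ThetaGroup.Ec),
          (e f).1 x = f.1.2.2 ⟨x, hx⟩ + ThetaGroup.fastOne χ s f.1.2.2 x)) ∧
      (∀ φ : ThetaGroup.SFEas χ s ε,
        (∀ (x : ThetaGroup.I₀) (hx : (x : ℝ) ∈ ThetaGroup.Ea),
          (e.symm φ).1.1 ⟨x, hx⟩ = φ.1 x -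
            ThetaGroup.alpha χ s ThetaGroup.k₂ (ThetaGroup.extZero ThetaGroup.I₀ φ.1) x) ∧
        (∀ (x : ThetaGroup.I₀) (hx : (x : ℝ) ∈ ThetaGroup.Eb),
          (e.symm φ).1.2.1 ⟨x, hx⟩ = φ.1 x) ∧
        (∀ (x : ThetaGroup.I₀) (hx : (x : ℝ) ∈ ThetaGroup.Ec),
          (e.symm φ).1.2.2 ⟨x, hx⟩ = φ.1 x -
            ThetaGroup.alpha χ s ThetaGroup.k₁⁻¹ (ThetaGroup.extZero ThetaGroup.I₀ φ.1) x)) ∧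
      ∃ e' : ThetaGroup.FFEdec χ (s := s) ⟨hs, hs'⟩ ε ≃ₗ[ℂ] ThetaGroup.SFEdec χ s ε,
        ∀ f : ThetaGroup.FFEdec χ (s := s) ⟨hs, hs'⟩ ε,
          (e' f).1 = (e ⟨f.1, ThetaGroup.FFEdec_le _ ε f.2⟩).1 := by
  refine ⟨fun f hf => ThetaGroup.fastDefined_of_mem ⟨hs, hs'⟩ hf,
    ThetaGroup.fastSlowEquiv χ ⟨hs, hs'⟩ ε, fun f => ?_, fun φ => ⟨fun _ _ => rfl, fun _ _ => rfl,
      fun _ _ => rfl⟩, ThetaGroup.fastSlowEquivDec χ ⟨hs, hs'⟩ ε, fun f => rfl⟩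
  obtain ⟨-, h1, h2, h3⟩ := ThetaGroup.slowOfFast_spec (s := s) ⟨hs, hs'⟩ f.2
  refine ⟨fun x hx => ?_, fun x hx => ?_, fun x hx => ?_⟩
  · change ThetaGroup.slowOfFast χ s ε f.1 x = _
    have h4 := congrFun (congrArg (fun g : ThetaGroup.Vec V => g.1) h3) ⟨x, hx⟩
    rw [h2 x x.2, ← h4]
    exact (sub_add_cancel _ _).symm
  · exact congrFun (congrArg (fun g : ThetaGroup.Vec V => g.2.1) h3) ⟨x, hx⟩
  · change ThetaGroup.slowOfFast χ s ε f.1 x = _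
    have h4 := congrFun (congrArg (fun g : ThetaGroup.Vec V => g.2.2) h3) ⟨x, hx⟩
    rw [h1 x x.2, ← h4]
    exact (sub_add_cancel _ _).symm
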